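/- **Conventions.** Let $N\ge 1$ and $\mathcal D=\{(a,b)\in\mathbb Z_{\ge0}^2: a+b\le N\}$; let $A_2=\{(0,0),\pm(1,-1),\pm(1,0),\pm(0,1)\}\subset\mathbb Z^2$, and call $\lambda,\chi\in\mathcal D$ adjacent if $\lambda-\chi\in A_2$. Write $(a)_n=\prod_{k<n}(a+k)$, $(a_1,a_2)_n=(a_1)_n(a_2)_n$, $\binom N{a,b}=\frac{N!}{(N-a-b)!\,a!\,b!}$. A parameter array of diameter $d$ is $\Phi=(\theta_i,\theta^\star_i\ (0\le i\le d);\varphi_j,\phi_j\ (1\le j\le d))$, complex numbers satisfying Terwilliger's conditions: the $\theta_i$ are distinct, the $\theta_i^\star$ are distinct, $\varphi_i\phi_i\ne0$, $\varphi_i=\phi_1\vartheta_i+(\theta^\star_i-\theta^\star_0)(\theta_{i-1}-\theta_d)$ and $\phi_i=\varphi_1\vartheta_i+(\theta^\star_i-\theta^\star_0)(\theta_{d-i+1}-\theta_0)$ for $1\le i\le d$, where $\vartheta_i=\sum_{h<i}\frac{\theta_h-\theta_{d-h}}{\theta_0-\theta_d}$, and $\frac{\theta_{i-2}-\theta_{i+1}}{\theta_{i-1}-\theta_i}$,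 $\frac{\theta^\star_{i-2}-\theta^\star_{i+1}}{\theta^\star_{i-1}-\theta^\star_i}$ are equal and independent of $i$ for $2\le i\le d-1$. Put $\Phi^\star=(\theta^\star_i,\theta_i;\varphi_j,\phi_{d-j+1})$ and $$b_i(\Phi)=\varphi_{i+1}\frac{\prod_{h=0}^{i-1}(\theta^\star_i-\theta^\star_h)}{\prod_{h=0}^{i}(\theta^\star_{i+1}-\theta^\star_h)},\quad c_i(\Phi)=\phi_i\frac{\prod_{h=0}^{d-i-1}(\theta^\star_i-\theta^\star_{d-h})}{\prod_{h=0}^{d-i}(\theta^\star_{i-1}-\theta^\star_{d-h})},\quad a_i(\Phi)=\theta_i+\frac{\varphi_i}{\theta^\star_i-\theta^\star_{i-1}}+\frac{\varphi_{i+1}}{\theta^\star_i-\theta^\star_{i+1}},$$ with $b_{-1}=b_d=c_0=c_{d+1}=0$ and the terms with $\varphi_0,\varphi_{d+1}$ absent from $a_i$. For $0\le x,i\le d$ put $p_{xi}(\Phi)=k_i(\Phi)\,u_i(\theta_x)$, where $$u_i(\lambda)=\sum_{k=0}^i\prod_{j=0}^{k-1}\frac{(\lambda-\theta_j)(\theta^\star_i-\theta^\star_j)}{\varphi_{j+1}},\quad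 k_i(\Phi)=\prod_{h=1}^i\frac{\varphi_h}{\phi_h}\,\frac{\prod_{h=1}^d(\theta^\star_0-\theta^\star_h)}{\prod_{0\le h\le d,\,h\ne i}(\theta^\star_i-\theta^\star_h)},\quad \nu(\Phi)=\prod_{h=1}^d\frac{(\theta_0-\theta_h)(\theta^\star_0-\theta^\star_h)}{\phi_h}.$$ All quantities with indices out of range ($p_{xi}(\Phi)$, vectors labelled outside $\mathcal D$) are read as $0$. Consider families $\Phi_j=(t_x,t^\star_x(j);f_x(j),g_x(j))$ of diameter $N-j$ ($0\le j\le N$) and $\Psi_x=(\theta_j(x),\theta^\star_j;\varphi_j(x),\phi_j(x))$ of diameter $N-x$ ($0\le x\le N$). They are *compatible* with coefficients $C^{\epsilon,\epsilon'}_{i,j}$, $D^{\epsilon,\epsilon'}_{x,y}$ and weights $F,G$ if, for $(i,j),(x,y)\in\mathcal D$ (and, in the first three equations, all $0\le x\le N$; in the next three, all $0\le j\le N$), $$c_{j+1}(\Psi_x)p_{xi}(\Phi_j)=\sum_{\epsilon=-1,0}C^{\epsilon,1}_{i,j}p_{x,i+\epsilon}(\Phi_{j+1}),\qquad a_j(\Psi_x)p_{xi}(\Phi_j)=\sum_{\epsilon=0,\pm1}C^{\epsilon,0}_{i,j}p_{x,i+\epsilon}(\Phi_j),$$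 $$b_{j-1}(\Psi_x)p_{xi}(\Phi_j)=\sum_{\epsilon=0,1}C^{\epsilon,-1}_{i,j}p_{x,i+\epsilon}(\Phi_{j-1}),$$ $$c_{x+1}(\Phi_j^\star)p_{jy}(\Psi_x^\star)=\tfrac{\nu(\Psi_x)}{\nu(\Psi_{x+1})}\sum_{\epsilon'=-1,0}D^{1,\epsilon'}_{x,y}p_{j,y+\epsilon'}(\Psi^\star_{x+1}),\qquad a_x(\Phi_j^\star)p_{jy}(\Psi_x^\star)=\sum_{\epsilon'=0,\pm1}D^{0,\epsilon'}_{x,y}p_{j,y+\epsilon'}(\Psi^\star_x),$$ $$b_{x-1}(\Phi_j^\star)p_{jy}(\Psi_x^\star)=\tfrac{\nu(\Psi_x)}{\nu(\Psi_{x-1})}\sum_{\epsilon'=0,1}D^{-1,\epsilon'}_{x,y}p_{j,y+\epsilon'}(\Psi^\star_{x-1}),$$ and $F$ is nowhere zero on $\mathcal D$ with, whenever moreover $x+j\le N$, $$\frac{k_i(\Phi_j)}{k_x(\Phi_j^\star)}\frac{k_j(\Psi_x)}{k_y(\Psi_x^\star)}F(x,y)=\frac{G(i,j)}{\nu(\Psi_x)\nu(\Phi_j)}.$$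 A *factorized $A_2$-Leonard pair* with basis $(X,Y;X^\star,Y^\star)$ consists of $X,Y,X^\star,Y^\star\in\mathrm{End}(V)$, $V$ a complex vector space, such that: $H=\langle X,Y\rangle$ and $H^\star=\langle X^\star,Y^\star\rangle$ are two-dimensional spaces of commuting diagonalizable maps; there are bijections $\lambda\mapsto V_{(\lambda)}$, $\lambda\mapsto V^\star_{(\lambda)}$ from $\mathcal D$ to the common eigenspaces of $H$, resp. $H^\star$, all of dimension one, with $H^\star V_{(\lambda)}\subseteq\sum_{\chi\text{ adj }\lambda}V_{(\chi)}$ and $HV^\star_{(\lambda)}\subseteq\sum_{\chi\text{ adj }\lambda}V^\star_{(\chi)}$; no subspace other than $0,V$ is invariant under $H$ and $H^\star$; there is a non-degenerate symmetric bilinear form for which distinct $V_{(\lambda)}$ are orthogonal and distinct $V^\star_{(\lambda)}$ are orthogonal; $X$ acts on $V_{(x,y)}$ by a scalar $t_x$ and $Y^\star$ on $V^\star_{(i,j)}$ by a scalar $\theta^\star_j$, with $t_0,\dots,t_N$ distinct and $\theta^\star_0,\dots,\theta^\star_N$ distinct; $[X,Y^\star]=0$ and each common eigenspace of $X,Y^\star$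 has dimension one; and $\langle V^\star_{(i+1,j)},XV^\star_{(i,j)}\rangle$, $\langle V^\star_{(i,j)},XV^\star_{(i+1,j)}\rangle$, $\langle V_{(x,y+1)},Y^\star V_{(x,y)}\rangle$, $\langle V_{(x,y)},Y^\star V_{(x,y+1)}\rangle$ are nonzero whenever the labels lie in $\mathcal D$. Say that $(\Phi_j),(\Psi_x),C,D,F,G$ *give a factorized $A_2$-Leonard pair* if: all $\Phi_j$, $\Psi_x$ are parameter arrays; they are compatible with $C,D,F,G$; $C$ and $D$ are uniquely determined by their constraints (for $(\epsilon,\epsilon')\in A_2$ and both $(i,j)$ and $(i+\epsilon,j+\epsilon')$ in $\mathcal D$); there are a factorized $A_2$-Leonard pair with basis $(X,Y;X^\star,Y^\star)$ on some $V$ and bases $V_{x,y}$, $\widetilde V_{x,j}$, $V^\star_{i,j}$ of $V$ (labelled by $\mathcal D$), with $V_{x,y}$ spanning $V_{(x,y)}$ and $V^\star_{i,j}$ spanning $V^\star_{(i,j)}$, such that $$XV_{x,y}=t_xV_{x,y},\quad YV_{x,y}=\theta_y(x)V_{x,y},\quad X^\star V_{x,y}=\sum_{(\epsilon,\epsilon')\in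 A_2}D^{\epsilon,\epsilon'}_{x,y}V_{x+\epsilon,y+\epsilon'},$$ $$Y^\star V_{x,y}=b_{y-1}(\Psi^\star_x)V_{x,y-1}+a_y(\Psi_x^\star)V_{x,y}+c_{y+1}(\Psi_x^\star)V_{x,y+1},$$ $$X\widetilde V_{x,j}=t_x\widetilde V_{x,j},\quad Y^\star\widetilde V_{x,j}=\theta^\star_j\widetilde V_{x,j},\quad X^\star\widetilde V_{x,j}=b_{x-1}(\Phi_j^\star)\widetilde V_{x-1,j}+a_x(\Phi_j^\star)\widetilde V_{x,j}+c_{x+1}(\Phi_j^\star)\widetilde V_{x+1,j},$$ $$Y\widetilde V_{x,j}=b_{j-1}(\Psi_x)\widetilde V_{x,j-1}+a_j(\Psi_x)\widetilde V_{x,j}+c_{j+1}(\Psi_x)\widetilde V_{x,j+1},$$ $$XV^\star_{i,j}=b_{i-1}(\Phi_j)V^\star_{i-1,j}+a_i(\Phi_j)V^\star_{i,j}+c_{i+1}(\Phi_j)V^\star_{i+1,j},\quad YV^\star_{i,j}=\sum_{(\epsilon,\epsilon')\in A_2}C^{\epsilon,\epsilon'}_{i,j}V^\star_{i+\epsilon,j+\epsilon'},$$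 $$X^\star V^\star_{i,j}=t^\star_i(j)V^\star_{i,j},\quad Y^\star V^\star_{i,j}=\theta^\star_jV^\star_{i,j},$$ $$\widetilde V_{x,j}=\sum_{y=0}^{N-x}p_{yj}(\Psi_x)V_{x,y},\quad V^\star_{i,j}=\sum_{x=0}^{N-j}p_{xi}(\Phi_j)\widetilde V_{x,j}=\sum_{x=0}^{N-j}\sum_{y=0}^{N-x}T_{i,j}(x,y)V_{x,y},\quad T_{i,j}(x,y):=p_{xi}(\Phi_j)p_{yj}(\Psi_x),$$ and the bilinear form satisfies $\langle V_{x,y},V_{u,v}\rangle=\delta_{xu}\delta_{yv}F(x,y)$, $\langle V^\star_{i,j},V^\star_{k,l}\rangle=\delta_{ik}\delta_{jl}G(i,j)$; and, for each $(i,j)\in\mathcal D$, $T_{i,j}(x,y)$ is on $\mathcal D$ the value of a polynomial in $t_x$ and $\theta_y(x)$ of total degree exactly $i+j$ and of degree exactly $j$ in the second variable. **Hahn / dual Hahn.** Let $m^\star,r,s^\star,\mu,\rho,\sigma\in\mathbb C$ with $m^\star\mu\ne0$, $r+n,\ s^\star-r+n,\ \rho+n,\ \sigma-\rho+n\neq0$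 for $1\le n\le N$, and $s^\star+n,\ \sigma+n\ne0$ for $2\le n\le 2N$ (equivalently, in all the arrays below the eigenvalues are distinct, the dual eigenvalues are distinct and the split parameters are nonzero). Let $$\Phi_j:\ t_x=x,\quad t^\star_x(j)=m^\star x(x+1+s^\star+j),\quad f_x(j)=m^\star x(x-N+j-1)(x+r),\quad g_x(j)=-m^\star x(x-N+j-1)(x+s^\star+j-r),$$ $$\Psi_x:\ \theta_j(x)=\mu j(j+1+\sigma+x),\quad\theta_j^\star=j,\quad\varphi_j(x)=\mu j(j-N+x-1)(j+\rho),\quad\phi_j(x)=\mu j(j-N+x-1)(j+\rho-\sigma-N-1).$$ In the formulas below a quotient in square brackets is read as $1$ if its numerator and denominator are equal (also when both vanish). Then: (1) $a_i(\Phi_j)=-b_i(\Phi_j)-c_i(\Phi_j)$, $b_i(\Phi_j)=\frac{(i+j-N)(i+1+r)}{2i+j+s^\star+2}\Big[\frac{i+1+s^\star+j}{2i+j+s^\star+1}\Big]$, $c_i(\Phi_j)=-\frac{i(i+j+s^\star-r)}{2i+j+s^\star}\Big[\frac{i+1+s^\star+N}{2i+j+s^\star+1}\Big]$ (with $c_0=0$),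 $a_j(\Psi_x)=-b_j(\Psi_x)-c_j(\Psi_x)$, $b_j(\Psi_x)=\mu(j-N+x)(j+1+\rho)$, $c_j(\Psi_x)=\mu j(j-N-1+\rho-\sigma)$, and $\frac{\nu(\Psi_{x+1})}{\nu(\Psi_x)}=\frac{\sigma-\rho+x+1}{\sigma+x+2}$ for $0\le x<N$, $\frac{\nu(\Psi_{x-1})}{\nu(\Psi_x)}=\frac{\sigma+x+1}{\sigma-\rho+x}$ for $0<x\le N$. (2) $(\Phi_j),(\Psi_x)$ give a factorized $A_2$-Leonard pair with the coefficients $$C^{-,0}_{i,j}=-\mu(j+1+\rho)b_{i-1}(\Phi_j),\qquad C^{+,0}_{i,j}=-\mu(j+1+\rho)c_{i+1}(\Phi_j),$$ $$C^{0,0}_{i,j}=-\mu(j+1+\rho)a_i(\Phi_j)+\mu(N-j)(j+1+\rho)+\mu j(N-j+1+\sigma-\rho),$$ $$C^{-,+}_{i,j}=\tfrac{\mu(j+1)(j-N+\rho-\sigma)(i+r)(s^\star+j+2)}{(2i+s^\star+j)(s^\star+j+1-r)},\qquad C^{0,+}_{i,j}=\tfrac{\mu(j+1)(j-N+\rho-\sigma)(i+1+s^\star+j-r)(s^\star+j+2)}{(2i+s^\star+j+2)(s^\star+j+1-r)},$$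 $$C^{0,-}_{i,j}=\tfrac{\mu(j+\rho)(N-j+1-i)(r-s^\star-j)}{s^\star+j+1}\Big[\tfrac{i+s^\star+j}{2i+s^\star+j}\Big],\qquad C^{+,-}_{i,j}=\tfrac{\mu(j+\rho)(i+1)(r-s^\star-j)}{s^\star+j+1}\Big[\tfrac{i+s^\star+N+2}{2i+s^\star+j+2}\Big],$$ $$D^{\epsilon,\epsilon'}_{x,y}=C^{\epsilon',\epsilon}_{y,x}\Big|_{(s^\star,r,m^\star,\mu,\sigma,\rho)\to(\sigma,\rho,\mu,m^\star,s^\star,r)}\ \frac{\nu(\Psi_{x+\epsilon})}{\nu(\Psi_x)}$$ and the weights $$F(x,y)=\binom N{x,y}\frac{(-1)^{N-y}(r+1)_x(\rho+1)_y(\rho-N-\sigma)_{N-x-y}}{(\sigma+x+y+1)_y(\sigma+x+2y+2)_{N-x-y}(r-s^\star-N)_x},$$ $$G(i,j)=\binom N{i,j}\frac{(-1)^N(r+1)_i\,[(2+s^\star+j)_{N-j}]^2(\rho+1)_j}{(s^\star+j-r+1,\,s^\star+j+1+i)_i(s^\star+j+2i+2)_{N-j-i}(\rho-\sigma-N)_j(r-s^\star-N)_{N-j}}.$$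 (3) For $(i,j),(x,y)\in\mathcal D$, $$T_{i,j}(x,y)=\binom{N-j}i\binom{N-x}j\frac{(-1)^j(r+1)_i(2+s^\star+j)_{N-j}(\rho+1)_j}{(s^\star+j-r+1,\,s^\star+j+1+i)_i(s^\star+j+2i+2)_{N-j-i}(\rho-\sigma-N)_j}$$ $$\times\ {}_3F_2\Big({-i,\ i+1+s^\star+j,\ -x\atop r+1,\ -N+j};1\Big)\ {}_3F_2\Big({-j,\ -y,\ y+1+\sigma+x\atop\rho+1,\ -N+x};1\Big),$$ where the ${}_3F_2$ are the terminating sums. **Krawtchouk cases.** For $r,\rho\in\mathbb C\setminus\{0,1\}$ define the Krawtchouk arrays $$\Phi^K_j:\ t_x=x,\ t^\star_x(j)=x,\ f_x(j)=rx(x-N+j-1),\ g_x(j)=(r-1)x(x-N+j-1),$$ $$\Psi^K_x:\ \theta_j(x)=j,\ \theta^\star_j=j,\ \varphi_j(x)=\rho j(j-N+x-1),\ \phi_j(x)=(\rho-1)j(j-N+x-1).$$ Each of the pairs of families $(\Phi^K_j,\Psi_x)$, $(\Phi_j,\Psi^K_x)$, $(\Phi^K_j,\Psi^K_x)$ (with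 the parameters of a Hahn or dual Hahn family subject to the conditions above) gives a factorized $A_2$-Leonard pair with suitable $C,D,F,G$. The arrays, the coefficients $C,D$ (for the indices that matter), the weights $F,G$ and the functions $T_{i,j}(x,y)$ on $\mathcal D\times\mathcal D$ are the limits of those of the Hahn / dual Hahn case, respectively: after $s^\star\to\frac1{m^\star}$, $r\to\frac r{m^\star}$ as $m^\star\to0$; after $\sigma\to\frac1\mu$, $\rho\to\frac\rho\mu$ as $\mu\to0$; after both replacements as $(m^\star,\mu)\to(0,0)$ with $m^\star\mu\ne0$. -/

import Mathlib

open scoped Topology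

noncomputable section

/-- A parameter array of diameter `diam`: `ev i = θ_i` and `dev i = θ*_i` for `0 ≤ i ≤ diam`,
`fst i = φ_i` (first split sequence) and `snd i = ϕ_i` (second split sequence) for
`1 ≤ i ≤ diam`. Values outside these ranges are never used. -/
structure ParamArray where
  diam : ℕ
  ev : ℕ → ℂ
  dev : ℕ → ℂ
  fst : ℕ → ℂ
  snd : ℕ → ℂ

namespace ParamArray

/-- The transformed array `Φ* = (θ*_i, θ_i; φ_j, ϕ_{d-j+1})`. -/
def star (Φ : ParamArray) : ParamArray where
  diam := Φ.diam
  ev := Φ.dev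
  dev := Φ.ev
  fst := Φ.fst
  snd := fun j => Φ.snd (Φ.diam + 1 - j)

/-- The (Terwilliger) conditions PA1 - PA5 that characterize the parameter arrays of Leonard
systems. -/
structure IsValid (Φ : ParamArray) : Prop where
  ev_ne : ∀ i j, i ≤ Φ.diam → j ≤ Φ.diam → i ≠ j → Φ.ev i ≠ Φ.ev j
  dev_ne : ∀ i j, i ≤ Φ.diam → j ≤ Φ.diam → i ≠ j → Φ.dev i ≠ Φ.dev j
  fst_ne : ∀ i, 1 ≤ i → i ≤ Φ.diam → Φ.fst i ≠ 0
  snd_ne : ∀ i, 1 ≤ i → i ≤ Φ.diam → Φ.snd i ≠ 0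
  fst_eq : ∀ i, 1 ≤ i → i ≤ Φ.diam →
    Φ.fst i = Φ.snd 1 * (∑ h ∈ Finset.range i,
        (Φ.ev h - Φ.ev (Φ.diam - h)) / (Φ.ev 0 - Φ.ev Φ.diam))
      + (Φ.dev i - Φ.dev 0) * (Φ.ev (i - 1) - Φ.ev Φ.diam)
  snd_eq : ∀ i, 1 ≤ i → i ≤ Φ.diam →
    Φ.snd i = Φ.fst 1 * (∑ h ∈ Finset.range i,
        (Φ.ev h - Φ.ev (Φ.diam - h)) / (Φ.ev 0 - Φ.ev Φ.diam))
      + (Φ.dev i - Φ.dev 0) * (Φ.ev (Φ.diam - i + 1) - Φ.ev 0)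
  ratio_eq : ∃ β : ℂ, ∀ i, 2 ≤ i → i + 1 ≤ Φ.diam →
    (Φ.ev (i - 2) - Φ.ev (i + 1)) / (Φ.ev (i - 1) - Φ.ev i) = β ∧
    (Φ.dev (i - 2) - Φ.dev (i + 1)) / (Φ.dev (i - 1) - Φ.dev i) = β

/-- `b_i(Φ)`, with `b_d = 0`. -/
def b (Φ : ParamArray) (i : ℕ) : ℂ :=
  if i < Φ.diam then
    Φ.fst (i + 1) * (∏ h ∈ Finset.range i, (Φ.dev i - Φ.dev h)) /
      ∏ h ∈ Finset.range (i + 1), (Φ.dev (i + 1) - Φ.dev h)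
  else 0

/-- `b_{i-1}(Φ)`, with `b_{-1} = 0`. -/
def bPrev (Φ : ParamArray) : ℕ → ℂ
  | 0 => 0
  | i + 1 => Φ.b i

/-- `c_i(Φ)`, with `c_0 = c_{d+1} = 0`. -/
def c (Φ : ParamArray) (i : ℕ) : ℂ :=
  if 1 ≤ i ∧ i ≤ Φ.diam then
    Φ.snd i * (∏ h ∈ Finset.range (Φ.diam - i), (Φ.dev i - Φ.dev (Φ.diam - h))) /
      ∏ h ∈ Finset.range (Φ.diam - i + 1), (Φ.dev (i - 1) - Φ.dev (Φ.diam - h))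
  else 0

/-- `a_i(Φ)`, where the terms with `φ_0` and `φ_{d+1}` are absent. -/
def a (Φ : ParamArray) (i : ℕ) : ℂ :=
  Φ.ev i + (if 1 ≤ i then Φ.fst i / (Φ.dev i - Φ.dev (i - 1)) else 0)
    + (if i < Φ.diam then Φ.fst (i + 1) / (Φ.dev i - Φ.dev (i + 1)) else 0)

/-- The polynomial `u_i(lam)`. -/
def u (Φ : ParamArray) (i : ℕ) (lam : ℂ) : ℂ :=
  ∑ k ∈ Finset.range (i + 1), ∏ j ∈ Finset.range k,
    ((lam - Φ.ev j) * (Φ.dev i - Φ.dev j) / Φ.fst (j + 1))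

/-- The normalization factor `k_i(Φ)`. -/
def k (Φ : ParamArray) (i : ℕ) : ℂ :=
  (∏ h ∈ Finset.Icc 1 i, Φ.fst h / Φ.snd h) *
    (∏ h ∈ Finset.Icc 1 Φ.diam, (Φ.dev 0 - Φ.dev h)) /
      ∏ h ∈ (Finset.range (Φ.diam + 1)).erase i, (Φ.dev i - Φ.dev h)

/-- The transition coefficient `p_{xi}(Φ) = k_i(Φ) u_i(θ_x)` for `0 ≤ x, i ≤ d`, extended by
zero to other indices. -/
def p (Φ : ParamArray) (x i : ℕ) : ℂ :=
  if x ≤ Φ.diam ∧ i ≤ Φ.diam then Φ.k i * Φ.u i (Φ.ev x) else 0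

/-- The constant `ν(Φ)` of the orthogonality relation. -/
def nu (Φ : ParamArray) : ℂ :=
  ∏ h ∈ Finset.Icc 1 Φ.diam,
    ((Φ.ev 0 - Φ.ev h) * (Φ.dev 0 - Φ.dev h) / Φ.snd h)

end ParamArray

/-- The triangular domain of all pairs of natural numbers with sum at most `N`. -/
def triDom (N : ℕ) : Finset (ℕ × ℕ) :=
  (Finset.range (N + 1) ×ˢ Finset.range (N + 1)).filter (fun q => q.1 + q.2 ≤ N)

theorem mem_triDom {N : ℕ} {q : ℕ × ℕ} : q ∈ triDom N ↔ q.1 + q.2 ≤ N := by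
  simp only [triDom, Finset.mem_filter, Finset.mem_product, Finset.mem_range]
  omega

/-- The set `A_2` (the six roots together with zero). -/
def rootsA2 : Finset (ℤ × ℤ) :=
  {(0, 0), (1, -1), (1, 0), (0, 1), (-1, 1), (-1, 0), (0, -1)}

/-- `A_2`-adjacency. -/
def adjA2 (p q : ℕ × ℕ) : Prop :=
  ((p.1 : ℤ) - q.1, (p.2 : ℤ) - q.2) ∈ rootsA2

section LeonardPair

variable {V : Type*} [AddCommGroup V] [Module ℂ V]

/-- `W` is a common eigenspace of the elements of `H`. -/
def IsCommonEigenspace (H : Set (Module.End ℂ V)) (W : Submodule ℂ V) : Prop :=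
  W ≠ ⊥ ∧ ∃ χ : Module.End ℂ V → ℂ, ∀ v : V, v ∈ W ↔ ∀ h ∈ H, h v = χ h • v

/-- A two-dimensional space of commuting diagonalizable linear maps. -/
structure IsDiagonalPlane (H : Submodule ℂ (Module.End ℂ V)) : Prop where
  finrank_eq : Module.finrank ℂ H = 2
  diagonalizable : ∀ h ∈ H, ⨆ t : ℂ, Module.End.eigenspace h t = ⊤
  commute : ∀ h ∈ H, ∀ h' ∈ H, Commute h h'

/-- `(H, Hs)` is an `A_2`-Leonard pair on the triangular domain of size `N`, with
`λ ↦ E λ` and `λ ↦ Es λ` the labellings of the common eigenspaces of `H` and `Hs`, and `B` the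
bilinear form. -/
structure IsA2LeonardPair (N : ℕ) (H Hs : Submodule ℂ (Module.End ℂ V))
    (E Es : ℕ × ℕ → Submodule ℂ V) (B : LinearMap.BilinForm ℂ V) : Prop where
  plane : IsDiagonalPlane H
  plane_star : IsDiagonalPlane Hs
  bij : Set.BijOn E (triDom N) {W | IsCommonEigenspace (H : Set (Module.End ℂ V)) W}
  action : ∀ q ∈ triDom N, ∀ h ∈ Hs,
    (E q).map h ≤ ⨆ q' ∈ {q' | q' ∈ triDom N ∧ adjA2 q' q}, E q'
  bij_star : Set.BijOn Es (triDom N) {W | IsCommonEigenspace (Hs : Set (Module.End ℂ V)) W}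
  action_star : ∀ q ∈ triDom N, ∀ h ∈ H,
    (Es q).map h ≤ ⨆ q' ∈ {q' | q' ∈ triDom N ∧ adjA2 q' q}, Es q'
  irreducible : ∀ W : Submodule ℂ V, (∀ h ∈ H, W.map h ≤ W) → (∀ h ∈ Hs, W.map h ≤ W) →
    W = ⊥ ∨ W = ⊤
  finrank_one : ∀ q ∈ triDom N, Module.finrank ℂ (E q) = 1 ∧ Module.finrank ℂ (Es q) = 1
  form_nondegenerate : B.Nondegenerate
  form_symm : B.IsSymm
  form_orth : ∀ q ∈ triDom N, ∀ q' ∈ triDom N, q ≠ q' →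
    (∀ v ∈ E q, ∀ w ∈ E q', B v w = 0) ∧ (∀ v ∈ Es q, ∀ w ∈ Es q', B v w = 0)

/-- `(X, Y; Xs, Ys)` is a basis of a factorized `A_2`-Leonard pair, namely of the pair
consisting of the spans of `X, Y` and of `Xs, Ys`, with eigenspaces `E`, `Es` and bilinear form
`B`. -/
structure IsFactorizedA2LeonardPair (N : ℕ) (X Y Xs Ys : Module.End ℂ V)
    (E Es : ℕ × ℕ → Submodule ℂ V) (B : LinearMap.BilinForm ℂ V) : Prop where
  linIndep : LinearIndependent ℂ ![X, Y]
  linIndep_star : LinearIndependent ℂ ![Xs, Ys]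
  isA2LeonardPair :
    IsA2LeonardPair N (Submodule.span ℂ {X, Y}) (Submodule.span ℂ {Xs, Ys}) E Es B
  eigenvalues : ∃ t : ℕ → ℂ, (∀ x x', x ≤ N → x' ≤ N → (t x ≠ t x' ↔ x ≠ x')) ∧
    ∀ q ∈ triDom N, ∀ v ∈ E q, X v = t q.1 • v
  eigenvalues_star : ∃ t : ℕ → ℂ, (∀ j j', j ≤ N → j' ≤ N → (t j ≠ t j' ↔ j ≠ j')) ∧
    ∀ q ∈ triDom N, ∀ v ∈ Es q, Ys v = t q.2 • v
  commute : Commute X Ys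
  common_finrank : ∀ W : Submodule ℂ V, IsCommonEigenspace {X, Ys} W → Module.finrank ℂ W = 1
  offdiag_star : ∀ i j, i + 1 + j ≤ N → ∀ v ∈ Es (i, j), ∀ w ∈ Es (i + 1, j), v ≠ 0 → w ≠ 0 →
    B w (X v) ≠ 0 ∧ B v (X w) ≠ 0
  offdiag : ∀ x y, x + y + 1 ≤ N → ∀ v ∈ E (x, y), ∀ w ∈ E (x, y + 1), v ≠ 0 → w ≠ 0 →
    B w (Ys v) ≠ 0 ∧ B v (Ys w) ≠ 0

/-- The vector with label `(i, j)` of a family indexed by the triangular domain, with the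
convention that it is zero for labels outside the domain. -/
def vec {N : ℕ} (v : triDom N → V) (i j : ℤ) : V :=
  if h : 0 ≤ i ∧ 0 ≤ j ∧ i + j ≤ N then
    v ⟨(i.toNat, j.toNat), mem_triDom.2 (by simp only; omega)⟩
  else 0

/-- The line spanned by the vector with label `q`. -/
def vecLine {N : ℕ} (v : triDom N → V) (q : ℕ × ℕ) : Submodule ℂ V :=
  Submodule.span ℂ {vec v q.1 q.2}

end LeonardPair

/-- A function on the triangular domain, extended by zero to all pairs of integers. -/
def zeroExt (N : ℕ) (f : ℕ → ℕ → ℂ) (i j : ℤ) : ℂ :=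
  if 0 ≤ i ∧ 0 ≤ j ∧ i + j ≤ N then f i.toNat j.toNat else 0

/-- The constraints on `C`: `C ε ε' i j` stands for `C^{ε,ε'}_{i,j}`. Here
`zeroExt N (fun k l => (Φ l).p x k) i j` is `p_{x,i}(Φ_j)`. -/
structure SolvesC (N : ℕ) (Φ Ψ : ℕ → ParamArray) (C : ℤ → ℤ → ℕ → ℕ → ℂ) : Prop where
  up : ∀ i j x : ℕ, i + j ≤ N → x ≤ N →
    (Ψ x).c (j + 1) * (Φ j).p x i = ∑ ε ∈ ({-1, 0} : Finset ℤ),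
      C ε 1 i j * zeroExt N (fun k l => (Φ l).p x k) (i + ε) (j + 1)
  level : ∀ i j x : ℕ, i + j ≤ N → x ≤ N →
    (Ψ x).a j * (Φ j).p x i = ∑ ε ∈ ({-1, 0, 1} : Finset ℤ),
      C ε 0 i j * zeroExt N (fun k l => (Φ l).p x k) (i + ε) j
  down : ∀ i j x : ℕ, i + j ≤ N → x ≤ N →
    (Ψ x).bPrev j * (Φ j).p x i = ∑ ε ∈ ({0, 1} : Finset ℤ),
      C ε (-1) i j * zeroExt N (fun k l => (Φ l).p x k) (i + ε) (j - 1)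

/-- The constraints on `D`: `D ε ε' x y` stands for `D^{ε,ε'}_{x,y}`. Here
`zeroExt N (fun k l => (Ψ k).star.p j l) x y` is `p_{j,y}(Ψ*_x)`; for `x = N` in `up` and `x = 0`
in `down` these factors all vanish. -/
structure SolvesD (N : ℕ) (Φ Ψ : ℕ → ParamArray) (D : ℤ → ℤ → ℕ → ℕ → ℂ) : Prop where
  up : ∀ x y j : ℕ, x + y ≤ N → j ≤ N →
    (Φ j).star.c (x + 1) * (Ψ x).star.p j y =
      (Ψ x).nu / (Ψ (x + 1)).nu * ∑ ε ∈ ({-1, 0} : Finset ℤ),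
        D 1 ε x y * zeroExt N (fun k l => (Ψ k).star.p j l) (x + 1) (y + ε)
  level : ∀ x y j : ℕ, x + y ≤ N → j ≤ N →
    (Φ j).star.a x * (Ψ x).star.p j y = ∑ ε ∈ ({-1, 0, 1} : Finset ℤ),
      D 0 ε x y * zeroExt N (fun k l => (Ψ k).star.p j l) x (y + ε)
  down : ∀ x y j : ℕ, x + y ≤ N → j ≤ N →
    (Φ j).star.bPrev x * (Ψ x).star.p j y =
      (Ψ x).nu / (Ψ (x - 1)).nu * ∑ ε ∈ ({0, 1} : Finset ℤ),
        D (-1) ε x y * zeroExt N (fun k l => (Ψ k).star.p j l) (x - 1) (y + ε)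

/-- The condition on the weights `F`, `G`. -/
structure SolvesFG (N : ℕ) (Φ Ψ : ℕ → ParamArray) (F G : ℕ → ℕ → ℂ) : Prop where
  F_ne : ∀ x y, x + y ≤ N → F x y ≠ 0
  eq : ∀ i j x y, i + j ≤ N → x + y ≤ N → x + j ≤ N →
    (Φ j).k i / (Φ j).star.k x * ((Ψ x).k j / (Ψ x).star.k y) * F x y
      = G i j / ((Ψ x).nu * (Φ j).nu)

/-- `(Φ_j)` and `(Ψ_x)` are compatible, with coefficients `C`, `D` and weights `F`, `G`. -/
structure CompatibleWith (N : ℕ) (Φ Ψ : ℕ → ParamArray) (C D : ℤ → ℤ → ℕ → ℕ → ℂ)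
    (F G : ℕ → ℕ → ℂ) : Prop where
  solvesC : SolvesC N Φ Ψ C
  solvesD : SolvesD N Φ Ψ D
  solvesFG : SolvesFG N Φ Ψ F G

/-- The indices `(ε, ε'), (i, j)` for which a coefficient is meaningful: `(ε, ε')` belongs to
`A_2`, and both `(i, j)` and `(i + ε, j + ε')` lie in the domain. -/
def CoefIndex (N : ℕ) (ε ε' : ℤ) (i j : ℕ) : Prop :=
  (ε, ε') ∈ rootsA2 ∧ i + j ≤ N ∧ 0 ≤ (i : ℤ) + ε ∧ 0 ≤ (j : ℤ) + ε' ∧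
    (i : ℤ) + ε + (j + ε') ≤ N

/-- Two systems of coefficients agree wherever the coefficients are meaningful. -/
def CoefEq (N : ℕ) (C C' : ℤ → ℤ → ℕ → ℕ → ℂ) : Prop :=
  ∀ ε ε' i j, CoefIndex N ε ε' i j → C ε ε' i j = C' ε ε' i j

/-- The bivariate function of Tratnik type `T_{i,j}(x,y) = p_{xi}(Φ_j) p_{yj}(Ψ_x)`. -/
def tratnik (Φ Ψ : ℕ → ParamArray) (i j x y : ℕ) : ℂ :=
  (Φ j).p x i * (Ψ x).p y j

/-- `(Φ_j)` and `(Ψ_x)` are the parameter arrays associated to a factorized `A_2`-Leonard pair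
with basis `(X, Y; Xs, Ys)`. The vectors `vec v x y`, `vec vt x j` and `vec vs i j` are the basis
vectors `V_{x,y}`, `V~_{x,j}` and `V*_{i,j}` of the common eigenspaces of `(X, Y)`, of `(X, Ys)`
and of `(Xs, Ys)`. -/
structure Realizes (N : ℕ) (Φ Ψ : ℕ → ParamArray) (C D : ℤ → ℤ → ℕ → ℕ → ℂ) (F G : ℕ → ℕ → ℂ)
    {V : Type*} [AddCommGroup V] [Module ℂ V] (X Y Xs Ys : Module.End ℂ V)
    (v vt vs : Module.Basis (triDom N) ℂ V) (B : LinearMap.BilinForm ℂ V) : Prop where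
  isFactorized : IsFactorizedA2LeonardPair N X Y Xs Ys (vecLine v) (vecLine vs) B
  form : ∀ x y x' y' : ℕ, x + y ≤ N → x' + y' ≤ N →
    B (vec v x y) (vec v x' y') = if x = x' ∧ y = y' then F x y else 0
  form_star : ∀ i j i' j' : ℕ, i + j ≤ N → i' + j' ≤ N →
    B (vec vs i j) (vec vs i' j') = if i = i' ∧ j = j' then G i j else 0
  -- the actions on the vectors `V_{x,y}`
  X_v : ∀ x y : ℕ, x + y ≤ N → ∀ j, x + j ≤ N → X (vec v x y) = (Φ j).ev x • vec v x y
  Y_v : ∀ x y : ℕ, x + y ≤ N → Y (vec v x y) = (Ψ x).ev y • vec v x y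
  Xs_v : ∀ x y : ℕ, x + y ≤ N →
    Xs (vec v x y) = ∑ e ∈ rootsA2, D e.1 e.2 x y • vec v (x + e.1) (y + e.2)
  Ys_v : ∀ x y : ℕ, x + y ≤ N →
    Ys (vec v x y) = (Ψ x).star.bPrev y • vec v x (y - 1) + (Ψ x).star.a y • vec v x y
      + (Ψ x).star.c (y + 1) • vec v x (y + 1)
  -- the actions on the vectors `V~_{x,j}`
  X_vt : ∀ x j : ℕ, x + j ≤ N → X (vec vt x j) = (Φ j).ev x • vec vt x j
  Ys_vt : ∀ x j : ℕ, x + j ≤ N → Ys (vec vt x j) = (Ψ x).dev j • vec vt x j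
  Xs_vt : ∀ x j : ℕ, x + j ≤ N →
    Xs (vec vt x j) = (Φ j).star.bPrev x • vec vt (x - 1) j + (Φ j).star.a x • vec vt x j
      + (Φ j).star.c (x + 1) • vec vt (x + 1) j
  Y_vt : ∀ x j : ℕ, x + j ≤ N →
    Y (vec vt x j) = (Ψ x).bPrev j • vec vt x (j - 1) + (Ψ x).a j • vec vt x j
      + (Ψ x).c (j + 1) • vec vt x (j + 1)
  -- the actions on the vectors `V*_{i,j}`
  X_vs : ∀ i j : ℕ, i + j ≤ N →
    X (vec vs i j) = (Φ j).bPrev i • vec vs (i - 1) j + (Φ j).a i • vec vs i j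
      + (Φ j).c (i + 1) • vec vs (i + 1) j
  Y_vs : ∀ i j : ℕ, i + j ≤ N →
    Y (vec vs i j) = ∑ e ∈ rootsA2, C e.1 e.2 i j • vec vs (i + e.1) (j + e.2)
  Xs_vs : ∀ i j : ℕ, i + j ≤ N → Xs (vec vs i j) = (Φ j).dev i • vec vs i j
  Ys_vs : ∀ i j : ℕ, i + j ≤ N → ∀ x, x + j ≤ N → Ys (vec vs i j) = (Ψ x).dev j • vec vs i j
  -- the changes of basis
  vt_eq : ∀ x j : ℕ, x + j ≤ N →
    vec vt x j = ∑ y ∈ Finset.range (N - x + 1), (Ψ x).p y j • vec v x y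
  vs_eq : ∀ i j : ℕ, i + j ≤ N →
    vec vs i j = ∑ x ∈ Finset.range (N - j + 1), (Φ j).p x i • vec vt x j
  vs_eq_v : ∀ i j : ℕ, i + j ≤ N →
    vec vs i j = ∑ x ∈ Finset.range (N - j + 1), ∑ y ∈ Finset.range (N - x + 1),
      tratnik Φ Ψ i j x y • vec v x y

/-- The families `(Φ_j)`, `(Ψ_x)` consist of parameter arrays and are compatible, with the
essentially unique coefficients `C`, `D` and with weights `F`, `G`; they are associated to a
factorized `A_2`-Leonard pair; and `T_{i,j}(x,y)` is a polynomial in `t_x` and `θ_y(x)` of total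
degree `i + j`, and of degree `j` in the second variable. -/
structure GivesFactorizedPair (N : ℕ) (Φ Ψ : ℕ → ParamArray) (C D : ℤ → ℤ → ℕ → ℕ → ℂ)
    (F G : ℕ → ℕ → ℂ) : Prop where
  validΦ : ∀ j ≤ N, (Φ j).diam = N - j ∧ (Φ j).IsValid
  validΨ : ∀ x ≤ N, (Ψ x).diam = N - x ∧ (Ψ x).IsValid
  compatible : CompatibleWith N Φ Ψ C D F G
  uniqueC : ∀ C', SolvesC N Φ Ψ C' → CoefEq N C' C
  uniqueD : ∀ D', SolvesD N Φ Ψ D' → CoefEq N D' D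
  pair : ∃ (V : Type) (_ : AddCommGroup V) (_ : Module ℂ V) (X Y Xs Ys : Module.End ℂ V)
    (v vt vs : Module.Basis (triDom N) ℂ V) (B : LinearMap.BilinForm ℂ V),
    Realizes N Φ Ψ C D F G X Y Xs Ys v vt vs B
  degree : ∀ i j, i + j ≤ N → ∃ P : MvPolynomial (Fin 2) ℂ,
    P.totalDegree = i + j ∧ P.degreeOf 1 = j ∧
    ∀ x y, x + y ≤ N →
      tratnik Φ Ψ i j x y = MvPolynomial.eval ![(Φ 0).ev x, (Ψ x).ev y] P

/-- The Hahn arrays `Φ_j`. -/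
def hahnArray (N : ℕ) (m r s : ℂ) (j : ℕ) : ParamArray where
  diam := N - j
  ev := fun x => x
  dev := fun x => m * x * (x + 1 + s + j)
  fst := fun x => m * x * (x - N + j - 1) * (x + r)
  snd := fun x => -m * x * (x - N + j - 1) * (x + s + j - r)

/-- The dual Hahn arrays `Ψ_x`. -/
def dualHahnArray (N : ℕ) (μ ρ σ : ℂ) (x : ℕ) : ParamArray where
  diam := N - x
  ev := fun j => μ * j * (j + 1 + σ + x)
  dev := fun j => j
  fst := fun j => μ * j * (j - N + x - 1) * (j + ρ)
  snd := fun j => μ * j * (j - N + x - 1) * (j + ρ - σ - N - 1)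

/-- The Krawtchouk arrays, of diameter `N - j`. -/
def krawtchoukArray (N : ℕ) (r : ℂ) (j : ℕ) : ParamArray where
  diam := N - j
  ev := fun x => x
  dev := fun x => x
  fst := fun x => r * x * (x - N + j - 1)
  snd := fun x => (r - 1) * x * (x - N + j - 1)

/-- The non-degeneracy conditions: they say exactly that, for the Hahn arrays (or the dual Hahn
arrays) with parameters `m, r, s`, the eigenvalues and dual eigenvalues are pairwise distinct and
the split sequences do not vanish. -/
def HahnNondeg (N : ℕ) (m r s : ℂ) : Prop :=
  m ≠ 0 ∧ (∀ n : ℕ, 1 ≤ n → n ≤ N → r + n ≠ 0) ∧ (∀ n : ℕ, 1 ≤ n → n ≤ N → s - r + n ≠ 0) ∧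
    ∀ n : ℕ, 2 ≤ n → n ≤ 2 * N → s + n ≠ 0

/-- The six parameters of the Hahn / dual Hahn case; `(m, r, s)` are `(m*, r, s*)`. -/
structure HahnParams where
  m : ℂ
  r : ℂ
  s : ℂ
  μ : ℂ
  ρ : ℂ
  σ : ℂ

/-- The replacement `(m*, r, s*, μ, ρ, σ) → (μ, ρ, σ, m*, r, s*)`. -/
def HahnParams.swap (P : HahnParams) : HahnParams :=
  ⟨P.μ, P.ρ, P.σ, P.m, P.r, P.s⟩

open Classical in
/-- The quotient of two factors, with equal factors cancelled before evaluation; it differs from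
`a / b` only for `a = b = 0`. -/
def cancelQuot (a b : ℂ) : ℂ := if a = b then 1 else a / b

/-- The Pochhammer symbol `(a)_n`. -/
def poch (a : ℂ) (n : ℕ) : ℂ := ∏ k ∈ Finset.range n, (a + k)

/-- The hypergeometric function `₃F₂(a, b, c; d, e; z)`. -/
def hyp3F2 (a b c d e z : ℂ) : ℂ :=
  ∑' n : ℕ, poch a n * poch b n * poch c n / (poch d n * poch e n * (n.factorial : ℂ)) * z ^ n

/-- The trinomial coefficient `N! / ((N - i - j)! i! j!)`. -/
def trinom (N i j : ℕ) : ℂ :=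
  (N.factorial : ℂ) / ((N - i - j).factorial * i.factorial * j.factorial)

/-- Closed form of `b_i(Φ_j)` for the Hahn arrays. -/
def hahnB (N : ℕ) (r s : ℂ) (j i : ℕ) : ℂ :=
  (i + j - N) * (i + 1 + r) / (2 * i + j + s + 2) *
    cancelQuot (i + 1 + s + j) (2 * i + j + s + 1)

/-- Closed form of `c_i(Φ_j)` for the Hahn arrays. -/
def hahnCc (N : ℕ) (r s : ℂ) (j i : ℕ) : ℂ :=
  -(i * (i + j + s - r) / (2 * i + j + s) * cancelQuot (i + 1 + s + N) (2 * i + j + s + 1))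

/-- Closed form of `a_i(Φ_j)` for the Hahn arrays. -/
def hahnA (N : ℕ) (r s : ℂ) (j i : ℕ) : ℂ :=
  -hahnB N r s j i - hahnCc N r s j i

/-- The explicit coefficients `C^{ε,ε'}_{i,j}` of the Hahn / dual Hahn case (zero for
`(ε, ε')` outside `A_2`; meaningful for the indices in `CoefIndex`). -/
def hahnC (N : ℕ) (P : HahnParams) (ε ε' : ℤ) (i j : ℕ) : ℂ :=
  if (ε, ε') = (-1, 0) then
    -P.μ * (j + 1 + P.ρ) * hahnB N P.r P.s j (i - 1)
  else if (ε, ε') = (1, 0) then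
    -P.μ * (j + 1 + P.ρ) * hahnCc N P.r P.s j (i + 1)
  else if (ε, ε') = (0, 0) then
    -P.μ * (j + 1 + P.ρ) * hahnA N P.r P.s j i + P.μ * (N - j) * (j + 1 + P.ρ)
      + P.μ * j * (N - j + 1 + P.σ - P.ρ)
  else if (ε, ε') = (-1, 1) then
    P.μ * (j + 1) * (j - N + P.ρ - P.σ) * (i + P.r) * (P.s + j + 2) /
      ((2 * i + P.s + j) * (P.s + j + 1 - P.r))
  else if (ε, ε') = (0, 1) then
    P.μ * (j + 1) * (j - N + P.ρ - P.σ) * (i + 1 + P.s + j - P.r) * (P.s + j + 2) /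
      ((2 * i + P.s + j + 2) * (P.s + j + 1 - P.r))
  else if (ε, ε') = (0, -1) then
    P.μ * (j + P.ρ) * (N - j + 1 - i) * (P.r - P.s - j) / (P.s + j + 1) *
      cancelQuot (i + P.s + j) (2 * i + P.s + j)
  else if (ε, ε') = (1, -1) then
    P.μ * (j + P.ρ) * (i + 1) * (P.r - P.s - j) / (P.s + j + 1) *
      cancelQuot (i + P.s + N + 2) (2 * i + P.s + j + 2)
  else 0

/-- Closed form of `ν(Ψ_{x+ε}) / ν(Ψ_x)` for the dual Hahn arrays, `ε ∈ {-1, 0, 1}`. -/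
def nuRatio (ρ σ : ℂ) (ε : ℤ) (x : ℕ) : ℂ :=
  if ε = 1 then (σ - ρ + x + 1) / (σ + x + 2)
  else if ε = -1 then (σ + x + 1) / (σ - ρ + x)
  else 1

/-- The explicit coefficients `D^{ε,ε'}_{x,y}` of the Hahn / dual Hahn case. -/
def hahnD (N : ℕ) (P : HahnParams) (ε ε' : ℤ) (x y : ℕ) : ℂ :=
  hahnC N P.swap ε' ε y x * nuRatio P.ρ P.σ ε x

/-- The explicit weight `F(x,y)` of the Hahn / dual Hahn case. -/
def hahnF (N : ℕ) (P : HahnParams) (x y : ℕ) : ℂ :=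
  trinom N x y *
    ((-1) ^ (N - y) * poch (P.r + 1) x * poch (P.ρ + 1) y * poch (P.ρ - N - P.σ) (N - x - y)) /
    (poch (P.σ + x + y + 1) y * poch (P.σ + x + 2 * y + 2) (N - x - y) * poch (P.r - P.s - N) x)

/-- The explicit weight `G(i,j)` of the Hahn / dual Hahn case. -/
def hahnG (N : ℕ) (P : HahnParams) (i j : ℕ) : ℂ :=
  trinom N i j *
    ((-1) ^ N * poch (P.r + 1) i * poch (2 + P.s + j) (N - j) ^ 2 * poch (P.ρ + 1) j) /
    (poch (P.s + j - P.r + 1) i * poch (P.s + j + 1 + i) i *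
      poch (P.s + j + 2 * i + 2) (N - j - i) * poch (P.ρ - P.σ - N) j *
      poch (P.r - P.s - N) (N - j))

/-- The explicit functions `T_{i,j}(x,y)` of the Hahn / dual Hahn case. -/
def hahnT (N : ℕ) (P : HahnParams) (i j x y : ℕ) : ℂ :=
  ((N - j).choose i : ℂ) * ((N - x).choose j : ℂ) *
    ((-1) ^ j * poch (P.r + 1) i * poch (2 + P.s + j) (N - j) * poch (P.ρ + 1) j) /
    (poch (P.s + j - P.r + 1) i * poch (P.s + j + 1 + i) i *
      poch (P.s + j + 2 * i + 2) (N - j - i) * poch (P.ρ - P.σ - N) j) *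
    hyp3F2 (-i) (i + 1 + P.s + j) (-x) (P.r + 1) (-N + j) 1 *
    hyp3F2 (-j) (-y) (y + 1 + P.σ + x) (P.ρ + 1) (-N + x) 1

/-- The array `Φ` is the entrywise limit along `l` of the arrays `Φa`. -/
structure TendstoArray {α : Type*} (l : Filter α) (Φa : α → ParamArray) (Φ : ParamArray) :
    Prop where
  diam : ∀ a, (Φa a).diam = Φ.diam
  ev : ∀ i ≤ Φ.diam, Filter.Tendsto (fun a => (Φa a).ev i) l (𝓝 (Φ.ev i))
  dev : ∀ i ≤ Φ.diam, Filter.Tendsto (fun a => (Φa a).dev i) l (𝓝 (Φ.dev i))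
  fst : ∀ i, 1 ≤ i → i ≤ Φ.diam → Filter.Tendsto (fun a => (Φa a).fst i) l (𝓝 (Φ.fst i))
  snd : ∀ i, 1 ≤ i → i ≤ Φ.diam → Filter.Tendsto (fun a => (Φa a).snd i) l (𝓝 (Φ.snd i))

/-- The arrays `Φ_j`, `Ψ_x`, the coefficients `C`, `D`, the weights `F`, `G` and the functions
`T_{i,j}(x,y)` are the limits along `l` of those of the Hahn / dual Hahn case with parameters
`P a`. -/
structure IsHahnLimit (N : ℕ) {α : Type*} (l : Filter α) (P : α → HahnParams)
    (Φ Ψ : ℕ → ParamArray) (C D : ℤ → ℤ → ℕ → ℕ → ℂ) (F G : ℕ → ℕ → ℂ) : Prop where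
  limΦ : ∀ j ≤ N, TendstoArray l (fun a => hahnArray N (P a).m (P a).r (P a).s j) (Φ j)
  limΨ : ∀ x ≤ N, TendstoArray l (fun a => dualHahnArray N (P a).μ (P a).ρ (P a).σ x) (Ψ x)
  limC : ∀ ε ε' i j, CoefIndex N ε ε' i j →
    Filter.Tendsto (fun a => hahnC N (P a) ε ε' i j) l (𝓝 (C ε ε' i j))
  limD : ∀ ε ε' x y, CoefIndex N ε ε' x y →
    Filter.Tendsto (fun a => hahnD N (P a) ε ε' x y) l (𝓝 (D ε ε' x y))
  limF : ∀ x y, x + y ≤ N → Filter.Tendsto (fun a => hahnF N (P a) x y) l (𝓝 (F x y))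
  limG : ∀ i j, i + j ≤ N → Filter.Tendsto (fun a => hahnG N (P a) i j) l (𝓝 (G i j))
  limT : ∀ i j x y, i + j ≤ N → x + y ≤ N →
    Filter.Tendsto (fun a => hahnT N (P a) i j x y) l (𝓝 (tratnik Φ Ψ i j x y))

end

/-! The proof is a double change of basis resting on one-variable orthogonality. Rather than
deriving the recurrences from the Terwilliger conditions, it works with arrays (`Good`) that are
nondegenerate and satisfy the three-term recurrence for `u_i` and for the dual polynomials. Detailed
balance `k_i b_i = k_{i+1} c_{i+1}` makes the weighted recurrence symmetric, which yields
orthogonality; Newton interpolation gives the total mass `ν` (`Good.sum_k`). Hence the transition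
matrices satisfy `P P* = P* P = ν` (`Good.sum_p_mul`).

For compatible families, fix a basis `V_{x,y}`, pass to `V~_{x,j}` by the matrices of the `Ψ_x` and
then to `V*_{i,j}` by those of the `Φ_j`. Prescribe `X`, `Y`, `Y*` on the first basis and `X*` on
the second. The recurrences give the diagonal and tridiagonal actions. The constraints on `C` push
`Y` through the second change of basis, and those on `D` pull `X*` back through the first
(`SolvesC.sum_smul`, `exists_realizesActions`). The relation between `F` and `G` keeps the form
diagonal. Orthogonality also solves the constraints for `C`, so `C` is unique (`SolvesC.eq_coefC`).
The exchange `(Φ, Ψ) → (Ψ*, Φ*)` reduces every statement on `D` to one on `C` (`solvesD_iff`).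

For Hahn and dual Hahn arrays, `c_{j+1}(Ψ_x)` does not depend on `x`, `a_j(Ψ_x)` is affine in `x`,
and `b_{j-1}(Ψ_x)` is a multiple of `x - (N - j + 1)`. The constraints therefore become a raising
relation, the recurrence and a lowering relation for Hahn polynomials (`hahnBase_up_succ`,
`hahnBase_down`). The dual of a Hahn array is a dual Hahn array with the same parameters, so `D`
follows by exchanging parameters. The weights come down to the symmetry of a trinomial coefficient
(`dualK_mul_dualK`), and the degrees are read off Newton expansions (`IsDualHahnType.exists_poly`).

The Krawtchouk cases need no formulas of their own: all quantities, including the coefficients as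
expressed by `coefC`, are rational in the entries of the arrays, with denominators that survive in
the limit, so the identities pass to the limit (`exists_isHahnLimit`). -/

namespace ParamArray

/-! ### Nondegenerate and good arrays, agreement, duality of the polynomials -/

/-- The eigenvalues and the dual eigenvalues are distinct, and the split sequences do not
vanish. -/
structure Nondeg (Φ : ParamArray) : Prop where
  ev_ne : ∀ i j, i ≤ Φ.diam → j ≤ Φ.diam → i ≠ j → Φ.ev i ≠ Φ.ev j
  dev_ne : ∀ i j, i ≤ Φ.diam → j ≤ Φ.diam → i ≠ j → Φ.dev i ≠ Φ.dev j
  fst_ne : ∀ i, 1 ≤ i → i ≤ Φ.diam → Φ.fst i ≠ 0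
  snd_ne : ∀ i, 1 ≤ i → i ≤ Φ.diam → Φ.snd i ≠ 0

/-- The three-term recurrence of the polynomials `u_i`, at the eigenvalues. -/
def Rec (Φ : ParamArray) : Prop :=
  ∀ i x, i ≤ Φ.diam → x ≤ Φ.diam →
    Φ.ev x * Φ.u i (Φ.ev x) = Φ.c i * Φ.u (i - 1) (Φ.ev x) + Φ.a i * Φ.u i (Φ.ev x)
      + Φ.b i * Φ.u (i + 1) (Φ.ev x)

/-- A nondegenerate array for which the recurrences of the polynomials and of their duals
hold. -/
structure Good (Φ : ParamArray) : Prop extends Φ.Nondeg where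
  recur : Φ.Rec
  recur_star : Φ.star.Rec

theorem IsValid.nondeg {Φ : ParamArray} (h : Φ.IsValid) : Φ.Nondeg :=
  ⟨h.ev_ne, h.dev_ne, h.fst_ne, h.snd_ne⟩

@[simp] theorem star_diam (Φ : ParamArray) : Φ.star.diam = Φ.diam := rfl
@[simp] theorem star_ev (Φ : ParamArray) : Φ.star.ev = Φ.dev := rfl
@[simp] theorem star_dev (Φ : ParamArray) : Φ.star.dev = Φ.ev := rfl
@[simp] theorem star_fst (Φ : ParamArray) : Φ.star.fst = Φ.fst := rfl

theorem Nondeg.star {Φ : ParamArray} (h : Φ.Nondeg) : Φ.star.Nondeg where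
  ev_ne := h.dev_ne
  dev_ne := h.ev_ne
  fst_ne := h.fst_ne
  snd_ne i h1 h2 := h.snd_ne _ (by simp at h2; omega) (by simp at h2; omega)

/-- Agreement of two arrays at all meaningful indices. -/
structure Agree (Φ Φ' : ParamArray) : Prop where
  diam : Φ.diam = Φ'.diam
  ev : ∀ i ≤ Φ.diam, Φ.ev i = Φ'.ev i
  dev : ∀ i ≤ Φ.diam, Φ.dev i = Φ'.dev i
  fst : ∀ i, 1 ≤ i → i ≤ Φ.diam → Φ.fst i = Φ'.fst i
  snd : ∀ i, 1 ≤ i → i ≤ Φ.diam → Φ.snd i = Φ'.snd i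

namespace Agree

variable {Φ Φ' : ParamArray}

theorem symm (h : Agree Φ Φ') : Agree Φ' Φ where
  diam := h.diam.symm
  ev i hi := (h.ev i (h.diam ▸ hi)).symm
  dev i hi := (h.dev i (h.diam ▸ hi)).symm
  fst i hi hi' := (h.fst i hi (h.diam ▸ hi')).symm
  snd i hi hi' := (h.snd i hi (h.diam ▸ hi')).symm

theorem b_eq (h : Agree Φ Φ') (i : ℕ) : Φ.b i = Φ'.b i := by
  unfold b
  rw [← h.diam]
  split_ifs with hi
  · rw [h.fst _ (by omega) (by omega)]
    refine congrArg₂ _ (congrArg _ ?_) ?_ <;> refine Finset.prod_congr rfl fun k hk => ?_ <;>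
      rw [Finset.mem_range] at hk <;> rw [h.dev _ (by omega), h.dev _ (by omega)]
  · rfl

theorem bPrev_eq (h : Agree Φ Φ') (i : ℕ) : Φ.bPrev i = Φ'.bPrev i := by
  cases i with
  | zero => rfl
  | succ i => exact h.b_eq i

theorem c_eq (h : Agree Φ Φ') (i : ℕ) : Φ.c i = Φ'.c i := by
  unfold c
  rw [← h.diam]
  split_ifs with hi
  · rw [h.snd _ (by omega) (by omega)]
    refine congrArg₂ _ (congrArg _ ?_) ?_ <;> refine Finset.prod_congr rfl fun k hk => ?_ <;>
      rw [h.dev _ (by omega), h.dev _ (by omega)]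
  · rfl

theorem a_eq (h : Agree Φ Φ') {i : ℕ} (hi : i ≤ Φ.diam) : Φ.a i = Φ'.a i := by
  unfold a
  rw [← h.diam, h.ev _ hi, h.dev _ hi]
  refine congrArg₂ _ (congrArg _ ?_) ?_ <;> split_ifs with h1
  · rw [h.fst _ h1 hi, h.dev _ (by omega)]
  · rfl
  · rw [h.fst _ (by omega) (by omega), h.dev _ (by omega)]
  · rfl

theorem u_eq (h : Agree Φ Φ') {i : ℕ} (hi : i ≤ Φ.diam) (lam : ℂ) :
    Φ.u i lam = Φ'.u i lam := by
  unfold u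
  refine Finset.sum_congr rfl fun k hk => Finset.prod_congr rfl fun j hj => ?_
  rw [Finset.mem_range] at hk hj
  rw [h.ev _ (by omega), h.dev _ (by omega), h.dev _ (by omega), h.fst _ (by omega) (by omega)]

theorem k_eq (h : Agree Φ Φ') {i : ℕ} (hi : i ≤ Φ.diam) : Φ.k i = Φ'.k i := by
  unfold k
  rw [← h.diam]
  congr 1
  · congr 1
    · refine Finset.prod_congr rfl fun k hk => ?_
      rw [Finset.mem_Icc] at hk
      rw [h.fst _ (by omega) (by omega), h.snd _ (by omega) (by omega)]
    · refine Finset.prod_congr rfl fun k hk => ?_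
      rw [Finset.mem_Icc] at hk
      rw [h.dev _ (by omega), h.dev _ (by omega)]
  · refine Finset.prod_congr rfl fun k hk => ?_
    rw [Finset.mem_erase, Finset.mem_range] at hk
    rw [h.dev _ (by omega), h.dev _ (by omega)]

theorem p_eq (h : Agree Φ Φ') (x i : ℕ) : Φ.p x i = Φ'.p x i := by
  unfold p
  rw [← h.diam]
  split_ifs with hi
  · rw [h.k_eq hi.2, h.u_eq hi.2, h.ev _ hi.1]
  · rfl

theorem nu_eq (h : Agree Φ Φ') : Φ.nu = Φ'.nu := by
  unfold nu
  rw [← h.diam]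
  refine Finset.prod_congr rfl fun k hk => ?_
  rw [Finset.mem_Icc] at hk
  rw [h.ev _ (by omega), h.ev _ (by omega), h.dev _ (by omega), h.dev _ (by omega),
    h.snd _ (by omega) (by omega)]

end Agree

/-- Subtraction on indices is truncated, so `star` is an involution only on the meaningful indices.
This is why agreement is used in place of equality. -/
theorem star_star_agree (Φ : ParamArray) : Agree Φ.star.star Φ where
  diam := rfl
  ev _ _ := rfl
  dev _ _ := rfl
  fst _ _ _ := rfl
  snd i h1 h2 := by
    simp only [star] at h2 ⊢
    congr 1
    omega

variable {Φ : ParamArray}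

theorem c_zero : Φ.c 0 = 0 := by simp [c]

theorem c_eq_zero {i : ℕ} (h : Φ.diam < i) : Φ.c i = 0 := by
  unfold c
  rw [if_neg]
  omega

theorem b_eq_zero {i : ℕ} (h : Φ.diam ≤ i) : Φ.b i = 0 := by
  unfold b
  rw [if_neg]
  omega

theorem p_of_le {x i : ℕ} (hx : x ≤ Φ.diam) (hi : i ≤ Φ.diam) :
    Φ.p x i = Φ.k i * Φ.u i (Φ.ev x) := if_pos ⟨hx, hi⟩

theorem p_of_lt_left {x i : ℕ} (hx : Φ.diam < x) : Φ.p x i = 0 := if_neg (by omega)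

theorem p_of_lt_right {x i : ℕ} (hi : Φ.diam < i) : Φ.p x i = 0 := if_neg (by omega)

theorem Rec.congr {Φ' : ParamArray} (h : Agree Φ Φ') (hr : Φ.Rec) : Φ'.Rec := by
  intro i x hi hx
  rw [← h.diam] at hi hx
  have := hr i x hi hx
  rw [h.ev x hx, h.u_eq hi, h.u_eq (i := i - 1) (by omega), h.c_eq, h.a_eq hi, h.b_eq] at this
  rw [this]
  -- For `i = d` the polynomial `u_{d+1}` involves entries on which the arrays may differ, but it is
  -- multiplied by `b_d = 0`.
  rcases hi.lt_or_eq with h1 | h1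
  · rw [h.u_eq (by omega : i + 1 ≤ Φ.diam)]
  · rw [← h.b_eq, b_eq_zero (by omega : Φ.diam ≤ i)]
    ring

theorem Good.star (h : Φ.Good) : Φ.star.Good where
  toNondeg := h.toNondeg.star
  recur := h.recur_star
  recur_star := h.recur.congr Φ.star_star_agree.symm

/-- The summands beyond `k = i` contain the factor `θ*_i - θ*_i`, so the sum may be prolonged
freely. -/
theorem u_eq_sum_range {i n : ℕ} (h : i ≤ n) (lam : ℂ) :
    Φ.u i lam = ∑ k ∈ Finset.range (n + 1), ∏ j ∈ Finset.range k,
      ((lam - Φ.ev j) * (Φ.dev i - Φ.dev j) / Φ.fst (j + 1)) := by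
  unfold u
  refine Finset.sum_subset (fun k => by simp only [Finset.mem_range]; omega) fun k _ hk => ?_
  refine Finset.prod_eq_zero (i := i) (by simp only [Finset.mem_range] at hk ⊢; omega) ?_
  simp

/-- Askey–Wilson duality: once both sums run up to `i + x`, the summand is symmetric under
exchanging `(x, θ)` with `(i, θ*)`. -/
theorem u_star (i x : ℕ) : Φ.u i (Φ.ev x) = Φ.star.u x (Φ.dev i) := by
  rw [u_eq_sum_range (Nat.le_add_right i x), u_eq_sum_range (Nat.le_add_left x i)]
  refine Finset.sum_congr rfl fun k _ => Finset.prod_congr rfl fun j _ => ?_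
  simp only [star_ev, star_dev, star_fst]
  ring

theorem u_zero (lam : ℂ) : Φ.u 0 lam = 1 := by simp [u]

theorem u_ev_zero (i : ℕ) : Φ.u i (Φ.ev 0) = 1 := by rw [u_star, u_zero]

/-! ### Nonvanishing of `k`, `b`, `c`, `ν`, and detailed balance -/

section Products

theorem prod_split_index (f : ℕ → ℂ) {d i : ℕ} (h : i ≤ d) :
    ∏ h ∈ (Finset.range (d + 1)).erase i, f h =
      (∏ h ∈ Finset.range i, f h) * ∏ h ∈ Finset.Icc (i + 1) d, f h := by
  rw [← Finset.prod_union]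
  · refine Finset.prod_congr ?_ fun _ _ => rfl
    ext k
    simp only [Finset.mem_erase, Finset.mem_range, Finset.mem_union, Finset.mem_Icc]
    omega
  · rw [Finset.disjoint_left]
    intro k
    simp only [Finset.mem_range, Finset.mem_Icc]
    omega

theorem prod_range_rev (f : ℕ → ℂ) {d i : ℕ} (h : i ≤ d) :
    ∏ h ∈ Finset.range (d - i), f (d - h) = ∏ h ∈ Finset.Icc (i + 1) d, f h := by
  refine Finset.prod_nbij' (fun k => d - k) (fun k => d - k) ?_ ?_ ?_ ?_ ?_ <;>
    simp only [Finset.mem_range, Finset.mem_Icc] <;> intros <;> first | omega | trivial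

end Products

theorem Nondeg.prod_dev_ne (h : Φ.Nondeg) {s : Finset ℕ} {i : ℕ} (hi : i ≤ Φ.diam)
    (hs : ∀ k ∈ s, k ≤ Φ.diam ∧ k ≠ i) : ∏ k ∈ s, (Φ.dev i - Φ.dev k) ≠ 0 :=
  Finset.prod_ne_zero_iff.2 fun k hk =>
    sub_ne_zero.2 (h.dev_ne _ _ hi (hs k hk).1 (hs k hk).2.symm)

theorem Nondeg.k_ne (h : Φ.Nondeg) {i : ℕ} (hi : i ≤ Φ.diam) : Φ.k i ≠ 0 := by
  unfold k
  refine div_ne_zero (mul_ne_zero (Finset.prod_ne_zero_iff.2 fun k hk => ?_)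
    (h.prod_dev_ne (Nat.zero_le _) fun k hk => ?_)) (h.prod_dev_ne hi fun k hk => ?_)
  · rw [Finset.mem_Icc] at hk
    exact div_ne_zero (h.fst_ne _ hk.1 (by omega)) (h.snd_ne _ hk.1 (by omega))
  · rw [Finset.mem_Icc] at hk; omega
  · rw [Finset.mem_erase, Finset.mem_range] at hk; omega

theorem Nondeg.k_zero (h : Φ.Nondeg) : Φ.k 0 = 1 := by
  unfold k
  rw [prod_split_index _ (Nat.zero_le _)]
  simp only [Finset.range_zero, Finset.prod_empty, one_mul]
  rw [Finset.Icc_eq_empty (by omega), Finset.prod_empty, one_mul, zero_add]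
  exact div_self (h.prod_dev_ne (Nat.zero_le _) fun k hk => by rw [Finset.mem_Icc] at hk; omega)

theorem Nondeg.nu_ne (h : Φ.Nondeg) : Φ.nu ≠ 0 := by
  unfold nu
  refine Finset.prod_ne_zero_iff.2 fun k hk => ?_
  rw [Finset.mem_Icc] at hk
  exact div_ne_zero (mul_ne_zero (sub_ne_zero.2 (h.ev_ne _ _ (by omega) (by omega) (by omega)))
    (sub_ne_zero.2 (h.dev_ne _ _ (by omega) (by omega) (by omega)))) (h.snd_ne _ hk.1 hk.2)

theorem Nondeg.b_ne (h : Φ.Nondeg) {i : ℕ} (hi : i < Φ.diam) : Φ.b i ≠ 0 := by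
  unfold b
  rw [if_pos hi]
  refine div_ne_zero (mul_ne_zero (h.fst_ne _ (by omega) (by omega))
    (h.prod_dev_ne (by omega) fun k hk => ?_)) (h.prod_dev_ne (by omega) fun k hk => ?_) <;>
    rw [Finset.mem_range] at hk <;> omega

/-- Reversing the order of the factors brings `c` to products over indices above `i`, the form in
which they meet the split denominator of `k_i`. -/
theorem c_eq' {i : ℕ} (hi : i + 1 ≤ Φ.diam) :
    Φ.c (i + 1) = Φ.snd (i + 1) *
      (∏ h ∈ Finset.Icc (i + 2) Φ.diam, (Φ.dev (i + 1) - Φ.dev h)) /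
      ∏ h ∈ Finset.Icc (i + 1) Φ.diam, (Φ.dev i - Φ.dev h) := by
  unfold c
  rw [if_pos (by omega), prod_range_rev (fun h => Φ.dev (i + 1) - Φ.dev h) hi,
    show Φ.diam - (i + 1) + 1 = Φ.diam - i by omega,
    ← prod_range_rev (fun h => Φ.dev i - Φ.dev h) (by omega : i ≤ Φ.diam)]
  rfl

theorem Nondeg.c_ne (h : Φ.Nondeg) {i : ℕ} (h1 : 1 ≤ i) (hi : i ≤ Φ.diam) : Φ.c i ≠ 0 := by
  obtain ⟨i, rfl⟩ := Nat.exists_eq_add_of_le' h1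
  rw [c_eq' hi]
  refine div_ne_zero (mul_ne_zero (h.snd_ne _ (by omega) (by omega))
    (h.prod_dev_ne (by omega) fun k hk => ?_)) (h.prod_dev_ne (by omega) fun k hk => ?_) <;>
    rw [Finset.mem_Icc] at hk <;> omega

/-- Detailed balance, which makes the recurrence symmetric for the weights `k_i`. It follows from
the definitions by cancelling products; none of the Terwilliger equations enters. -/
theorem Nondeg.k_mul_b (h : Φ.Nondeg) {i : ℕ} (hi : i < Φ.diam) :
    Φ.k i * Φ.b i = Φ.k (i + 1) * Φ.c (i + 1) := by
  rw [c_eq' hi]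
  unfold k b
  rw [if_pos hi, prod_split_index _ hi.le, prod_split_index _ (by omega : i + 1 ≤ Φ.diam),
    Finset.prod_Icc_succ_top (by omega : 1 ≤ i + 1)]
  have h1 := h.prod_dev_ne (i := i) (s := Finset.range i) hi.le
    (fun k hk => by rw [Finset.mem_range] at hk; omega)
  have h2 := h.prod_dev_ne (i := i) (s := Finset.Icc (i + 1) Φ.diam) hi.le
    (fun k hk => by rw [Finset.mem_Icc] at hk; omega)
  have h3 := h.prod_dev_ne (i := i + 1) (s := Finset.range (i + 1)) (by omega)
    (fun k hk => by rw [Finset.mem_range] at hk; omega)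
  have h4 := h.prod_dev_ne (i := i + 1) (s := Finset.Icc (i + 1 + 1) Φ.diam) (by omega)
    (fun k hk => by rw [Finset.mem_Icc] at hk; omega)
  have h5 := h.snd_ne (i + 1) (by omega) (by omega)
  rw [show i + 2 = i + 1 + 1 from rfl]
  field_simp

/-- The reversal of the second split sequence under `star` only permutes the denominators. -/
theorem nu_star : Φ.star.nu = Φ.nu := by
  unfold nu
  simp only [star, Finset.prod_div_distrib]
  congr 1
  · exact Finset.prod_congr rfl fun _ _ => mul_comm _ _
  · refine Finset.prod_nbij' (fun k => Φ.diam + 1 - k) (fun k => Φ.diam + 1 - k) ?_ ?_ ?_ ?_ ?_ <;>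
      simp only [Finset.mem_Icc] <;> intros <;> first | omega | trivial

/-! ### Recurrences for the transition coefficients and orthogonality -/

/-- The recurrence in terms of the transition coefficients `p_{xi}`. -/
theorem Good.p_rec (h : Φ.Good) {x i : ℕ} (hx : x ≤ Φ.diam) (hi : i ≤ Φ.diam) :
    Φ.ev x * Φ.p x i = Φ.bPrev i * Φ.p x (i - 1) + Φ.a i * Φ.p x i
      + Φ.c (i + 1) * Φ.p x (i + 1) := by
  have h1 : Φ.bPrev i * Φ.p x (i - 1) = Φ.k i * (Φ.c i * Φ.u (i - 1) (Φ.ev x)) := by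
    cases i with
    | zero => simp [bPrev, c_zero]
    | succ i =>
      rw [p_of_le hx (by omega)]
      simp only [bPrev, Nat.add_sub_cancel]
      linear_combination Φ.u i (Φ.ev x) * h.k_mul_b (by omega : i < Φ.diam)
  have h2 : Φ.c (i + 1) * Φ.p x (i + 1) = Φ.k i * (Φ.b i * Φ.u (i + 1) (Φ.ev x)) := by
    rcases hi.lt_or_eq with h1 | h1
    · rw [p_of_le hx (by omega)]
      linear_combination -Φ.u (i + 1) (Φ.ev x) * h.k_mul_b h1
    · rw [c_eq_zero (by omega), b_eq_zero (by omega)]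
      ring
  rw [h1, h2, p_of_le hx hi]
  linear_combination Φ.k i * h.recur i x hi hx

/-- The recurrence of the dual array, as a relation in the index `x` of `p_{xi}`. -/
theorem Good.p_rec_dual (h : Φ.Good) {x i : ℕ} (hx : x ≤ Φ.diam) (hi : i ≤ Φ.diam) :
    Φ.dev i * Φ.p x i = Φ.star.c x * Φ.p (x - 1) i + Φ.star.a x * Φ.p x i
      + Φ.star.b x * Φ.p (x + 1) i := by
  have h1 := h.recur_star x i hx hi
  simp only [star_ev, ← u_star] at h1
  rw [p_of_le hx hi, p_of_le (by omega) hi]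
  rcases hx.lt_or_eq with h2 | h2
  · rw [p_of_le (by omega) hi]
    linear_combination Φ.k i * h1
  · rw [b_eq_zero (by simp; omega)] at h1 ⊢
    linear_combination Φ.k i * h1

/-- The recurrence operator is self-adjoint for the weights `k_i`, and the vectors `(u_i(θ_x))_i`
and `(u_i(θ_y))_i` belong to different eigenvalues. -/
theorem Good.sum_k_u_u (h : Φ.Good) {x y : ℕ} (hx : x ≤ Φ.diam) (hy : y ≤ Φ.diam) (hxy : x ≠ y) :
    ∑ i ∈ Finset.range (Φ.diam + 1), Φ.k i * Φ.u i (Φ.ev x) * Φ.u i (Φ.ev y) = 0 := by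
  -- Detailed balance turns the `c`-terms into `b`-terms with shifted index, and the resulting
  -- expression is symmetric in `x` and `y`.
  have key : ∀ x y, x ≤ Φ.diam → y ≤ Φ.diam →
      Φ.ev x * ∑ i ∈ Finset.range (Φ.diam + 1), Φ.k i * Φ.u i (Φ.ev x) * Φ.u i (Φ.ev y) =
      ∑ i ∈ Finset.range Φ.diam, Φ.k i * Φ.b i *
        (Φ.u i (Φ.ev x) * Φ.u (i + 1) (Φ.ev y) + Φ.u i (Φ.ev y) * Φ.u (i + 1) (Φ.ev x)) +
      ∑ i ∈ Finset.range (Φ.diam + 1), Φ.k i * Φ.a i * (Φ.u i (Φ.ev x) * Φ.u i (Φ.ev y)) := by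
    intro x y hx hy
    have e1 : ∑ i ∈ Finset.range (Φ.diam + 1),
        Φ.k i * Φ.c i * Φ.u (i - 1) (Φ.ev x) * Φ.u i (Φ.ev y) =
        ∑ i ∈ Finset.range Φ.diam, Φ.k i * Φ.b i * Φ.u i (Φ.ev x) * Φ.u (i + 1) (Φ.ev y) := by
      rw [Finset.sum_range_succ', c_zero]
      simp only [mul_zero, zero_mul, add_zero, Nat.add_sub_cancel]
      refine Finset.sum_congr rfl fun i hi => ?_
      rw [Finset.mem_range] at hi
      rw [h.k_mul_b hi]
    have e2 : ∑ i ∈ Finset.range (Φ.diam + 1),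
        Φ.k i * Φ.b i * Φ.u (i + 1) (Φ.ev x) * Φ.u i (Φ.ev y) =
        ∑ i ∈ Finset.range Φ.diam, Φ.k i * Φ.b i * Φ.u (i + 1) (Φ.ev x) * Φ.u i (Φ.ev y) := by
      rw [Finset.sum_range_succ, b_eq_zero le_rfl]
      simp
    rw [Finset.mul_sum]
    trans ∑ i ∈ Finset.range (Φ.diam + 1),
      (Φ.k i * Φ.c i * Φ.u (i - 1) (Φ.ev x) * Φ.u i (Φ.ev y) +
        Φ.k i * Φ.b i * Φ.u (i + 1) (Φ.ev x) * Φ.u i (Φ.ev y) +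
        Φ.k i * Φ.a i * (Φ.u i (Φ.ev x) * Φ.u i (Φ.ev y)))
    · refine Finset.sum_congr rfl fun i hi => ?_
      rw [Finset.mem_range] at hi
      linear_combination Φ.k i * Φ.u i (Φ.ev y) * h.recur i x (by omega) hx
    · rw [Finset.sum_add_distrib, Finset.sum_add_distrib, e1, e2, ← Finset.sum_add_distrib]
      congr 1
      exact Finset.sum_congr rfl fun i _ => by ring
  have h1 := key x y hx hy
  have h2 := key y x hy hx
  have h3 : (Φ.ev x - Φ.ev y) *
      ∑ i ∈ Finset.range (Φ.diam + 1), Φ.k i * Φ.u i (Φ.ev x) * Φ.u i (Φ.ev y) = 0 := by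
    have e : ∑ i ∈ Finset.range (Φ.diam + 1), Φ.k i * Φ.u i (Φ.ev y) * Φ.u i (Φ.ev x) =
        ∑ i ∈ Finset.range (Φ.diam + 1), Φ.k i * Φ.u i (Φ.ev x) * Φ.u i (Φ.ev y) :=
      Finset.sum_congr rfl fun i _ => by ring
    rw [e] at h2
    rw [sub_mul, h1, h2, sub_eq_zero]
    congr 1 <;> exact Finset.sum_congr rfl fun i _ => by ring
  exact (mul_eq_zero.1 h3).resolve_left (sub_ne_zero.2 (h.ev_ne _ _ hx hy hxy))

/-- Newton interpolation: the partial sums of the basic series. -/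
theorem sum_newton (h : Φ.Nondeg) (lam : ℂ) {n : ℕ} (hn : n ≤ Φ.diam) :
    ∑ k ∈ Finset.range (n + 1), (∏ j ∈ Finset.range k, (lam - Φ.ev j)) /
      (∏ j ∈ Finset.range k, (Φ.ev 0 - Φ.ev (j + 1))) =
    ∏ j ∈ Finset.range n, ((lam - Φ.ev (j + 1)) / (Φ.ev 0 - Φ.ev (j + 1))) := by
  induction n with
  | zero => simp
  | succ n ih =>
    rw [Finset.sum_range_succ, ih (by omega), Finset.prod_div_distrib, Finset.prod_div_distrib,
      Finset.prod_range_succ' (fun j => lam - Φ.ev j),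
      Finset.prod_range_succ (fun j => lam - Φ.ev (j + 1)),
      Finset.prod_range_succ (fun j => Φ.ev 0 - Φ.ev (j + 1))]
    have h1 : ∏ j ∈ Finset.range n, (Φ.ev 0 - Φ.ev (j + 1)) ≠ 0 :=
      Finset.prod_ne_zero_iff.2 fun k hk => sub_ne_zero.2
        (h.ev_ne _ _ (by omega) (by rw [Finset.mem_range] at hk; omega) (by omega))
    have h2 : Φ.ev 0 - Φ.ev (n + 1) ≠ 0 :=
      sub_ne_zero.2 (h.ev_ne _ _ (by omega) (by omega) (by omega))
    field_simp
    ring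

theorem prod_Icc_one (f : ℕ → ℂ) (d : ℕ) :
    ∏ h ∈ Finset.Icc 1 d, f h = ∏ h ∈ Finset.range d, f (h + 1) := by
  rw [Finset.range_eq_Ico, Finset.prod_Ico_add' f 0 d 1]
  rfl

/-- Orthogonality to `x = 0` is a triangular linear system for the factorial moments `S n` of the
weights, and Newton interpolation exhibits its solution up to the factor `S 0`. The top moment has a
single nonzero term, `i = d`, and fixes that factor. -/
theorem Good.sum_k (h : Φ.Good) : ∑ i ∈ Finset.range (Φ.diam + 1), Φ.k i = Φ.nu := by
  set S : ℕ → ℂ := fun n => ∑ i ∈ Finset.range (Φ.diam + 1),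
    Φ.k i * ∏ j ∈ Finset.range n, (Φ.dev i - Φ.dev j) with hS
  have hf : ∀ n ≤ Φ.diam, ∏ j ∈ Finset.range n, Φ.fst (j + 1) ≠ 0 := fun n hn =>
    Finset.prod_ne_zero_iff.2 fun k hk =>
      h.fst_ne _ (by omega) (by rw [Finset.mem_range] at hk; omega)
  have he : ∀ n ≤ Φ.diam, ∏ j ∈ Finset.range n, (Φ.ev 0 - Φ.ev (j + 1)) ≠ 0 := fun n hn =>
    Finset.prod_ne_zero_iff.2 fun k hk => sub_ne_zero.2
      (h.ev_ne _ _ (by omega) (by rw [Finset.mem_range] at hk; omega) (by omega))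
  -- Since `u_i(θ_0) = 1`, this is orthogonality of `x` and `0`, with `u_i(θ_x)` expanded by duality
  -- in the products of `θ*_i - θ*_j`.
  have hsum : ∀ x, 1 ≤ x → x ≤ Φ.diam → ∑ n ∈ Finset.range (x + 1),
      (∏ j ∈ Finset.range n, (Φ.ev x - Φ.ev j)) * (S n / ∏ j ∈ Finset.range n, Φ.fst (j + 1))
        = 0 := by
    intro x h1 hx
    have h0 := h.sum_k_u_u hx (Nat.zero_le _) (by omega)
    simp only [u_ev_zero, mul_one] at h0
    rw [← h0]
    simp only [u_star, hS]
    rw [← Finset.sum_congr rfl fun n _ => (congrArg _ (Finset.sum_div _ _ _)).symm]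
    simp only [u, Finset.mul_sum]
    rw [Finset.sum_comm]
    refine Finset.sum_congr rfl fun i _ => Finset.sum_congr rfl fun n _ => ?_
    simp only [star_ev, star_dev, star_fst, Finset.prod_div_distrib, Finset.prod_mul_distrib]
    ring
  -- The Newton sum at `θ_n` with `n ≥ 1` vanishes, so it satisfies the same triangular system as
  -- `hsum`; the diagonal coefficient is nonzero, and strong induction compares the two.
  have hSn : ∀ n ≤ Φ.diam, S n / ∏ j ∈ Finset.range n, Φ.fst (j + 1) =
      S 0 / ∏ j ∈ Finset.range n, (Φ.ev 0 - Φ.ev (j + 1)) := by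
    intro n
    induction n using Nat.strong_induction_on with
    | _ n ih =>
      intro hn
      rcases Nat.eq_zero_or_pos n with rfl | hpos
      · simp
      have e1 := hsum n hpos hn
      have e2 := sum_newton h.toNondeg (Φ.ev n) hn
      rw [Finset.prod_eq_zero (i := n - 1) (by rw [Finset.mem_range]; omega)
        (by rw [Nat.sub_add_cancel hpos]; simp)] at e2
      rw [Finset.sum_range_succ] at e1 e2
      have e3 : ∑ k ∈ Finset.range n, (∏ j ∈ Finset.range k, (Φ.ev n - Φ.ev j)) *
          (S k / ∏ j ∈ Finset.range k, Φ.fst (j + 1)) =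
          S 0 * ∑ k ∈ Finset.range n, (∏ j ∈ Finset.range k, (Φ.ev n - Φ.ev j)) /
            ∏ j ∈ Finset.range k, (Φ.ev 0 - Φ.ev (j + 1)) := by
        rw [Finset.mul_sum]
        refine Finset.sum_congr rfl fun k hk => ?_
        rw [Finset.mem_range] at hk
        rw [ih k hk (by omega)]
        ring
      have e4 : ∏ j ∈ Finset.range n, (Φ.ev n - Φ.ev j) ≠ 0 :=
        Finset.prod_ne_zero_iff.2 fun k hk => sub_ne_zero.2
          (h.ev_ne _ _ (by omega) (by rw [Finset.mem_range] at hk; omega)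
            (by rw [Finset.mem_range] at hk; omega))
      apply mul_left_cancel₀ e4
      rw [e3] at e1
      linear_combination e1 - S 0 * e2
  have hd := hSn Φ.diam le_rfl
  have hSd : S Φ.diam = Φ.k Φ.diam * ∏ j ∈ Finset.range Φ.diam, (Φ.dev Φ.diam - Φ.dev j) := by
    simp only [hS]
    rw [Finset.sum_range_succ, Finset.sum_eq_zero, zero_add]
    intro i hi
    rw [Finset.prod_eq_zero hi (sub_self _), mul_zero]
  have hS0 : S 0 = ∑ i ∈ Finset.range (Φ.diam + 1), Φ.k i := by simp [hS]
  rw [← hS0]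
  have h1 := he _ le_rfl
  have h2 := hf _ le_rfl
  have h3 := h.prod_dev_ne (i := Φ.diam) (s := Finset.range Φ.diam) le_rfl
    (fun k hk => by rw [Finset.mem_range] at hk; omega)
  have h4 : ∏ j ∈ Finset.range Φ.diam, Φ.snd (j + 1) ≠ 0 :=
    Finset.prod_ne_zero_iff.2 fun k hk =>
      h.snd_ne _ (by omega) (by rw [Finset.mem_range] at hk; omega)
  rw [hSd] at hd
  unfold k at hd
  rw [prod_split_index _ le_rfl, Finset.Icc_eq_empty (by omega : ¬ Φ.diam + 1 ≤ Φ.diam),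
    Finset.prod_empty, mul_one] at hd
  unfold nu
  simp only [prod_Icc_one, Finset.prod_div_distrib, Finset.prod_mul_distrib] at hd ⊢
  field_simp at hd ⊢
  linear_combination -hd

/-- `P P* = ν`. -/
theorem Good.sum_p_mul (h : Φ.Good) {x y : ℕ} (hx : x ≤ Φ.diam) (hy : y ≤ Φ.diam) :
    ∑ i ∈ Finset.range (Φ.diam + 1), Φ.p x i * Φ.star.p i y = if x = y then Φ.nu else 0 := by
  have hp : ∀ x ≤ Φ.diam, ∀ i ≤ Φ.diam, Φ.p x i = Φ.k i * Φ.u i (Φ.ev x) :=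
    fun x hx i hi => p_of_le hx hi
  have hq : ∀ x ≤ Φ.diam, ∀ i ≤ Φ.diam, Φ.star.p i x = Φ.star.k x * Φ.u i (Φ.ev x) := by
    intro x hx i hi
    rw [p_of_le (by exact hi) (by exact hx), star_ev, u_star]
  have off1 : ∀ x ≤ Φ.diam, ∀ y ≤ Φ.diam, x ≠ y →
      ∑ i ∈ Finset.range (Φ.diam + 1), Φ.p x i * Φ.star.p i y = 0 := by
    intro x hx y hy hxy
    trans Φ.star.k y *
      ∑ i ∈ Finset.range (Φ.diam + 1), Φ.k i * Φ.u i (Φ.ev x) * Φ.u i (Φ.ev y)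
    · rw [Finset.mul_sum]
      refine Finset.sum_congr rfl fun i hi => ?_
      rw [Finset.mem_range] at hi
      rw [hp x hx i (by omega), hq y hy i (by omega)]
      ring
    · rw [h.sum_k_u_u hx hy hxy, mul_zero]
  have off2 : ∀ i ≤ Φ.diam, ∀ j ≤ Φ.diam, i ≠ j →
      ∑ x ∈ Finset.range (Φ.diam + 1), Φ.star.p i x * Φ.p x j = 0 := by
    intro i hi j hj hij
    trans Φ.k j * ∑ x ∈ Finset.range (Φ.diam + 1),
      Φ.star.k x * Φ.star.u x (Φ.dev i) * Φ.star.u x (Φ.dev j)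
    · rw [Finset.mul_sum]
      refine Finset.sum_congr rfl fun x hx => ?_
      rw [Finset.mem_range] at hx
      rw [hp x (by omega) j hj, hq x (by omega) i hi, u_star, u_star]
      ring
    · have := h.star.sum_k_u_u (x := i) (y := j) hi hj hij
      simp only [star_diam, star_ev] at this
      rw [this, mul_zero]
  split_ifs with hxy
  · subst hxy
    -- The entry `(x, 0)` of `P P* P`, computed in two ways. Both `P P*` and `P* P` are already
    -- known to be diagonal, so the diagonal entry at `x` of the former equals the entry at `0` of
    -- the latter, because `p_{x0} = 1`; that entry is the total mass of the dual weights.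
    have e1 : ∑ i ∈ Finset.range (Φ.diam + 1), ∑ z ∈ Finset.range (Φ.diam + 1),
        Φ.p x i * Φ.star.p i z * Φ.p z 0 =
        (∑ i ∈ Finset.range (Φ.diam + 1), Φ.p x i * Φ.star.p i x) * Φ.p x 0 := by
      rw [Finset.sum_comm, Finset.sum_eq_single x]
      · rw [Finset.sum_mul]
      · intro z hz hne
        rw [Finset.mem_range] at hz
        rw [← Finset.sum_mul, off1 x hx z (by omega) hne.symm, zero_mul]
      · intro hn
        simp only [Finset.mem_range] at hn
        omega
    have e2 : ∑ i ∈ Finset.range (Φ.diam + 1), ∑ z ∈ Finset.range (Φ.diam + 1),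
        Φ.p x i * Φ.star.p i z * Φ.p z 0 =
        Φ.p x 0 * ∑ z ∈ Finset.range (Φ.diam + 1), Φ.star.p 0 z * Φ.p z 0 := by
      rw [Finset.sum_eq_single 0]
      · rw [Finset.mul_sum]
        exact Finset.sum_congr rfl fun z _ => by ring
      · intro i hi hne
        rw [Finset.mem_range] at hi
        rw [Finset.sum_congr rfl fun z _ => mul_assoc _ _ _, ← Finset.mul_sum,
          off2 i (by omega) 0 (by omega) hne, mul_zero]
      · intro hn
        simp only [Finset.mem_range] at hn
        omega
    have e3 : Φ.p x 0 = 1 := by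
      rw [hp x hx 0 (by omega), u_zero, h.k_zero, mul_one]
    have e4 : ∑ z ∈ Finset.range (Φ.diam + 1), Φ.star.p 0 z * Φ.p z 0 = Φ.nu := by
      rw [← nu_star, ← h.star.sum_k]
      refine Finset.sum_congr rfl fun z hz => ?_
      rw [Finset.mem_range, star_diam] at hz
      rw [hp z (by omega) 0 (by omega), hq z (by omega) 0 (by omega), u_zero, h.k_zero]
      ring
    rw [e1, e3, e4] at e2
    linear_combination e2
  · exact off1 x hx y hy hxy

/-- `P* P = ν`. -/
theorem Good.sum_p_mul' (h : Φ.Good) {i j : ℕ} (hi : i ≤ Φ.diam) (hj : j ≤ Φ.diam) :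
    ∑ x ∈ Finset.range (Φ.diam + 1), Φ.star.p i x * Φ.p x j = if i = j then Φ.nu else 0 := by
  have := h.star.sum_p_mul (x := i) (y := j) hi hj
  rw [nu_star] at this
  rw [← this]
  exact Finset.sum_congr rfl fun x _ => by rw [Φ.star_star_agree.p_eq]

/-- Both sides equal `k*_x k_i` times the common value of the polynomial and its dual. -/
theorem star_p (i x : ℕ) : Φ.star.p i x * Φ.k i = Φ.star.k x * Φ.p x i := by
  unfold p
  rw [star_diam, star_ev, u_star]
  by_cases hi : i ≤ Φ.diam <;> by_cases hx : x ≤ Φ.diam <;> simp [hi, hx]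
  ring

end ParamArray

/-! ### Pairs of maps that are diagonal in a common basis -/

section DiagonalBasis

variable {V ι : Type*} [AddCommGroup V] [Module ℂ V]

theorem repr_of_diag (w : Module.Basis ι ℂ V) {S : Module.End ℂ V} {α : ι → ℂ}
    (hS : ∀ q, S (w q) = α q • w q) (u : V) (q : ι) : w.repr (S u) q = α q * w.repr u q := by
  classical
  have h : (w.coord q) ∘ₗ S = α q • w.coord q := by
    refine w.ext fun q' => ?_
    simp only [LinearMap.comp_apply, hS, map_smul, LinearMap.smul_apply, smul_eq_mul,
      Module.Basis.coord_apply, Module.Basis.repr_self, Finsupp.single_apply]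
    split_ifs with h
    · rw [h]
    · simp
  exact LinearMap.congr_fun h u

theorem mem_span_of_joint_eigen [Fintype ι] (w : Module.Basis ι ℂ V) {S T : Module.End ℂ V}
    {α β : ι → ℂ} (hS : ∀ q, S (w q) = α q • w q) (hT : ∀ q, T (w q) = β q • w q)
    (hd : ∀ q q', α q = α q' → β q = β q' → q = q') {u : V} {q : ι} (h1 : S u = α q • u)
    (h2 : T u = β q • u) : u ∈ Submodule.span ℂ {w q} := by
  rw [← w.sum_repr u]
  refine Submodule.sum_mem _ fun q' _ => ?_
  rcases eq_or_ne q' q with rfl | hne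
  · exact Submodule.smul_mem _ _ (Submodule.mem_span_singleton_self _)
  · have e1 := repr_of_diag w hS u q'
    have e2 := repr_of_diag w hT u q'
    rw [h1, map_smul, Finsupp.smul_apply, smul_eq_mul] at e1
    rw [h2, map_smul, Finsupp.smul_apply, smul_eq_mul] at e2
    have : w.repr u q' = 0 := by
      by_contra h0
      exact hne (hd _ _ (mul_right_cancel₀ h0 e1).symm (mul_right_cancel₀ h0 e2).symm)
    rw [this, zero_smul]
    exact Submodule.zero_mem _

/-- A nonzero coordinate `q` of one nonzero vector of `W` identifies the eigenvalues of `S` and `T`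
on `W`, and joint eigenvalues determine the line. The set `H` is only required to contain `S` and
`T`, so that the lemma serves both for the plane they span and for the bare pair. -/
theorem eq_span_of_isCommonEigenspace [Fintype ι] (w : Module.Basis ι ℂ V)
    {S T : Module.End ℂ V} {α β : ι → ℂ} (hS : ∀ q, S (w q) = α q • w q) (hT : ∀ q, T (w q) = β q • w q)
    (hd : ∀ q q', α q = α q' → β q = β q' → q = q') {H : Set (Module.End ℂ V)}
    (hSH : S ∈ H) (hTH : T ∈ H) {W : Submodule ℂ V} (hW : IsCommonEigenspace H W) :
    ∃ q, W = Submodule.span ℂ {w q} := by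
  obtain ⟨hne, χ, hχ⟩ := hW
  obtain ⟨u, huW, hu⟩ := W.ne_bot_iff.1 hne
  have hu' : w.repr u ≠ 0 := by simpa using hu
  obtain ⟨q, hq⟩ := Finsupp.ne_iff.1 hu'
  have e1 := repr_of_diag w hS u q
  have e2 := repr_of_diag w hT u q
  rw [(hχ u).1 huW S hSH, map_smul, Finsupp.smul_apply, smul_eq_mul] at e1
  rw [(hχ u).1 huW T hTH, map_smul, Finsupp.smul_apply, smul_eq_mul] at e2
  have e1 := mul_right_cancel₀ hq e1
  have e2 := mul_right_cancel₀ hq e2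
  have hle : W ≤ Submodule.span ℂ {w q} := by
    intro u' hu'
    refine mem_span_of_joint_eigen w hS hT hd ?_ ?_
    · rw [← e1]; exact (hχ u').1 hu' S hSH
    · rw [← e2]; exact (hχ u').1 hu' T hTH
  refine ⟨q, le_antisymm hle ?_⟩
  obtain ⟨a, rfl⟩ := Submodule.mem_span_singleton.1 (hle huW)
  have ha : a ≠ 0 := by rintro rfl; simp at hu
  rw [Submodule.span_singleton_le_iff_mem]
  have := W.smul_mem a⁻¹ huW
  rwa [smul_smul, inv_mul_cancel₀ ha, one_smul] at this

theorem apply_eq_repr_smul_of_mem_span (w : Module.Basis ι ℂ V) {S T : Module.End ℂ V}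
    {α β : ι → ℂ} (hS : ∀ q, S (w q) = α q • w q) (hT : ∀ q, T (w q) = β q • w q)
    {h : Module.End ℂ V} (hh : h ∈ Submodule.span ℂ {S, T}) :
    ∃ χ : ι → ℂ, ∀ q, h (w q) = χ q • w q := by
  obtain ⟨a, b, rfl⟩ := Submodule.mem_span_pair.1 hh
  refine ⟨fun q => a * α q + b * β q, fun q => ?_⟩
  simp only [LinearMap.add_apply, LinearMap.smul_apply, hS, hT, smul_smul, add_smul]

theorem isCommonEigenspace_span [Fintype ι] (w : Module.Basis ι ℂ V) {S T : Module.End ℂ V}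
    {α β : ι → ℂ} (hS : ∀ q, S (w q) = α q • w q) (hT : ∀ q, T (w q) = β q • w q)
    (hd : ∀ q q', α q = α q' → β q = β q' → q = q') (q : ι) :
    IsCommonEigenspace (Submodule.span ℂ {S, T} : Set (Module.End ℂ V))
      (Submodule.span ℂ {w q}) := by
  -- The eigenvalue of `h` on the line is read off as the `q`-th coordinate of `h (w q)`, which
  -- makes sense for every `h`.
  refine ⟨by simpa using w.ne_zero q, fun h => w.repr (h (w q)) q, fun u => ⟨fun hu h hh => ?_,
    fun hu => ?_⟩⟩
  · obtain ⟨χ, hχ⟩ := apply_eq_repr_smul_of_mem_span w hS hT hh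
    obtain ⟨a, rfl⟩ := Submodule.mem_span_singleton.1 hu
    simp [hχ, smul_smul, mul_comm]
  · refine mem_span_of_joint_eigen w hS hT hd ?_ ?_
    · rw [hu S (Submodule.subset_span (by simp))]; simp [hS]
    · rw [hu T (Submodule.subset_span (by simp))]; simp [hT]

theorem iSup_eigenspace_of_diag (w : Module.Basis ι ℂ V) {h : Module.End ℂ V} {χ : ι → ℂ}
    (hχ : ∀ q, h (w q) = χ q • w q) : ⨆ t : ℂ, Module.End.eigenspace h t = ⊤ := by
  rw [eq_top_iff, ← w.span_eq, Submodule.span_le]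
  rintro _ ⟨q, rfl⟩
  exact Submodule.mem_iSup_of_mem (χ q) (Module.End.mem_eigenspace_iff.2 (hχ q))

theorem isDiagonalPlane_span (w : Module.Basis ι ℂ V) {S T : Module.End ℂ V} {α β : ι → ℂ}
    (hS : ∀ q, S (w q) = α q • w q) (hT : ∀ q, T (w q) = β q • w q)
    (hli : LinearIndependent ℂ ![S, T]) : IsDiagonalPlane (Submodule.span ℂ {S, T}) where
  finrank_eq := by
    have := finrank_span_eq_card hli
    rwa [Matrix.range_cons, Matrix.range_cons, Matrix.range_empty, Set.union_empty,
      Set.singleton_union, Fintype.card_fin] at this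
  diagonalizable h hh := by
    obtain ⟨χ, hχ⟩ := apply_eq_repr_smul_of_mem_span w hS hT hh
    exact iSup_eigenspace_of_diag w hχ
  commute h hh h' hh' := by
    obtain ⟨χ, hχ⟩ := apply_eq_repr_smul_of_mem_span w hS hT hh
    obtain ⟨χ', hχ'⟩ := apply_eq_repr_smul_of_mem_span w hS hT hh'
    refine w.ext fun q => ?_
    simp [hχ, hχ', smul_smul, mul_comm]

theorem commute_of_diag (w : Module.Basis ι ℂ V) {S T : Module.End ℂ V} {α β : ι → ℂ}
    (hS : ∀ q, S (w q) = α q • w q) (hT : ∀ q, T (w q) = β q • w q) : Commute S T := by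
  refine w.ext fun q => ?_
  simp [hS, hT, smul_smul, mul_comm]

/-- A subspace invariant under two maps that are simultaneously diagonal, with distinct pairs of
eigenvalues, contains the components of its elements. -/
theorem component_mem_of_invariant [Fintype ι] (w : Module.Basis ι ℂ V) {S T : Module.End ℂ V}
    {α β : ι → ℂ} (hS : ∀ q, S (w q) = α q • w q) (hT : ∀ q, T (w q) = β q • w q)
    (hd : ∀ q q', α q = α q' → β q = β q' → q = q') {W : Submodule ℂ V}
    (hWS : ∀ u ∈ W, S u ∈ W) (hWT : ∀ u ∈ W, T u ∈ W) {u : V} (hu : u ∈ W) {q : ι}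
    (hq : w.repr u q ≠ 0) : w q ∈ W := by
  classical
  have key : ∀ s : Finset ι, q ∉ s →
      ∃ u' ∈ W, w.repr u' q ≠ 0 ∧ ∀ q' ∈ s, w.repr u' q' = 0 := by
    intro s
    induction s using Finset.induction_on with
    | empty => exact fun _ => ⟨u, hu, hq, by simp⟩
    | insert p s hp ih =>
      intro hqs
      rw [Finset.mem_insert, not_or] at hqs
      obtain ⟨u', hu', h1, h2⟩ := ih hqs.2
      -- `R - γ_p` kills the component at `p`, multiplies every other component by a scalar, and
      -- preserves the one at `q` as soon as `R` distinguishes `q` from `p`. One of `S`, `T` does.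
      have aux : ∀ (R : Module.End ℂ V) (γ : ι → ℂ), (∀ q, R (w q) = γ q • w q) →
          (∀ u ∈ W, R u ∈ W) → γ q ≠ γ p →
          ∃ u' ∈ W, w.repr u' q ≠ 0 ∧ ∀ q' ∈ insert p s, w.repr u' q' = 0 := by
        intro R γ hR hWR hγ
        have e : ∀ z, w.repr (R u' - γ p • u') z = (γ z - γ p) * w.repr u' z := by
          intro z
          rw [map_sub, map_smul, Finsupp.sub_apply, repr_of_diag w hR, Finsupp.smul_apply,
            smul_eq_mul]
          ring
        refine ⟨R u' - γ p • u', W.sub_mem (hWR _ hu') (W.smul_mem _ hu'), ?_, ?_⟩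
        · rw [e]; exact mul_ne_zero (sub_ne_zero.2 hγ) h1
        · intro q' hq'
          rw [e]
          rcases Finset.mem_insert.1 hq' with rfl | h
          · simp
          · rw [h2 _ h, mul_zero]
      by_cases hα : α q = α p
      · exact aux T β hT hWT fun hβ => hqs.1 (hd _ _ hα hβ)
      · exact aux S α hS hWS hα
  obtain ⟨u', hu', h1, h2⟩ := key (Finset.univ.erase q) (by simp)
  have e : u' = w.repr u' q • w q := by
    conv_lhs => rw [← w.sum_repr u']
    rw [Finset.sum_eq_single q]
    · intro p _ hp
      rw [h2 p (by simp [hp]), zero_smul]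
    · simp
  have := W.smul_mem (w.repr u' q)⁻¹ hu'
  rw [e, smul_smul] at this
  simpa [h1] using this

end DiagonalBasis

/-! ### Bases labelled by the triangle, and diagonal forms -/

section Vec

variable {V : Type*} [AddCommGroup V] {N : ℕ}

theorem vec_nat (w : triDom N → V) {i j : ℕ} (h : i + j ≤ N) :
    vec w i j = w ⟨(i, j), mem_triDom.2 h⟩ := by
  unfold vec
  rw [dif_pos (by omega)]
  simp

theorem vec_eq_zero (w : triDom N → V) {i j : ℤ} (h : ¬ (0 ≤ i ∧ 0 ≤ j ∧ i + j ≤ N)) :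
    vec w i j = 0 := dif_neg h

variable [Module ℂ V]

theorem zeroExt_nat (f : ℕ → ℕ → ℂ) {i j : ℕ} (h : i + j ≤ N) :
    zeroExt N f i j = f i j := by
  unfold zeroExt
  rw [if_pos (by omega)]
  simp

theorem zeroExt_eq_zero (f : ℕ → ℕ → ℂ) {i j : ℤ} (h : ¬ (0 ≤ i ∧ 0 ≤ j ∧ i + j ≤ N)) :
    zeroExt N f i j = 0 := if_neg h

theorem zeroExt_swap (f : ℕ → ℕ → ℂ) (i j : ℤ) :
    zeroExt N (fun k l => f l k) i j = zeroExt N f j i := by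
  unfold zeroExt
  exact if_congr (by constructor <;> intro h <;> omega) rfl rfl

theorem exists_nat_of_dom {i j : ℤ} (h : 0 ≤ i ∧ 0 ≤ j ∧ i + j ≤ (N : ℤ)) :
    ∃ k l : ℕ, i = k ∧ j = l ∧ k + l ≤ N :=
  ⟨i.toNat, j.toNat, by omega, by omega, by omega⟩

theorem exists_end (w : Module.Basis (triDom N) ℂ V) (f : ℕ → ℕ → V) :
    ∃ X : Module.End ℂ V, ∀ x y : ℕ, x + y ≤ N → X (vec w x y) = f x y := by
  refine ⟨w.constr ℂ fun q => f q.1.1 q.1.2, fun x y h => ?_⟩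
  rw [vec_nat _ h, Module.Basis.constr_basis]

/-- A spanning family with as many members as the dimension is a basis, so only the invertibility
direction "old vectors from new ones" has to be supplied. -/
theorem exists_basis (w : Module.Basis (triDom N) ℂ V) (f : ℕ → ℕ → V)
    (hf : ∀ x y : ℕ, x + y ≤ N →
      vec w x y ∈ Submodule.span ℂ (Set.range fun q : triDom N => f q.1.1 q.1.2)) :
    ∃ w' : Module.Basis (triDom N) ℂ V, ∀ x y : ℕ, x + y ≤ N → vec w' x y = f x y := by
  have hspan : ⊤ ≤ Submodule.span ℂ (Set.range fun q : triDom N => f q.1.1 q.1.2) := by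
    rw [← w.span_eq, Submodule.span_le]
    rintro _ ⟨q, rfl⟩
    have hq := mem_triDom.1 q.2
    have := hf _ _ hq
    rwa [vec_nat _ hq] at this
  have hcard : Fintype.card (triDom N) = Module.finrank ℂ V :=
    (Module.finrank_eq_card_basis w).symm
  refine ⟨basisOfTopLeSpanOfCardEqFinrank _ hspan hcard, fun x y h => ?_⟩
  rw [vec_nat _ h, coe_basisOfTopLeSpanOfCardEqFinrank]

/-- The diagonal bilinear form with prescribed values on a basis. -/
theorem exists_form (w : Module.Basis (triDom N) ℂ V) (F : ℕ → ℕ → ℂ) :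
    ∃ B : LinearMap.BilinForm ℂ V, ∀ x y x' y' : ℕ, x + y ≤ N → x' + y' ≤ N →
      B (vec w x y) (vec w x' y') = if x = x' ∧ y = y' then F x y else 0 := by
  refine ⟨Matrix.toBilin w (Matrix.diagonal fun q => F q.1.1 q.1.2),
    fun x y x' y' h h' => ?_⟩
  rw [vec_nat _ h, vec_nat _ h', ← LinearMap.BilinForm.toMatrix_apply,
    LinearMap.BilinForm.toMatrix_toBilin, Matrix.diagonal_apply]
  simp only [Subtype.mk.injEq, Prod.mk.injEq]

theorem form_nondegenerate_of_diag (w : Module.Basis (triDom N) ℂ V) {F : ℕ → ℕ → ℂ}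
    {B : LinearMap.BilinForm ℂ V} (hB : ∀ x y x' y' : ℕ, x + y ≤ N → x' + y' ≤ N →
      B (vec w x y) (vec w x' y') = if x = x' ∧ y = y' then F x y else 0)
    (hF : ∀ x y, x + y ≤ N → F x y ≠ 0) : B.Nondegenerate ∧ B.IsSymm := by
  have hB' : ∀ q q' : triDom N, B (w q) (w q') = if q = q' then F q.1.1 q.1.2 else 0 := by
    intro q q'
    have hq := mem_triDom.1 q.2
    have hq' := mem_triDom.1 q'.2
    have := hB _ _ _ _ hq hq'
    rw [vec_nat _ hq, vec_nat _ hq'] at this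
    rw [this]
    simp only [Subtype.ext_iff, Prod.ext_iff]
  have hsymm : B.IsSymm := by
    constructor
    intro u u'
    have : B = B.flip := by
      refine LinearMap.BilinForm.ext_basis w fun q q' => ?_
      rw [LinearMap.BilinForm.flip_apply, hB', hB']
      by_cases h : q = q'
      · subst h; rfl
      · rw [if_neg h, if_neg (Ne.symm h)]
    conv_lhs => rw [this]
    simp
  refine ⟨?_, hsymm⟩
  have hl : ∀ u, (∀ u', B u u' = 0) → u = 0 := by
    intro u hu
    refine w.ext_elem fun q => ?_
    have h1 := hu (w q)
    rw [← w.sum_repr u] at h1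
    simp only [map_sum, map_smul, LinearMap.sum_apply, LinearMap.smul_apply, hB', smul_eq_mul,
      mul_ite, mul_zero, Finset.sum_ite_eq', Finset.mem_univ, if_true] at h1
    have := (mul_eq_zero.1 h1).resolve_right (hF _ _ (mem_triDom.1 q.2))
    simpa using this
  refine ⟨hl, fun u hu => hl u fun u' => ?_⟩
  have := hsymm.eq u u'
  rw [← hu u', ← this]

end Vec

/-! ### Families of arrays and uniqueness of the coefficients -/

/-- Two families of arrays of complementary diameters, with the recurrences of Leonard systems,
such that `Φ_j` has the eigenvalues `t_x` and `Ψ_x` has the dual eigenvalues `θ*_j`. -/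
structure GoodFamilies (N : ℕ) (Φ Ψ : ℕ → ParamArray) : Prop where
  diamΦ : ∀ j ≤ N, (Φ j).diam = N - j
  goodΦ : ∀ j ≤ N, (Φ j).Good
  diamΨ : ∀ x ≤ N, (Ψ x).diam = N - x
  goodΨ : ∀ x ≤ N, (Ψ x).Good
  ev_eq : ∀ x j, x + j ≤ N → (Φ j).ev x = (Φ 0).ev x
  dev_eq : ∀ x j, x + j ≤ N → (Ψ x).dev j = (Ψ 0).dev j

/-- The symmetry of the whole setting: the families `Ψ*_x` and `Φ*_j` take the places of `Φ_j` and
`Ψ_x`. It transfers results on `C` to `D`. -/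
theorem GoodFamilies.swap {N : ℕ} {Φ Ψ : ℕ → ParamArray} (h : GoodFamilies N Φ Ψ) :
    GoodFamilies N (fun x => (Ψ x).star) (fun j => (Φ j).star) where
  diamΦ := h.diamΨ
  goodΦ x hx := (h.goodΨ x hx).star
  diamΨ := h.diamΦ
  goodΨ j hj := (h.goodΦ j hj).star
  ev_eq j x hx := h.dev_eq x j (by omega)
  dev_eq j x hx := h.ev_eq x j (by omega)

section Coefficients

/-- The first components of the elements of `A_2` with second component `ε'`. -/
def rootRow (ε' : ℤ) : Finset ℤ :=
  if ε' = 1 then {-1, 0} else if ε' = 0 then {-1, 0, 1} else {0, 1}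

/-- The entry `c_{j+1}`, `a_j` or `b_{j-1}`, according to `ε' = 1, 0, -1`. -/
noncomputable def ParamArray.wt (Ψ : ParamArray) (ε' : ℤ) (j : ℕ) : ℂ :=
  if ε' = 1 then Ψ.c (j + 1) else if ε' = 0 then Ψ.a j else Ψ.bPrev j

/-- One equation for each second component `ε'`, so that the three constraints can be handled by a
single argument. -/
theorem solvesC_iff {N : ℕ} {Φ Ψ : ℕ → ParamArray} {C : ℤ → ℤ → ℕ → ℕ → ℂ} :
    SolvesC N Φ Ψ C ↔ ∀ ε' ∈ ({1, 0, -1} : Finset ℤ), ∀ i j x : ℕ, i + j ≤ N → x ≤ N →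
      (Ψ x).wt ε' j * (Φ j).p x i = ∑ ε ∈ rootRow ε',
        C ε ε' i j * zeroExt N (fun k l => (Φ l).p x k) (i + ε) (j + ε') := by
  constructor
  · intro h ε' hε'
    simp only [Finset.mem_insert, Finset.mem_singleton] at hε'
    rcases hε' with rfl | rfl | rfl
    · exact h.up
    · simpa [ParamArray.wt, rootRow] using h.level
    · exact h.down
  · intro h
    exact ⟨h 1 (by simp), by simpa [ParamArray.wt, rootRow] using h 0 (by simp),
      by simpa [ParamArray.wt, rootRow, sub_eq_add_neg] using h (-1) (by simp)⟩

theorem mem_rootsA2_iff {ε ε' : ℤ} :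
    (ε, ε') ∈ rootsA2 ↔ ε' ∈ ({1, 0, -1} : Finset ℤ) ∧ ε ∈ rootRow ε' := by
  simp only [rootsA2, rootRow, Finset.mem_insert, Finset.mem_singleton, Prod.mk.injEq]
  constructor
  · rintro (⟨rfl, rfl⟩ | ⟨rfl, rfl⟩ | ⟨rfl, rfl⟩ | ⟨rfl, rfl⟩ | ⟨rfl, rfl⟩ | ⟨rfl, rfl⟩ |
      ⟨rfl, rfl⟩) <;> decide
  · rintro ⟨rfl | rfl | rfl, h⟩ <;> simp at h <;> omega

theorem mem_rootsA2_swap {ε ε' : ℤ} : (ε, ε') ∈ rootsA2 ↔ (ε', ε) ∈ rootsA2 := by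
  simp only [rootsA2, Finset.mem_insert, Finset.mem_singleton, Prod.mk.injEq]
  omega

theorem sum_rootsA2 {M : Type*} [AddCommMonoid M] (f : ℤ → ℤ → M) :
    ∑ e ∈ rootsA2, f e.1 e.2 = ∑ ε' ∈ ({1, 0, -1} : Finset ℤ), ∑ ε ∈ rootRow ε', f ε ε' := by
  have e1 : rootRow 1 = {-1, 0} := rfl
  have e2 : rootRow 0 = {-1, 0, 1} := rfl
  have e3 : rootRow (-1) = {0, 1} := rfl
  simp [rootsA2, e1, e2, e3]
  abel

theorem sum_rootsA2_swap {M : Type*} [AddCommMonoid M] (f : ℤ → ℤ → M) :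
    ∑ e ∈ rootsA2, f e.1 e.2 = ∑ e ∈ rootsA2, f e.2 e.1 := by
  refine Finset.sum_nbij' Prod.swap Prod.swap ?_ ?_ ?_ ?_ ?_
  · rintro ⟨a, b⟩ h; exact mem_rootsA2_swap.1 h
  · rintro ⟨a, b⟩ h; exact mem_rootsA2_swap.1 h
  all_goals simp

theorem CoefIndex.swap {N : ℕ} {ε ε' : ℤ} {i j : ℕ} (h : CoefIndex N ε ε' i j) :
    CoefIndex N ε' ε j i := by
  obtain ⟨h1, h2, h3, h4, h5⟩ := h
  exact ⟨mem_rootsA2_swap.1 h1, by omega, h4, h3, by omega⟩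

/-- The coefficients `C` computed from the arrays by means of the orthogonality relations. -/
noncomputable def coefC (N : ℕ) (Φ Ψ : ℕ → ParamArray) (ε ε' : ℤ) (i j : ℕ) : ℂ :=
  (∑ x ∈ Finset.range (N + 1), (Φ (j + ε').toNat).star.p (i + ε).toNat x *
    ((Ψ x).wt ε' j * (Φ j).p x i)) / (Φ (j + ε').toNat).nu

/-- The coefficients vanish for `x` beyond the diameter, so all arrays of a family can be summed
over the common range `0, …, N`. -/
theorem ParamArray.Good.sum_p_mul_le {Φ : ParamArray} (h : Φ.Good) {i j N : ℕ}
    (hi : i ≤ Φ.diam) (hj : j ≤ Φ.diam) (hN : Φ.diam ≤ N) :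
    ∑ x ∈ Finset.range (N + 1), Φ.star.p i x * Φ.p x j = if i = j then Φ.nu else 0 := by
  rw [← h.sum_p_mul' hi hj]
  refine (Finset.sum_subset (fun k => by simp only [Finset.mem_range]; omega)
    fun k _ hk => ?_).symm
  rw [p_of_lt_left (x := k) (by simp only [Finset.mem_range] at hk; omega), mul_zero]

/-- Pair the constraint with `p_{i+ε,x}(Φ*_{j+ε'})` and sum over `x`. On its right-hand side all
coefficients `p` come from the same array `Φ_{j+ε'}`, so `P* P = ν` isolates a single coefficient;
labels outside the domain contribute zero. -/
theorem SolvesC.eq_coefC {N : ℕ} {Φ Ψ : ℕ → ParamArray} {C : ℤ → ℤ → ℕ → ℕ → ℂ}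
    (hG : GoodFamilies N Φ Ψ) (h : SolvesC N Φ Ψ C) : CoefEq N C (coefC N Φ Ψ) := by
  rintro ε ε' i j ⟨hr, hij, hi, hj, hN⟩
  obtain ⟨hε', hε⟩ := mem_rootsA2_iff.1 hr
  obtain ⟨I, J, hI, hJ, hIJ⟩ := exists_nat_of_dom ⟨hi, hj, hN⟩
  have hgood := hG.goodΦ J (by omega)
  have hdiam := hG.diamΦ J (by omega)
  unfold coefC
  rw [hI, hJ, Int.toNat_natCast, Int.toNat_natCast, eq_div_iff hgood.nu_ne]
  trans ∑ x ∈ Finset.range (N + 1), (Φ J).star.p I x * ∑ ε₁ ∈ rootRow ε',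
        C ε₁ ε' i j * zeroExt N (fun k l => (Φ l).p x k) (i + ε₁) J
  · simp only [Finset.mul_sum]
    rw [Finset.sum_comm, Finset.sum_eq_single_of_mem ε hε]
    · rw [hI]
      simp only [zeroExt_nat _ hIJ]
      trans C ε ε' i j * ∑ x ∈ Finset.range (N + 1), (Φ J).star.p I x * (Φ J).p x I
      · rw [hgood.sum_p_mul_le (by omega) (by omega) (by omega), if_pos rfl]
      · rw [Finset.mul_sum]
        exact Finset.sum_congr rfl fun x _ => by ring
    · intro ε₁ _ hne
      by_cases hd : 0 ≤ (i : ℤ) + ε₁ ∧ 0 ≤ (J : ℤ) ∧ (i : ℤ) + ε₁ + J ≤ N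
      · obtain ⟨K, _, hK, hL, hKL⟩ := exists_nat_of_dom hd
        rw [Nat.cast_inj] at hL
        subst hL
        rw [hK]
        simp only [zeroExt_nat _ hKL]
        trans C ε₁ ε' i j * ∑ x ∈ Finset.range (N + 1), (Φ J).star.p I x * (Φ J).p x K
        · rw [Finset.mul_sum]
          exact Finset.sum_congr rfl fun x _ => by ring
        · rw [hgood.sum_p_mul_le (by omega) (by omega) (by omega), if_neg (by omega), mul_zero]
      · simp only [zeroExt_eq_zero _ hd, mul_zero, Finset.sum_const_zero]
  · refine Finset.sum_congr rfl fun x hx => ?_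
    rw [Finset.mem_range] at hx
    rw [solvesC_iff.1 h ε' hε' i j x hij (by omega), hJ]

theorem SolvesC.unique {N : ℕ} {Φ Ψ : ℕ → ParamArray} {C C' : ℤ → ℤ → ℕ → ℕ → ℂ}
    (hG : GoodFamilies N Φ Ψ) (h : SolvesC N Φ Ψ C) (h' : SolvesC N Φ Ψ C') : CoefEq N C' C :=
  fun ε ε' i j hi => (h'.eq_coefC hG ε ε' i j hi).trans (h.eq_coefC hG ε ε' i j hi).symm

/-- The transformation that turns the constraints on `D` into constraints of the form of those
on `C`. -/
noncomputable def dualCoef (Ψ : ℕ → ParamArray) (D : ℤ → ℤ → ℕ → ℕ → ℂ) (ε' ε : ℤ) (y x : ℕ) :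
    ℂ :=
  D ε ε' x y * ((Ψ x).nu / (Ψ (x + ε).toNat).nu)

/-- Once the ratio of the `ν` is absorbed into the coefficients and the labels are transposed, the
constraints on `D` are the constraints on `C` for the swapped families. -/
theorem solvesD_iff {N : ℕ} {Φ Ψ : ℕ → ParamArray} {D : ℤ → ℤ → ℕ → ℕ → ℂ}
    (hν : ∀ x ≤ N, (Ψ x).nu ≠ 0) :
    SolvesD N Φ Ψ D ↔
      SolvesC N (fun x => (Ψ x).star) (fun j => (Φ j).star) (dualCoef Ψ D) := by
  have hswap : ∀ (j : ℕ) (a b : ℤ), zeroExt N (fun k l => (Ψ l).star.p j k) a b =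
      zeroExt N (fun k l => (Ψ k).star.p j l) b a := fun j a b =>
    zeroExt_swap (fun k l => (Ψ k).star.p j l) a b
  have h1 : ∀ x : ℕ, ((x : ℤ) + 1).toNat = x + 1 := fun x => by omega
  -- At `x = 0` both sides are the truncated value `0`, so `dualCoef` uses the same array as
  -- `SolvesD.down` there too.
  have h2 : ∀ x : ℕ, ((x : ℤ) + -1).toNat = x - 1 := fun x => by omega
  constructor
  · intro h
    refine ⟨fun y x j hyx hj => ?_, fun y x j hyx hj => ?_, fun y x j hyx hj => ?_⟩
    · simp only [hswap, dualCoef, h1]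
      rw [h.up x y j (by omega) hj, Finset.mul_sum]
      exact Finset.sum_congr rfl fun ε _ => by ring
    · simp only [hswap, dualCoef, add_zero, Int.toNat_natCast]
      rw [h.level x y j (by omega) hj, div_self (hν x (by omega))]
      simp only [mul_one]
    · simp only [hswap, dualCoef, h2]
      rw [h.down x y j (by omega) hj, Finset.mul_sum]
      exact Finset.sum_congr rfl fun ε _ => by ring
  · intro h
    refine ⟨fun x y j hyx hj => ?_, fun x y j hyx hj => ?_, fun x y j hyx hj => ?_⟩
    · rw [h.up y x j (by omega) hj, Finset.mul_sum]
      simp only [hswap, dualCoef, h1]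
      exact Finset.sum_congr rfl fun ε _ => by ring
    · rw [h.level y x j (by omega) hj]
      simp only [hswap, dualCoef, add_zero, Int.toNat_natCast, div_self (hν x (by omega)),
        mul_one]
    · rw [h.down y x j (by omega) hj, Finset.mul_sum]
      simp only [hswap, dualCoef, h2]
      exact Finset.sum_congr rfl fun ε _ => by ring

theorem GoodFamilies.nuΨ_ne {N : ℕ} {Φ Ψ : ℕ → ParamArray} (hG : GoodFamilies N Φ Ψ) :
    ∀ x ≤ N, (Ψ x).nu ≠ 0 := fun x hx => (hG.goodΨ x hx).nu_ne

theorem SolvesD.unique {N : ℕ} {Φ Ψ : ℕ → ParamArray} {D D' : ℤ → ℤ → ℕ → ℕ → ℂ}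
    (hG : GoodFamilies N Φ Ψ) (h : SolvesD N Φ Ψ D) (h' : SolvesD N Φ Ψ D') : CoefEq N D' D := by
  intro ε ε' x y hi
  have := SolvesC.unique hG.swap ((solvesD_iff hG.nuΨ_ne).1 h) ((solvesD_iff hG.nuΨ_ne).1 h')
    ε' ε y x hi.swap
  obtain ⟨_, h2, h3, h4, h5⟩ := hi
  exact mul_right_cancel₀ (div_ne_zero (hG.nuΨ_ne x (by omega)) (hG.nuΨ_ne _ (by omega))) this

end Coefficients

/-! ### Transport of actions through a change of basis -/

section Sums

variable {V : Type*} [AddCommGroup V] [Module ℂ V]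

namespace ParamArray

/-- The relation `P P* = ν`, applied to vectors instead of scalars. -/
theorem Good.inversion {Φ : ParamArray} (h : Φ.Good) {F g : ℕ → V}
    (hF : ∀ i ≤ Φ.diam, F i = ∑ x ∈ Finset.range (Φ.diam + 1), Φ.p x i • g x) {x : ℕ}
    (hx : x ≤ Φ.diam) :
    Φ.nu • g x = ∑ i ∈ Finset.range (Φ.diam + 1), Φ.star.p i x • F i := by
  trans ∑ i ∈ Finset.range (Φ.diam + 1), ∑ z ∈ Finset.range (Φ.diam + 1),
    (Φ.p z i * Φ.star.p i x) • g z
  · rw [Finset.sum_comm, Finset.sum_eq_single x]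
    · rw [← Finset.sum_smul, h.sum_p_mul hx hx, if_pos rfl]
    · intro z hz hne
      rw [Finset.mem_range] at hz
      rw [← Finset.sum_smul, h.sum_p_mul (by omega) hx, if_neg hne, zero_smul]
    · intro hn
      simp only [Finset.mem_range] at hn
      omega
  · refine Finset.sum_congr rfl fun i hi => ?_
    rw [Finset.mem_range] at hi
    rw [hF i (by omega), Finset.smul_sum]
    exact Finset.sum_congr rfl fun z _ => by rw [smul_smul, mul_comm]

/-- An action that is diagonal on the `g x` with eigenvalues `θ_x` becomes tridiagonal on the `F i`.
This produces the action of `Y` on `V~` and of `X` on `V*`. -/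
theorem Good.sum_p_rec {Φ : ParamArray} (h : Φ.Good) {F : ℤ → V} {g : ℕ → V}
    (hF : ∀ i ≤ Φ.diam, F i = ∑ x ∈ Finset.range (Φ.diam + 1), Φ.p x i • g x) {i : ℕ}
    (hi : i ≤ Φ.diam) :
    ∑ x ∈ Finset.range (Φ.diam + 1), Φ.p x i • (Φ.ev x • g x) =
      Φ.bPrev i • F (i - 1) + Φ.a i • F i + Φ.c (i + 1) • F (i + 1) := by
  have h1 : Φ.bPrev i • F (i - 1) =
      ∑ x ∈ Finset.range (Φ.diam + 1), (Φ.bPrev i * Φ.p x (i - 1)) • g x := by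
    cases i with
    | zero => simp [bPrev]
    | succ i =>
      rw [show ((i + 1 : ℕ) : ℤ) - 1 = i by push_cast; ring, hF i (by omega), Finset.smul_sum]
      exact Finset.sum_congr rfl fun x _ => by rw [smul_smul, Nat.add_sub_cancel]
  have h2 : Φ.c (i + 1) • F (i + 1) =
      ∑ x ∈ Finset.range (Φ.diam + 1), (Φ.c (i + 1) * Φ.p x (i + 1)) • g x := by
    rcases hi.lt_or_eq with hlt | heq
    · rw [← Nat.cast_succ, hF _ hlt, Finset.smul_sum]
      exact Finset.sum_congr rfl fun x _ => by rw [smul_smul]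
    · rw [c_eq_zero (by omega)]
      simp
  rw [h1, h2, hF i hi, Finset.smul_sum, ← Finset.sum_add_distrib, ← Finset.sum_add_distrib]
  refine Finset.sum_congr rfl fun x hx => ?_
  rw [Finset.mem_range] at hx
  rw [smul_smul, smul_smul, ← add_smul, ← add_smul, ← h.p_rec (by omega) hi, mul_comm]

/-- The converse transport: a tridiagonal action with the dual coefficients becomes diagonal with
eigenvalues `θ*_i`. The boundary terms drop out because `b*_d = 0` and `c*_{d+1} = 0`. -/
theorem Good.sum_p_rec_dual {Φ : ParamArray} (h : Φ.Good) (G : ℤ → V) {i : ℕ}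
    (hi : i ≤ Φ.diam) :
    ∑ x ∈ Finset.range (Φ.diam + 1), Φ.p x i • (Φ.star.bPrev x • G (x - 1) + Φ.star.a x • G x
        + Φ.star.c (x + 1) • G (x + 1)) =
      Φ.dev i • ∑ x ∈ Finset.range (Φ.diam + 1), Φ.p x i • G x := by
  have h1 : ∑ x ∈ Finset.range (Φ.diam + 1), Φ.p x i • (Φ.star.bPrev x • G (x - 1)) =
      ∑ x ∈ Finset.range (Φ.diam + 1), (Φ.star.b x * Φ.p (x + 1) i) • G x := by
    rw [Finset.sum_range_succ', Finset.sum_range_succ,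
      b_eq_zero (show Φ.star.diam ≤ Φ.diam from le_rfl)]
    simp only [bPrev, zero_smul, smul_zero, zero_mul, add_zero]
    refine Finset.sum_congr rfl fun x _ => ?_
    rw [smul_smul, mul_comm, show ((x + 1 : ℕ) : ℤ) - 1 = x by push_cast; ring]
  have h2 : ∑ x ∈ Finset.range (Φ.diam + 1), Φ.p x i • (Φ.star.c (x + 1) • G (x + 1)) =
      ∑ x ∈ Finset.range (Φ.diam + 1), (Φ.star.c x * Φ.p (x - 1) i) • G x := by
    rw [Finset.sum_range_succ, Finset.sum_range_succ',
      c_eq_zero (show Φ.star.diam < Φ.diam + 1 from Nat.lt_succ_self _), c_zero]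
    simp only [zero_smul, smul_zero, zero_mul, add_zero]
    refine Finset.sum_congr rfl fun x _ => ?_
    rw [smul_smul, mul_comm, Nat.add_sub_cancel, Nat.cast_succ]
  simp only [smul_add, Finset.sum_add_distrib]
  rw [h1, h2, Finset.smul_sum, ← Finset.sum_add_distrib, ← Finset.sum_add_distrib]
  refine Finset.sum_congr rfl fun x hx => ?_
  rw [Finset.mem_range] at hx
  rw [smul_smul, smul_smul, ← add_smul, ← add_smul, h.p_rec_dual (by omega) hi]
  congr 1
  ring

end ParamArray

/-- Compatibility in vector form: summing a tridiagonal action on the middle basis against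
`p_{xi}(Φ_j)` gives an `A_2`-action on the transformed vectors. It is stated for arbitrary `w` and
`S`, since it is applied to `Y` and, with the swapped families, to `X*`. -/
theorem SolvesC.sum_smul {N : ℕ} {Φ Ψ : ℕ → ParamArray} {C : ℤ → ℤ → ℕ → ℕ → ℂ}
    (h : SolvesC N Φ Ψ C) {w S : ℤ → ℤ → V}
    (hS : ∀ i j : ℤ, S i j =
      ∑ x ∈ Finset.range (N + 1), zeroExt N (fun k l => (Φ l).p x k) i j • w x j) {i j : ℕ}
    (hij : i + j ≤ N) :
    ∑ x ∈ Finset.range (N + 1), (Φ j).p x i •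
      ((Ψ x).bPrev j • w x (j - 1) + (Ψ x).a j • w x j + (Ψ x).c (j + 1) • w x (j + 1)) =
    ∑ e ∈ rootsA2, C e.1 e.2 i j • S (i + e.1) (j + e.2) := by
  rw [sum_rootsA2 fun ε ε' => C ε ε' i j • S (i + ε) (j + ε')]
  have key : ∀ ε' ∈ ({1, 0, -1} : Finset ℤ), ∑ ε ∈ rootRow ε', C ε ε' i j • S (i + ε) (j + ε') =
      ∑ x ∈ Finset.range (N + 1), (Φ j).p x i • ((Ψ x).wt ε' j • w x (j + ε')) := by
    intro ε' hε'
    simp only [hS, Finset.smul_sum]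
    rw [Finset.sum_comm]
    refine Finset.sum_congr rfl fun x hx => ?_
    rw [Finset.mem_range] at hx
    rw [smul_smul, mul_comm, solvesC_iff.1 h ε' hε' i j x hij (by omega), Finset.sum_smul]
    exact Finset.sum_congr rfl fun ε _ => by rw [smul_smul]
  rw [Finset.sum_congr rfl key, ← Finset.sum_comm]
  refine Finset.sum_congr rfl fun x _ => ?_
  rw [← Finset.smul_sum]
  congr 1
  rw [Finset.sum_insert (by decide), Finset.sum_insert (by decide), Finset.sum_singleton]
  simp only [ParamArray.wt, add_zero, ← sub_eq_add_neg]
  norm_num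
  abel

end Sums

/-! ### Construction of the maps, the bases and the form -/

/-- The identities of `Realizes`, without the properties of a factorized `A_2`-Leonard pair. -/
structure RealizesActions (N : ℕ) (Φ Ψ : ℕ → ParamArray) (C D : ℤ → ℤ → ℕ → ℕ → ℂ)
    (F G : ℕ → ℕ → ℂ) {V : Type*} [AddCommGroup V] [Module ℂ V] (X Y Xs Ys : Module.End ℂ V)
    (v vt vs : Module.Basis (triDom N) ℂ V) (B : LinearMap.BilinForm ℂ V) : Prop where
  form : ∀ x y x' y' : ℕ, x + y ≤ N → x' + y' ≤ N →
    B (vec v x y) (vec v x' y') = if x = x' ∧ y = y' then F x y else 0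
  form_star : ∀ i j i' j' : ℕ, i + j ≤ N → i' + j' ≤ N →
    B (vec vs i j) (vec vs i' j') = if i = i' ∧ j = j' then G i j else 0
  X_v : ∀ x y : ℕ, x + y ≤ N → ∀ j, x + j ≤ N → X (vec v x y) = (Φ j).ev x • vec v x y
  Y_v : ∀ x y : ℕ, x + y ≤ N → Y (vec v x y) = (Ψ x).ev y • vec v x y
  Xs_v : ∀ x y : ℕ, x + y ≤ N →
    Xs (vec v x y) = ∑ e ∈ rootsA2, D e.1 e.2 x y • vec v (x + e.1) (y + e.2)
  Ys_v : ∀ x y : ℕ, x + y ≤ N →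
    Ys (vec v x y) = (Ψ x).star.bPrev y • vec v x (y - 1) + (Ψ x).star.a y • vec v x y
      + (Ψ x).star.c (y + 1) • vec v x (y + 1)
  X_vt : ∀ x j : ℕ, x + j ≤ N → X (vec vt x j) = (Φ j).ev x • vec vt x j
  Ys_vt : ∀ x j : ℕ, x + j ≤ N → Ys (vec vt x j) = (Ψ x).dev j • vec vt x j
  Xs_vt : ∀ x j : ℕ, x + j ≤ N →
    Xs (vec vt x j) = (Φ j).star.bPrev x • vec vt (x - 1) j + (Φ j).star.a x • vec vt x j
      + (Φ j).star.c (x + 1) • vec vt (x + 1) j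
  Y_vt : ∀ x j : ℕ, x + j ≤ N →
    Y (vec vt x j) = (Ψ x).bPrev j • vec vt x (j - 1) + (Ψ x).a j • vec vt x j
      + (Ψ x).c (j + 1) • vec vt x (j + 1)
  X_vs : ∀ i j : ℕ, i + j ≤ N →
    X (vec vs i j) = (Φ j).bPrev i • vec vs (i - 1) j + (Φ j).a i • vec vs i j
      + (Φ j).c (i + 1) • vec vs (i + 1) j
  Y_vs : ∀ i j : ℕ, i + j ≤ N →
    Y (vec vs i j) = ∑ e ∈ rootsA2, C e.1 e.2 i j • vec vs (i + e.1) (j + e.2)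
  Xs_vs : ∀ i j : ℕ, i + j ≤ N → Xs (vec vs i j) = (Φ j).dev i • vec vs i j
  Ys_vs : ∀ i j : ℕ, i + j ≤ N → ∀ x, x + j ≤ N → Ys (vec vs i j) = (Ψ x).dev j • vec vs i j
  vt_eq : ∀ x j : ℕ, x + j ≤ N →
    vec vt x j = ∑ y ∈ Finset.range (N - x + 1), (Ψ x).p y j • vec v x y
  vs_eq : ∀ i j : ℕ, i + j ≤ N →
    vec vs i j = ∑ x ∈ Finset.range (N - j + 1), (Φ j).p x i • vec vt x j
  vs_eq_v : ∀ i j : ℕ, i + j ≤ N →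
    vec vs i j = ∑ x ∈ Finset.range (N - j + 1), ∑ y ∈ Finset.range (N - x + 1),
      tratnik Φ Ψ i j x y • vec v x y

section Construction

variable {V : Type*} [AddCommGroup V] [Module ℂ V] {N : ℕ} {Φ Ψ : ℕ → ParamArray}

/-- Each row `x` is transformed by its own matrix `P(Ψ_x)`; the inversion formula returns the old
vectors, `ν(Ψ_x)` being nonzero. -/
theorem GoodFamilies.exists_vt (hG : GoodFamilies N Φ Ψ) (v : Module.Basis (triDom N) ℂ V) :
    ∃ vt : Module.Basis (triDom N) ℂ V, ∀ x j : ℕ, x + j ≤ N →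
      vec vt x j = ∑ y ∈ Finset.range (N - x + 1), (Ψ x).p y j • vec v x y := by
  refine exists_basis v (fun x j => ∑ y ∈ Finset.range (N - x + 1), (Ψ x).p y j • vec v x y)
    fun x y hxy => ?_
  have hd := hG.diamΨ x (by omega)
  have h1 := (hG.goodΨ x (by omega)).inversion (g := fun y => vec v x y) (fun i _ => rfl)
    (x := y) (by omega)
  rw [← inv_smul_smul₀ (hG.nuΨ_ne x (by omega)) (vec v x y), h1, hd]
  refine Submodule.smul_mem _ _ (Submodule.sum_mem _ fun i hi => Submodule.smul_mem _ _ ?_)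
  rw [Finset.mem_range] at hi
  exact Submodule.subset_span ⟨⟨(x, i), mem_triDom.2 (by simp only; omega)⟩, rfl⟩

theorem GoodFamilies.exists_vs (hG : GoodFamilies N Φ Ψ) (vt : Module.Basis (triDom N) ℂ V) :
    ∃ vs : Module.Basis (triDom N) ℂ V, ∀ i j : ℕ, i + j ≤ N →
      vec vs i j = ∑ x ∈ Finset.range (N - j + 1), (Φ j).p x i • vec vt x j := by
  refine exists_basis vt (fun i j => ∑ x ∈ Finset.range (N - j + 1), (Φ j).p x i • vec vt x j)
    fun x j hxj => ?_
  have hd := hG.diamΦ j (by omega)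
  have h1 := (hG.goodΦ j (by omega)).inversion (g := fun x => vec vt x j) (fun i _ => rfl)
    (x := x) (by omega)
  rw [← inv_smul_smul₀ (hG.goodΦ j (by omega)).nu_ne (vec vt x j), h1, hd]
  refine Submodule.smul_mem _ _ (Submodule.sum_mem _ fun i hi => Submodule.smul_mem _ _ ?_)
  rw [Finset.mem_range] at hi
  exact Submodule.subset_span ⟨⟨(i, j), mem_triDom.2 (by simp only; omega)⟩, rfl⟩

/-- The Gram matrix of the vectors `V~_{x,j}`. -/
theorem SolvesFG.form_vt {F G : ℕ → ℕ → ℂ} (hG : GoodFamilies N Φ Ψ) (hFG : SolvesFG N Φ Ψ F G)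
    {v vt : Module.Basis (triDom N) ℂ V} {B : LinearMap.BilinForm ℂ V}
    (hB : ∀ x y x' y' : ℕ, x + y ≤ N → x' + y' ≤ N →
      B (vec v x y) (vec v x' y') = if x = x' ∧ y = y' then F x y else 0)
    (hvt : ∀ x j : ℕ, x + j ≤ N →
      vec vt x j = ∑ y ∈ Finset.range (N - x + 1), (Ψ x).p y j • vec v x y)
    {x j x' j' i : ℕ} (h : x + j ≤ N) (h' : x' + j' ≤ N) (hi : i + j ≤ N) :
    B (vec vt x j) (vec vt x' j') =
      if x = x' ∧ j = j' then G i j / (Φ j).nu * ((Φ j).star.k x / (Φ j).k i) else 0 := by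
  have hΨ := hG.goodΨ x (by omega)
  have hΦ := hG.goodΦ j (by omega)
  have hdΨ := hG.diamΨ x (by omega)
  have hdΦ := hG.diamΦ j (by omega)
  rw [hvt x j h, hvt x' j' h']
  simp only [map_sum, map_smul, LinearMap.sum_apply, LinearMap.smul_apply, smul_eq_mul]
  by_cases hx : x = x'
  · subst hx
    simp only [true_and]
    -- The weight relation rewrites `F(x,y)` so that `p_{yj}(Ψ_x) F(x,y)` becomes a multiple,
    -- independent of `y`, of `p_{jy}(Ψ*_x)`. The sum over `y` is then an entry of `P* P`. The index
    -- `i` is auxiliary.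
    trans ∑ y ∈ Finset.range ((Ψ x).diam + 1), G i j / ((Ψ x).nu * (Φ j).nu) *
      ((Φ j).star.k x / (Φ j).k i) * ((Ψ x).star.p j y * (Ψ x).p y j')
    · rw [hdΨ]
      refine Finset.sum_congr rfl fun y hy => ?_
      rw [Finset.mem_range] at hy
      rw [Finset.sum_eq_single_of_mem y (by rw [Finset.mem_range]; omega), hB _ _ _ _ (by omega)
        (by omega), if_pos ⟨rfl, rfl⟩, ← hFG.eq i j x y hi (by omega) (by omega)]
      · have e1 := hΦ.k_ne (i := i) (by omega)
        have e2 := hΦ.star.k_ne (i := x) (by rw [ParamArray.star_diam]; omega)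
        have e3 := hΨ.k_ne (i := j) (by omega)
        have e4 := hΨ.star.k_ne (i := y) (by rw [ParamArray.star_diam]; omega)
        have e5 := (Ψ x).star_p j y
        field_simp
        linear_combination -(F x y * (Ψ x).p y j') * e5
      · intro z hz hne
        rw [Finset.mem_range] at hz
        rw [hB _ _ _ _ (by omega) (by omega), if_neg (by omega)]
        ring
    · rw [← Finset.mul_sum, hΨ.sum_p_mul' (by omega) (by omega)]
      split_ifs
      · have e1 := hΨ.nu_ne
        have e2 := hΦ.nu_ne
        have e3 := hΦ.k_ne (i := i) (by omega)
        field_simp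
      · rw [mul_zero]
  · rw [if_neg (by omega)]
    refine Finset.sum_eq_zero fun y hy =>
      mul_eq_zero_of_right _ (Finset.sum_eq_zero fun z hz => ?_)
    rw [Finset.mem_range] at hy hz
    rw [hB _ _ _ _ (by omega) (by omega), if_neg (by omega)]
    ring

/-- The same mechanism one level up: the norm of `V~_{x,j}` turns `p_{xi}(Φ_j)` into `p_{ix}(Φ*_j)`,
and `P* P = ν` leaves exactly `G`. -/
theorem SolvesFG.form_vs {F G : ℕ → ℕ → ℂ} (hG : GoodFamilies N Φ Ψ) (hFG : SolvesFG N Φ Ψ F G)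
    {v vt vs : Module.Basis (triDom N) ℂ V} {B : LinearMap.BilinForm ℂ V}
    (hB : ∀ x y x' y' : ℕ, x + y ≤ N → x' + y' ≤ N →
      B (vec v x y) (vec v x' y') = if x = x' ∧ y = y' then F x y else 0)
    (hvt : ∀ x j : ℕ, x + j ≤ N →
      vec vt x j = ∑ y ∈ Finset.range (N - x + 1), (Ψ x).p y j • vec v x y)
    (hvs : ∀ i j : ℕ, i + j ≤ N →
      vec vs i j = ∑ x ∈ Finset.range (N - j + 1), (Φ j).p x i • vec vt x j)
    {i j i' j' : ℕ} (h : i + j ≤ N) (h' : i' + j' ≤ N) :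
    B (vec vs i j) (vec vs i' j') = if i = i' ∧ j = j' then G i j else 0 := by
  have hΦ := hG.goodΦ j (by omega)
  have hdΦ := hG.diamΦ j (by omega)
  rw [hvs i j h, hvs i' j' h']
  simp only [map_sum, map_smul, LinearMap.sum_apply, LinearMap.smul_apply, smul_eq_mul]
  by_cases hj : j = j'
  · subst hj
    simp only [and_true]
    trans ∑ x ∈ Finset.range ((Φ j).diam + 1),
      G i j / (Φ j).nu * ((Φ j).star.p i x * (Φ j).p x i')
    · rw [hdΦ]
      refine Finset.sum_congr rfl fun x hx => ?_
      rw [Finset.mem_range] at hx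
      rw [Finset.sum_eq_single_of_mem x (by rw [Finset.mem_range]; omega),
        hFG.form_vt hG hB hvt (by omega) (by omega) h, if_pos ⟨rfl, rfl⟩]
      · have e1 := hΦ.k_ne (i := i) (by omega)
        have e2 := hΦ.nu_ne
        have e5 := (Φ j).star_p i x
        field_simp
        linear_combination -(G i j * (Φ j).p x i') * e5
      · intro z hz hne
        rw [Finset.mem_range] at hz
        rw [hFG.form_vt hG hB hvt (by omega) (by omega) (by omega : 0 + j ≤ N),
          if_neg (by omega)]
        ring
    · rw [← Finset.mul_sum, hΦ.sum_p_mul' (by omega) (by omega)]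
      split_ifs
      · have e2 := hΦ.nu_ne
        field_simp
      · rw [mul_zero]
  · rw [if_neg (by omega)]
    refine Finset.sum_eq_zero fun y hy =>
      mul_eq_zero_of_right _ (Finset.sum_eq_zero fun z hz => ?_)
    rw [Finset.mem_range] at hy hz
    rw [hFG.form_vt hG hB hvt (by omega) (by omega) (by omega : 0 + j ≤ N), if_neg (by omega)]
    ring

/-- `X`, `Y`, `Y*` are prescribed on the first basis and `X*` on the middle one. The remaining
actions are consequences: those inside one row or column follow from the recurrences, the two
`A_2`-actions from the constraints on `C` and `D`. -/
theorem exists_realizesActions (hG : GoodFamilies N Φ Ψ) {C D : ℤ → ℤ → ℕ → ℕ → ℂ}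
    {F G : ℕ → ℕ → ℂ} (hC : CompatibleWith N Φ Ψ C D F G) (v : Module.Basis (triDom N) ℂ V) :
    ∃ (X Y Xs Ys : Module.End ℂ V) (vt vs : Module.Basis (triDom N) ℂ V)
      (B : LinearMap.BilinForm ℂ V), RealizesActions N Φ Ψ C D F G X Y Xs Ys v vt vs B := by
  obtain ⟨vt, hvt⟩ := hG.exists_vt v
  obtain ⟨vs, hvs⟩ := hG.exists_vs vt
  obtain ⟨X, hX⟩ := exists_end v fun x y => (Φ 0).ev x • vec v x y
  obtain ⟨Y, hY⟩ := exists_end v fun x y => (Ψ x).ev y • vec v x y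
  obtain ⟨Ys, hYs⟩ := exists_end v fun x y =>
    (Ψ x).star.bPrev y • vec v x (y - 1) + (Ψ x).star.a y • vec v x y
      + (Ψ x).star.c (y + 1) • vec v x (y + 1)
  obtain ⟨Xs, hXs⟩ := exists_end vt fun x j =>
    (Φ j).star.bPrev x • vec vt (x - 1) j + (Φ j).star.a x • vec vt x j
      + (Φ j).star.c (x + 1) • vec vt (x + 1) j
  obtain ⟨B, hB⟩ := exists_form v F
  have hvt' : ∀ x ≤ N, ∀ j ≤ (Ψ x).diam,
      vec vt x j = ∑ y ∈ Finset.range ((Ψ x).diam + 1), (Ψ x).p y j • vec v x y := by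
    intro x hx j hj
    rw [hG.diamΨ x hx] at hj ⊢
    exact hvt x j (by omega)
  have hvs' : ∀ j ≤ N, ∀ i ≤ (Φ j).diam,
      vec vs i j = ∑ x ∈ Finset.range ((Φ j).diam + 1), (Φ j).p x i • vec vt x j := by
    intro j hj i hi
    rw [hG.diamΦ j hj] at hi ⊢
    exact hvs i j (by omega)
  have X_vt : ∀ x j : ℕ, x + j ≤ N → X (vec vt x j) = (Φ j).ev x • vec vt x j := by
    intro x j h
    rw [hvt x j h, map_sum, Finset.smul_sum]
    refine Finset.sum_congr rfl fun y hy => ?_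
    rw [Finset.mem_range] at hy
    rw [map_smul, hX x y (by omega), hG.ev_eq x j h, smul_comm]
  have Ys_vt : ∀ x j : ℕ, x + j ≤ N → Ys (vec vt x j) = (Ψ x).dev j • vec vt x j := by
    intro x j h
    have hd := hG.diamΨ x (by omega)
    have := (hG.goodΨ x (by omega)).sum_p_rec_dual (fun z => vec v x z) (i := j) (by omega)
    rw [hvt' x (by omega) j (by omega), ← this, map_sum]
    refine Finset.sum_congr rfl fun y hy => ?_
    rw [Finset.mem_range] at hy
    rw [map_smul, hYs x y (by omega)]
  have Y_vt : ∀ x j : ℕ, x + j ≤ N →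
      Y (vec vt x j) = (Ψ x).bPrev j • vec vt x (j - 1) + (Ψ x).a j • vec vt x j
        + (Ψ x).c (j + 1) • vec vt x (j + 1) := by
    intro x j h
    have hd := hG.diamΨ x (by omega)
    have := (hG.goodΨ x (by omega)).sum_p_rec (F := fun z => vec vt x z)
      (hvt' x (by omega)) (i := j) (by omega)
    rw [← this, hvt' x (by omega) j (by omega), map_sum]
    refine Finset.sum_congr rfl fun y hy => ?_
    rw [Finset.mem_range] at hy
    rw [map_smul, hY x y (by omega)]
  have Ys_vs : ∀ i j : ℕ, i + j ≤ N → ∀ x, x + j ≤ N →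
      Ys (vec vs i j) = (Ψ x).dev j • vec vs i j := by
    intro i j h x hx
    rw [hvs i j h, map_sum, Finset.smul_sum]
    refine Finset.sum_congr rfl fun z hz => ?_
    rw [Finset.mem_range] at hz
    rw [map_smul, Ys_vt z j (by omega), hG.dev_eq x j hx, hG.dev_eq z j (by omega), smul_comm]
  refine ⟨X, Y, Xs, Ys, vt, vs, B,
    { form := hB
      form_star := fun i j i' j' h h' => hC.solvesFG.form_vs hG hB hvt hvs h h'
      X_v := fun x y h j hj => by rw [hX x y h, hG.ev_eq x j hj]
      Y_v := hY
      Xs_v := ?_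
      Ys_v := hYs
      X_vt := X_vt
      Ys_vt := Ys_vt
      Xs_vt := hXs
      Y_vt := Y_vt
      X_vs := ?_
      Y_vs := ?_
      Xs_vs := ?_
      Ys_vs := Ys_vs
      vt_eq := hvt
      vs_eq := hvs
      vs_eq_v := ?_ }⟩
  · intro x y h
    have hd := hG.diamΨ x (by omega)
    -- By inversion, `ν(Ψ_x) V_{x,y}` is the combination of the `V~_{x,j}` with coefficients
    -- `p_{jy}(Ψ*_x)`. These rescaled vectors are what the swapped constraints act on; the factors
    -- `ν` are removed at the end through `dualCoef`.
    have hS : ∀ a b : ℤ, (fun a b : ℤ => (Ψ b.toNat).nu • vec v b a) a b =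
        ∑ j ∈ Finset.range (N + 1), zeroExt N (fun k l => (Ψ l).star.p j k) a b •
          (fun j b : ℤ => vec vt b j) j b := by
      intro a b
      by_cases hab : 0 ≤ a ∧ 0 ≤ b ∧ a + b ≤ (N : ℤ)
      · obtain ⟨z, x, rfl, rfl, hzx⟩ := exists_nat_of_dom hab
        have hd := hG.diamΨ x (by omega)
        simp only [zeroExt_nat _ hzx, Int.toNat_natCast]
        rw [(hG.goodΨ x (by omega)).inversion (F := fun j => vec vt x j) (g := fun y => vec v x y)
          (hvt' x (by omega)) (x := z) (by omega)]
        refine Finset.sum_subset (fun k => by simp only [Finset.mem_range]; omega)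
          fun k _ hk => ?_
        rw [ParamArray.p_of_lt_left (by
          simp only [Finset.mem_range, ParamArray.star_diam] at hk ⊢; omega), zero_smul]
      · simp only [zeroExt_eq_zero _ hab, zero_smul, Finset.sum_const_zero]
        rw [vec_eq_zero _ (by omega), smul_zero]
    have key := ((solvesD_iff hG.nuΨ_ne).1 hC.solvesD).sum_smul
      (w := fun j b : ℤ => vec vt b j) (S := fun a b : ℤ => (Ψ b.toNat).nu • vec v b a) hS (i := y) (j := x) (by omega)
    have e1 : ∑ j ∈ Finset.range (N + 1), (Ψ x).star.p j y •
        ((Φ j).star.bPrev x • vec vt (x - 1) j + (Φ j).star.a x • vec vt x j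
          + (Φ j).star.c (x + 1) • vec vt (x + 1) j) = (Ψ x).nu • Xs (vec v x y) := by
      rw [← map_smul, (hG.goodΨ x (by omega)).inversion (F := fun j => vec vt x j)
        (g := fun y => vec v x y) (hvt' x (by omega)) (x := y) (by omega), map_sum]
      symm
      refine Finset.sum_subset_zero_on_sdiff
        (fun k => by simp only [Finset.mem_range]; omega) (fun k hk => ?_) fun j hj => ?_
      · rw [ParamArray.p_of_lt_left (by
          simp only [Finset.mem_sdiff, Finset.mem_range, ParamArray.star_diam] at hk ⊢; omega),
          zero_smul]
      · rw [Finset.mem_range] at hj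
        rw [map_smul, hXs x j (by omega)]
    rw [e1] at key
    apply smul_right_injective V (hG.nuΨ_ne x (by omega))
    simp only
    rw [key, sum_rootsA2_swap fun a b => dualCoef Ψ D a b y x •
      ((Ψ ((x : ℤ) + b).toNat).nu • vec v (x + b) (y + a)), Finset.smul_sum]
    refine Finset.sum_congr rfl fun e _ => ?_
    by_cases hab : 0 ≤ (x : ℤ) + e.1 ∧ 0 ≤ (y : ℤ) + e.2 ∧ (x : ℤ) + e.1 + (y + e.2) ≤ (N : ℤ)
    · rw [smul_smul, smul_smul, dualCoef]
      have := hG.nuΨ_ne ((x : ℤ) + e.1).toNat (by omega)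
      congr 1
      field_simp
    · rw [vec_eq_zero _ hab]
      simp only [smul_zero]
  · intro i j h
    have hd := hG.diamΦ j (by omega)
    have := (hG.goodΦ j (by omega)).sum_p_rec (F := fun z => vec vs z j)
      (g := fun x => vec vt x j) (hvs' j (by omega)) (i := i) (by omega)
    rw [← this, hvs' j (by omega) i (by omega), map_sum]
    refine Finset.sum_congr rfl fun x hx => ?_
    rw [Finset.mem_range] at hx
    rw [map_smul, X_vt x j (by omega)]
  · intro i j h
    have hd := hG.diamΦ j (by omega)
    have hS : ∀ a b : ℤ, (fun a b : ℤ => vec vs a b) a b =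
        ∑ x ∈ Finset.range (N + 1), zeroExt N (fun k l => (Φ l).p x k) a b •
          (fun x b : ℤ => vec vt x b) x b := by
      intro a b
      by_cases hab : 0 ≤ a ∧ 0 ≤ b ∧ a + b ≤ (N : ℤ)
      · obtain ⟨i, j, rfl, rfl, hij⟩ := exists_nat_of_dom hab
        have hd := hG.diamΦ j (by omega)
        simp only [zeroExt_nat _ hij]
        rw [hvs' j (by omega) i (by omega)]
        refine Finset.sum_subset (fun k => by simp only [Finset.mem_range]; omega)
          fun k _ hk => ?_
        rw [ParamArray.p_of_lt_left (by simp only [Finset.mem_range] at hk; omega), zero_smul]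
      · simp only [zeroExt_eq_zero _ hab, zero_smul, Finset.sum_const_zero]
        exact vec_eq_zero _ hab
    have key := hC.solvesC.sum_smul (w := fun x b : ℤ => vec vt x b)
      (S := fun a b : ℤ => vec vs a b) hS h
    rw [← key, hvs' j (by omega) i (by omega), map_sum]
    refine Finset.sum_subset_zero_on_sdiff
      (fun k => by simp only [Finset.mem_range]; omega) (fun k hk => ?_) fun x hx => ?_
    · rw [ParamArray.p_of_lt_left (by
        simp only [Finset.mem_sdiff, Finset.mem_range] at hk; omega), zero_smul]
    · rw [Finset.mem_range] at hx
      rw [map_smul, Y_vt x j (by omega)]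
  · intro i j h
    have hd := hG.diamΦ j (by omega)
    have := (hG.goodΦ j (by omega)).sum_p_rec_dual (fun z => vec vt z j) (i := i) (by omega)
    rw [hvs' j (by omega) i (by omega), ← this, map_sum]
    refine Finset.sum_congr rfl fun x hx => ?_
    rw [Finset.mem_range] at hx
    rw [map_smul, hXs x j (by omega)]
  · intro i j h
    rw [hvs i j h]
    refine Finset.sum_congr rfl fun x hx => ?_
    rw [Finset.mem_range] at hx
    rw [hvt x j (by omega), Finset.smul_sum]
    exact Finset.sum_congr rfl fun y _ => by rw [smul_smul]; rfl

end Construction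

/-! ### Common eigenspaces as coordinate lines, adjacency, chains -/

section VecLines

variable {V : Type*} [AddCommGroup V] [Module ℂ V] {N : ℕ}

theorem vecLine_eq (w : Module.Basis (triDom N) ℂ V) {q : ℕ × ℕ} (h : q ∈ triDom N) :
    vecLine w q = Submodule.span ℂ {w ⟨q, h⟩} := by
  unfold vecLine
  rw [vec_nat _ (mem_triDom.1 h)]

theorem repr_vec (w : Module.Basis (triDom N) ℂ V) (a b : ℤ) (q : triDom N) :
    w.repr (vec w a b) q = if a = q.1.1 ∧ b = q.1.2 then 1 else 0 := by
  obtain ⟨⟨x, y⟩, hq⟩ := q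
  have hxy := mem_triDom.1 hq
  by_cases hab : 0 ≤ a ∧ 0 ≤ b ∧ a + b ≤ (N : ℤ)
  · obtain ⟨k, l, rfl, rfl, hkl⟩ := exists_nat_of_dom hab
    rw [vec_nat _ hkl, Module.Basis.repr_self, Finsupp.single_apply]
    simp only [Subtype.mk.injEq, Prod.mk.injEq, Nat.cast_inj]
  · simp only at hxy
    rw [vec_eq_zero _ hab, map_zero, if_neg (by simp only; omega), Finsupp.zero_apply]

theorem form_vec_int {w : Module.Basis (triDom N) ℂ V} {F : ℕ → ℕ → ℂ}
    {B : LinearMap.BilinForm ℂ V} (hB : ∀ x y x' y' : ℕ, x + y ≤ N → x' + y' ≤ N →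
      B (vec w x y) (vec w x' y') = if x = x' ∧ y = y' then F x y else 0) {x y : ℕ}
    (h : x + y ≤ N) (a b : ℤ) :
    B (vec w x y) (vec w a b) = if a = x ∧ b = y then F x y else 0 := by
  by_cases hab : 0 ≤ a ∧ 0 ≤ b ∧ a + b ≤ (N : ℤ)
  · obtain ⟨k, l, rfl, rfl, hkl⟩ := exists_nat_of_dom hab
    rw [hB _ _ _ _ h hkl]
    exact if_congr (by omega) rfl rfl
  · rw [vec_eq_zero _ hab, map_zero, if_neg (by omega)]

theorem mem_vecLine (w : Module.Basis (triDom N) ℂ V) {x y : ℕ} {u : V}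
    (hu : u ∈ vecLine w (x, y)) : ∃ a : ℂ, u = a • vec w x y := by
  obtain ⟨a, rfl⟩ := Submodule.mem_span_singleton.1 hu
  exact ⟨a, rfl⟩

theorem diag_basis (w : Module.Basis (triDom N) ℂ V) {S : Module.End ℂ V} {α : ℕ → ℕ → ℂ}
    (hS : ∀ x y : ℕ, x + y ≤ N → S (vec w x y) = α x y • vec w x y) (q : triDom N) :
    S (w q) = α q.1.1 q.1.2 • w q := by
  have hq := mem_triDom.1 q.2
  have := hS _ _ hq
  rwa [vec_nat _ hq] at this

/-- The pairs `(α_{x,y}, β_{x,y})` with labels in the domain are distinct. -/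
def Separates (N : ℕ) (α β : ℕ → ℕ → ℂ) : Prop :=
  ∀ x y x' y', x + y ≤ N → x' + y' ≤ N → α x y = α x' y' → β x y = β x' y' → x = x' ∧ y = y'

theorem Separates.subtype {α β : ℕ → ℕ → ℂ} (h : Separates N α β) (q q' : triDom N)
    (h1 : α q.1.1 q.1.2 = α q'.1.1 q'.1.2) (h2 : β q.1.1 q.1.2 = β q'.1.1 q'.1.2) : q = q' :=
  Subtype.ext (Prod.ext_iff.2 (h _ _ _ _ (mem_triDom.1 q.2) (mem_triDom.1 q'.2) h1 h2))

variable {w : Module.Basis (triDom N) ℂ V} {S T : Module.End ℂ V} {α β : ℕ → ℕ → ℂ}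

theorem bijOn_vecLine
    (hS : ∀ x y : ℕ, x + y ≤ N → S (vec w x y) = α x y • vec w x y)
    (hT : ∀ x y : ℕ, x + y ≤ N → T (vec w x y) = β x y • vec w x y) (hd : Separates N α β) :
    Set.BijOn (vecLine w) (triDom N)
      {W | IsCommonEigenspace (Submodule.span ℂ {S, T} : Set (Module.End ℂ V)) W} := by
  have hS' := diag_basis w hS
  have hT' := diag_basis w hT
  refine ⟨fun q hq => ?_, fun q hq q' hq' h => ?_, fun W hW => ?_⟩
  · rw [vecLine_eq w hq]
    exact isCommonEigenspace_span w hS' hT' hd.subtype _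
  · rw [vecLine_eq w hq, vecLine_eq w hq'] at h
    have h1 : w ⟨q, hq⟩ ∈ Submodule.span ℂ {w ⟨q', hq'⟩} :=
      h ▸ Submodule.mem_span_singleton_self _
    obtain ⟨a, ha⟩ := Submodule.mem_span_singleton.1 h1
    have h2 := congrArg (fun u => w.repr u ⟨q, hq⟩) ha
    simp only [map_smul, Module.Basis.repr_self, Finsupp.smul_apply, Finsupp.single_apply,
      if_true] at h2
    by_contra hne
    rw [if_neg (fun h => hne (Subtype.ext_iff.1 h).symm)] at h2
    simp at h2
  · obtain ⟨q, rfl⟩ := eq_span_of_isCommonEigenspace w hS' hT' hd.subtype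
      (Submodule.subset_span (by simp)) (Submodule.subset_span (by simp)) hW
    exact ⟨q, q.2, vecLine_eq w q.2⟩

/-- The labels `(0,0)`, `(1,0)`, `(0,1)` suffice, which is where `N > 0` is needed. The two
alternatives fit `(X, Y)`, where the first eigenvalue ignores the second label, and `(X*, Y*)`,
where the second ignores the first. -/
theorem linearIndependent_pair_of_diag (hN : 0 < N)
    (hS : ∀ x y : ℕ, x + y ≤ N → S (vec w x y) = α x y • vec w x y)
    (hT : ∀ x y : ℕ, x + y ≤ N → T (vec w x y) = β x y • vec w x y)
    (h : (α 0 0 = α 0 1 ∧ β 0 0 ≠ β 0 1 ∧ α 0 0 ≠ α 1 0) ∨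
      (β 0 0 = β 1 0 ∧ α 0 0 ≠ α 1 0 ∧ β 0 0 ≠ β 0 1)) :
    LinearIndependent ℂ ![S, T] := by
  rw [LinearIndependent.pair_iff]
  intro s t hst
  have key : ∀ x y, x + y ≤ N → s * α x y + t * β x y = 0 := by
    intro x y hxy
    have h1 := LinearMap.congr_fun hst (vec w x y)
    simp only [LinearMap.add_apply, LinearMap.smul_apply, hS x y hxy, hT x y hxy, smul_smul,
      LinearMap.zero_apply, ← add_smul] at h1
    rw [vec_nat _ hxy] at h1
    exact (smul_eq_zero.1 h1).resolve_right (w.ne_zero _)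
  have k0 := key 0 0 (by omega)
  have k1 := key 1 0 (by omega)
  have k2 := key 0 1 (by omega)
  rcases h with ⟨h1, h2, h3⟩ | ⟨h1, h2, h3⟩
  · have ht : t = 0 := by
      have : t * (β 0 0 - β 0 1) = 0 := by linear_combination k0 - k2 - s * h1
      exact (mul_eq_zero.1 this).resolve_right (sub_ne_zero.2 h2)
    have : s * (α 0 0 - α 1 0) = 0 := by
      linear_combination k0 - k1 + (β 1 0 - β 0 0) * ht
    exact ⟨(mul_eq_zero.1 this).resolve_right (sub_ne_zero.2 h3), ht⟩
  · have hs : s = 0 := by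
      have : s * (α 0 0 - α 1 0) = 0 := by linear_combination k0 - k1 - t * h1
      exact (mul_eq_zero.1 this).resolve_right (sub_ne_zero.2 h2)
    have : t * (β 0 0 - β 0 1) = 0 := by
      linear_combination k0 - k2 + (α 0 1 - α 0 0) * hs
    exact ⟨hs, (mul_eq_zero.1 this).resolve_right (sub_ne_zero.2 h3)⟩

/-- A neighbour outside the triangle is the zero vector, so boundary labels need no separate
treatment later. -/
theorem vec_mem_iSup_adj (w : Module.Basis (triDom N) ℂ V) {x y : ℕ} {e : ℤ × ℤ}
    (he : e ∈ rootsA2) : vec w (x + e.1) (y + e.2) ∈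
      ⨆ q' ∈ {q' | q' ∈ triDom N ∧ adjA2 q' (x, y)}, vecLine w q' := by
  by_cases hab : 0 ≤ (x : ℤ) + e.1 ∧ 0 ≤ (y : ℤ) + e.2 ∧ (x : ℤ) + e.1 + (y + e.2) ≤ (N : ℤ)
  · obtain ⟨k, l, hk, hl, hkl⟩ := exists_nat_of_dom hab
    rw [hk, hl]
    refine Submodule.mem_iSup_of_mem (k, l) (Submodule.mem_iSup_of_mem ⟨mem_triDom.2 hkl, ?_⟩
      (Submodule.mem_span_singleton_self _))
    unfold adjA2
    rw [← hk, ← hl]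
    simpa using he
  · rw [vec_eq_zero _ hab]
    exact Submodule.zero_mem _

theorem map_vecLine_le_of_action {S' T' : Module.End ℂ V} {x y : ℕ} {L : Submodule ℂ V}
    (h1 : S' (vec w x y) ∈ L) (h2 : T' (vec w x y) ∈ L) :
    ∀ h ∈ Submodule.span ℂ {S', T'}, (vecLine w (x, y)).map h ≤ L := by
  intro h hh
  obtain ⟨a, b, rfl⟩ := Submodule.mem_span_pair.1 hh
  unfold vecLine
  rw [Submodule.map_span_le]
  rintro _ rfl
  exact L.add_mem (L.smul_mem _ h1) (L.smul_mem _ h2)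

theorem sum_roots_mem_iSup_adj (w : Module.Basis (triDom N) ℂ V) (f : ℤ × ℤ → ℂ) (x y : ℕ) :
    ∑ e ∈ rootsA2, f e • vec w (x + e.1) (y + e.2) ∈
      ⨆ q' ∈ {q' | q' ∈ triDom N ∧ adjA2 q' (x, y)}, vecLine w q' :=
  Submodule.sum_mem _ fun _ he => Submodule.smul_mem _ _ (vec_mem_iSup_adj w he)

theorem tridiag_snd_mem_iSup_adj (w : Module.Basis (triDom N) ℂ V) (a b c : ℂ) (x y : ℕ) :
    a • vec w x (y - 1) + b • vec w x y + c • vec w x (y + 1) ∈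
      ⨆ q' ∈ {q' | q' ∈ triDom N ∧ adjA2 q' (x, y)}, vecLine w q' := by
  have h1 := vec_mem_iSup_adj w (x := x) (y := y) (e := (0, -1)) (by decide)
  have h2 := vec_mem_iSup_adj w (x := x) (y := y) (e := (0, 0)) (by decide)
  have h3 := vec_mem_iSup_adj w (x := x) (y := y) (e := (0, 1)) (by decide)
  simp only [add_zero, ← sub_eq_add_neg] at h1 h2 h3
  exact Submodule.add_mem _ (Submodule.add_mem _ (Submodule.smul_mem _ _ h1)
    (Submodule.smul_mem _ _ h2)) (Submodule.smul_mem _ _ h3)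

theorem tridiag_fst_mem_iSup_adj (w : Module.Basis (triDom N) ℂ V) (a b c : ℂ) (x y : ℕ) :
    a • vec w (x - 1) y + b • vec w x y + c • vec w (x + 1) y ∈
      ⨆ q' ∈ {q' | q' ∈ triDom N ∧ adjA2 q' (x, y)}, vecLine w q' := by
  have h1 := vec_mem_iSup_adj w (x := x) (y := y) (e := (-1, 0)) (by decide)
  have h2 := vec_mem_iSup_adj w (x := x) (y := y) (e := (0, 0)) (by decide)
  have h3 := vec_mem_iSup_adj w (x := x) (y := y) (e := (1, 0)) (by decide)
  simp only [add_zero, ← sub_eq_add_neg] at h1 h2 h3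
  exact Submodule.add_mem _ (Submodule.add_mem _ (Submodule.smul_mem _ _ h1)
    (Submodule.smul_mem _ _ h2)) (Submodule.smul_mem _ _ h3)

/-- A subspace invariant under an irreducible tridiagonal action contains the whole chain as soon
as it contains one of its vectors. -/
theorem chain_mem {W : Submodule ℂ V} {n : ℕ} {g : ℤ → V} {T : Module.End ℂ V}
    {b a c : ℕ → ℂ} (hT : ∀ z : ℕ, z ≤ n →
      T (g z) = b z • g (z - 1) + a z • g z + c z • g (z + 1))
    (hW : ∀ u ∈ W, T u ∈ W) (hb : ∀ z, 1 ≤ z → z ≤ n → b z ≠ 0) (hc : ∀ z, z < n → c z ≠ 0)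
    (hlow : ∀ (z : ℕ) (r s t : ℂ), 1 ≤ z → z ≤ n →
      r • g (z - 1) + s • g z + t • g (z + 1) ∈ W → r ≠ 0 → g (z - 1) ∈ W)
    (hhigh : ∀ (z : ℕ) (r s t : ℂ), z < n →
      r • g (z - 1) + s • g z + t • g (z + 1) ∈ W → t ≠ 0 → g (z + 1) ∈ W)
    {z : ℕ} (hz : z ≤ n) (hg : g z ∈ W) : ∀ z' : ℕ, z' ≤ n → g z' ∈ W := by
  -- Descend to the bottom of the chain by the nonzero `b`, then climb by the nonzero `c`.
  have h0 : g (0 : ℕ) ∈ W := by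
    clear hc hhigh
    induction z with
    | zero => exact hg
    | succ z ih =>
      refine ih (by omega) ?_
      have h1 := hW _ hg
      rw [hT _ hz] at h1
      have h2 := hlow _ _ _ _ (by omega) hz h1 (hb _ (by omega) hz)
      rwa [show ((z + 1 : ℕ) : ℤ) - 1 = z by push_cast; ring] at h2
  intro z'
  induction z' with
  | zero => exact fun _ => h0
  | succ z' ih =>
    intro hz'
    have h1 := hW _ (ih (by omega))
    rw [hT _ (by omega)] at h1
    have h2 := hhigh _ _ _ _ (by omega) h1 (hc _ (by omega))
    rwa [← Nat.cast_succ] at h2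

end VecLines

/-! ### Irreducibility and the axioms of a factorized pair -/

section Factorized

variable {V : Type*} [AddCommGroup V] [Module ℂ V] {N : ℕ} {Φ Ψ : ℕ → ParamArray}

theorem SolvesFG.G_ne {F G : ℕ → ℕ → ℂ} (hG : GoodFamilies N Φ Ψ) (hFG : SolvesFG N Φ Ψ F G)
    {i j : ℕ} (h : i + j ≤ N) : G i j ≠ 0 := by
  intro h0
  have h1 := hFG.eq i j 0 0 h (by omega) (by omega)
  rw [h0, zero_div] at h1
  have hΨ := hG.goodΨ 0 (by omega)
  have hΦ := hG.goodΦ j (by omega)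
  have hdΨ := hG.diamΨ 0 (by omega)
  have hdΦ := hG.diamΦ j (by omega)
  exact mul_ne_zero (mul_ne_zero (div_ne_zero (hΦ.k_ne (by omega)) (hΦ.star.k_ne (by omega)))
    (div_ne_zero (hΨ.k_ne (by omega)) (hΨ.star.k_ne (by omega)))) (hFG.F_ne 0 0 (by omega)) h1

/-- The eigenvalue `t_x` determines `x`, and for this `x` the eigenvalue `θ_y(x)` determines `y`. -/
theorem GoodFamilies.separates (hG : GoodFamilies N Φ Ψ) :
    Separates N (fun x _ => (Φ 0).ev x) (fun x y => (Ψ x).ev y) := by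
  intro x y x' y' h h' h1 h2
  have hx : x = x' := by
    by_contra hne
    have hd := hG.diamΦ 0 (by omega)
    exact (hG.goodΦ 0 (by omega)).ev_ne _ _ (by omega) (by omega) hne h1
  subst hx
  refine ⟨rfl, ?_⟩
  by_contra hne
  have hd := hG.diamΨ x (by omega)
  exact (hG.goodΨ x (by omega)).ev_ne _ _ (by omega) (by omega) hne h2

theorem Separates.transpose {α β : ℕ → ℕ → ℂ} (h : Separates N α β) :
    Separates N (fun x y => β y x) (fun x y => α y x) :=
  fun x y x' y' h1 h2 h3 h4 => (h y x y' x' (by omega) (by omega) h4 h3).symm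

theorem GoodFamilies.separates_mid (hG : GoodFamilies N Φ Ψ) :
    Separates N (fun x _ => (Φ 0).ev x) (fun _ j => (Ψ 0).dev j) := by
  intro x y x' y' h h' h1 h2
  constructor
  · by_contra hne
    have hd := hG.diamΦ 0 (by omega)
    exact (hG.goodΦ 0 (by omega)).ev_ne _ _ (by omega) (by omega) hne h1
  · by_contra hne
    have hd := hG.diamΨ 0 (by omega)
    exact (hG.goodΨ 0 (by omega)).dev_ne _ _ (by omega) (by omega) hne h2

namespace RealizesActions

variable {C D : ℤ → ℤ → ℕ → ℕ → ℂ} {F G : ℕ → ℕ → ℂ} {X Y Xs Ys : Module.End ℂ V}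
  {v vt vs : Module.Basis (triDom N) ℂ V} {B : LinearMap.BilinForm ℂ V}

/-- A nonzero invariant subspace contains some `V_{x,y}`, as `X` and `Y` separate components. `Y*`
spreads this over the row `x`, so `V~_{x,0}` lies in the subspace; `X*` spreads that over all
`V~_{x',0}`; each of these has a nonzero component `V_{x',0}`, and `Y*` fills the rows. -/
theorem irreducible (hG : GoodFamilies N Φ Ψ)
    (h : RealizesActions N Φ Ψ C D F G X Y Xs Ys v vt vs B) {W : Submodule ℂ V}
    (hX : ∀ u ∈ W, X u ∈ W) (hY : ∀ u ∈ W, Y u ∈ W) (hXs : ∀ u ∈ W, Xs u ∈ W)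
    (hYs : ∀ u ∈ W, Ys u ∈ W) : W = ⊥ ∨ W = ⊤ := by
  rcases eq_or_ne W ⊥ with h0 | h0
  · exact Or.inl h0
  right
  have hcomp : ∀ u ∈ W, ∀ x y : ℕ, ∀ hxy : x + y ≤ N,
      v.repr u ⟨(x, y), mem_triDom.2 hxy⟩ ≠ 0 → vec v x y ∈ W := by
    intro u hu x y hxy hne
    rw [vec_nat _ hxy]
    exact component_mem_of_invariant v
      (diag_basis v (α := fun x _ => (Φ 0).ev x) fun x y hxy => h.X_v x y hxy 0 (by omega))
      (diag_basis v (α := fun x y => (Ψ x).ev y) h.Y_v) hG.separates.subtype hX hY hu hne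
  have hcomp' : ∀ u ∈ W, ∀ x y : ℕ, ∀ hxy : x + y ≤ N,
      vt.repr u ⟨(x, y), mem_triDom.2 hxy⟩ ≠ 0 → vec vt x y ∈ W := by
    intro u hu x y hxy hne
    rw [vec_nat _ hxy]
    exact component_mem_of_invariant vt
      (diag_basis vt (α := fun x _ => (Φ 0).ev x) fun x y hxy => by
        rw [h.X_vt x y hxy, hG.ev_eq x y hxy])
      (diag_basis vt (α := fun _ j => (Ψ 0).dev j) fun x y hxy => by
        rw [h.Ys_vt x y hxy, hG.dev_eq x y hxy]) hG.separates_mid.subtype hX hYs hu hne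
  have row : ∀ x y : ℕ, x + y ≤ N → vec v x y ∈ W → ∀ y' : ℕ, y' ≤ N - x → vec v x y' ∈ W := by
    intro x y hxy hmem
    have hd := hG.diamΨ x (by omega)
    have hg := (hG.goodΨ x (by omega)).star
    refine chain_mem (g := fun z => vec v x z) (T := Ys) (n := N - x)
      (b := (Ψ x).star.bPrev) (a := (Ψ x).star.a) (c := fun z => (Ψ x).star.c (z + 1))
      (fun z hz => h.Ys_v x z (by omega)) hYs ?_ ?_ ?_ ?_ (z := y) (by omega) hmem
    · intro z h1 h2
      obtain ⟨z, rfl⟩ := Nat.exists_eq_add_of_le' h1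
      exact hg.b_ne (by rw [ParamArray.star_diam]; omega)
    · intro z hz
      exact hg.c_ne (by omega) (by rw [ParamArray.star_diam]; omega)
    · intro z r s t h1 h2 hm hr
      obtain ⟨z, rfl⟩ := Nat.exists_eq_add_of_le' h1
      have e : ((z + 1 : ℕ) : ℤ) - 1 = z := by push_cast; ring
      simp only [e] at hm ⊢
      refine hcomp _ hm x z (by omega) ?_
      simp only [map_add, map_smul, Finsupp.add_apply, Finsupp.smul_apply, repr_vec, smul_eq_mul, and_true,
        true_and]
      rw [if_pos trivial, if_neg (by omega), if_neg (by omega)]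
      simpa using hr
    · intro z r s t h2 hm ht
      simp only [← Nat.cast_succ] at hm ⊢
      refine hcomp _ hm x (z + 1) (by omega) ?_
      simp only [map_add, map_smul, Finsupp.add_apply, Finsupp.smul_apply, repr_vec, smul_eq_mul, and_true,
        true_and]
      rw [if_neg (by omega), if_neg (by omega), if_pos trivial]
      simpa using ht
  have col : ∀ x : ℕ, x ≤ N → vec vt x (0 : ℕ) ∈ W →
      ∀ x' : ℕ, x' ≤ N → vec vt x' (0 : ℕ) ∈ W := by
    intro x hx hmem
    have hd := hG.diamΦ 0 (by omega)
    have hg := (hG.goodΦ 0 (by omega)).star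
    refine chain_mem (g := fun z => vec vt z (0 : ℕ)) (T := Xs) (n := N)
      (b := (Φ 0).star.bPrev) (a := (Φ 0).star.a) (c := fun z => (Φ 0).star.c (z + 1))
      (fun z hz => h.Xs_vt z 0 (by omega)) hXs ?_ ?_ ?_ ?_ hx hmem
    · intro z h1 h2
      obtain ⟨z, rfl⟩ := Nat.exists_eq_add_of_le' h1
      exact hg.b_ne (by rw [ParamArray.star_diam]; omega)
    · intro z hz
      exact hg.c_ne (by omega) (by rw [ParamArray.star_diam]; omega)
    · intro z r s t h1 h2 hm hr
      obtain ⟨z, rfl⟩ := Nat.exists_eq_add_of_le' h1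
      have e : ((z + 1 : ℕ) : ℤ) - 1 = z := by push_cast; ring
      simp only [e] at hm ⊢
      refine hcomp' _ hm z 0 (by omega) ?_
      simp only [map_add, map_smul, Finsupp.add_apply, Finsupp.smul_apply, repr_vec, smul_eq_mul, and_true]
      rw [if_pos trivial, if_neg (by omega), if_neg (by omega)]
      simpa using hr
    · intro z r s t h2 hm ht
      simp only [← Nat.cast_succ] at hm ⊢
      refine hcomp' _ hm (z + 1) 0 (by omega) ?_
      simp only [map_add, map_smul, Finsupp.add_apply, Finsupp.smul_apply, repr_vec, smul_eq_mul, and_true]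
      rw [if_neg (by omega), if_neg (by omega), if_pos trivial]
      simpa using ht
  obtain ⟨u, huW, hu⟩ := W.ne_bot_iff.1 h0
  have hu' : v.repr u ≠ 0 := by simpa using hu
  obtain ⟨⟨⟨x, y⟩, hq⟩, hne⟩ := Finsupp.ne_iff.1 hu'
  have hxy := mem_triDom.1 hq
  have h1 := row x y hxy (hcomp u huW x y hxy hne)
  have h2 : vec vt x (0 : ℕ) ∈ W := by
    rw [h.vt_eq x 0 (by omega)]
    refine Submodule.sum_mem _ fun z hz => Submodule.smul_mem _ _ (h1 z ?_)
    rw [Finset.mem_range] at hz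
    omega
  have h3 := col x (by omega) h2
  have h4 : ∀ x : ℕ, x ≤ N → vec v x (0 : ℕ) ∈ W := by
    intro x hx
    -- The coefficient of `V_{x,0}` in `V~_{x,0}` is `p_{00}(Ψ_x) = 1`.
    refine hcomp _ (h3 x hx) x 0 (by omega) ?_
    rw [h.vt_eq x 0 (by omega), map_sum, Finsupp.finsetSum_apply,
      Finset.sum_eq_single_of_mem 0 (by simp)]
    · have hg := hG.goodΨ x hx
      rw [ParamArray.p_of_le (by omega) (by omega), hg.k_zero, ParamArray.u_zero, map_smul,
        Finsupp.smul_apply, repr_vec, if_pos (by simp)]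
      simp
    · intro z _ hz
      rw [map_smul, Finsupp.smul_apply, repr_vec, if_neg (by simp only; omega), smul_zero]
  rw [eq_top_iff, ← v.span_eq, Submodule.span_le]
  rintro _ ⟨q, rfl⟩
  have hq := mem_triDom.1 q.2
  have := row q.1.1 0 (by omega) (h4 _ (by omega)) q.1.2 (by omega)
  rwa [vec_nat _ hq] at this

/-- Every axiom is now read in the basis adapted to it: `v` for `(X, Y)`, `vs` for `(X*, Y*)` and
`vt` for the commuting pair `(X, Y*)`. -/
theorem isFactorized (hN : 0 < N) (hG : GoodFamilies N Φ Ψ)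
    (h : RealizesActions N Φ Ψ C D F G X Y Xs Ys v vt vs B) (hF : SolvesFG N Φ Ψ F G) :
    IsFactorizedA2LeonardPair N X Y Xs Ys (vecLine v) (vecLine vs) B := by
  have hX : ∀ x y : ℕ, x + y ≤ N → X (vec v x y) = (fun x _ => (Φ 0).ev x : ℕ → ℕ → ℂ) x y •
      vec v x y := fun x y hxy => h.X_v x y hxy 0 (by omega)
  have hY : ∀ x y : ℕ, x + y ≤ N → Y (vec v x y) = (fun x y => (Ψ x).ev y : ℕ → ℕ → ℂ) x y •
      vec v x y := h.Y_v
  have hXs : ∀ i j : ℕ, i + j ≤ N → Xs (vec vs i j) =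
      (fun i j => (Φ j).dev i : ℕ → ℕ → ℂ) i j • vec vs i j := h.Xs_vs
  have hYs : ∀ i j : ℕ, i + j ≤ N → Ys (vec vs i j) =
      (fun _ j => (Ψ 0).dev j : ℕ → ℕ → ℂ) i j • vec vs i j :=
    fun i j hij => h.Ys_vs i j hij 0 (by omega)
  have hsep := hG.separates
  have hsep' : Separates N (fun i j => (Φ j).dev i) (fun _ j => (Ψ 0).dev j) :=
    hG.swap.separates.transpose
  have hX' : ∀ x y : ℕ, x + y ≤ N → X (vec vt x y) = (fun x _ => (Φ 0).ev x : ℕ → ℕ → ℂ) x y •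
      vec vt x y := fun x y hxy => by rw [h.X_vt x y hxy, hG.ev_eq x y hxy]
  have hYs' : ∀ i j : ℕ, i + j ≤ N → Ys (vec vt i j) =
      (fun _ j => (Ψ 0).dev j : ℕ → ℕ → ℂ) i j • vec vt i j :=
    fun x y hxy => by rw [h.Ys_vt x y hxy, hG.dev_eq x y hxy]
  have hd0 := hG.diamΦ 0 (by omega)
  have hg0 := hG.goodΦ 0 (by omega)
  have hd0' := hG.diamΨ 0 (by omega)
  have hg0' := hG.goodΨ 0 (by omega)
  have hli : LinearIndependent ℂ ![X, Y] :=
    linearIndependent_pair_of_diag hN hX hY (Or.inl ⟨rfl,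
      hg0'.ev_ne _ _ (by omega) (by omega) (by omega),
      hg0.ev_ne _ _ (by omega) (by omega) (by omega)⟩)
  have hli' : LinearIndependent ℂ ![Xs, Ys] :=
    linearIndependent_pair_of_diag hN hXs hYs (Or.inr ⟨rfl,
      hg0.dev_ne _ _ (by omega) (by omega) (by omega),
      hg0'.dev_ne _ _ (by omega) (by omega) (by omega)⟩)
  refine
    { linIndep := hli
      linIndep_star := hli'
      isA2LeonardPair :=
        { plane := isDiagonalPlane_span v (diag_basis v hX) (diag_basis v hY) hli
          plane_star := isDiagonalPlane_span vs (diag_basis vs hXs) (diag_basis vs hYs) hli'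
          bij := bijOn_vecLine hX hY hsep
          action := ?_
          bij_star := bijOn_vecLine hXs hYs hsep'
          action_star := ?_
          irreducible := ?_
          finrank_one := ?_
          form_nondegenerate := (form_nondegenerate_of_diag v h.form hF.F_ne).1
          form_symm := (form_nondegenerate_of_diag v h.form hF.F_ne).2
          form_orth := ?_ }
      eigenvalues := ⟨(Φ 0).ev, ?_, ?_⟩
      eigenvalues_star := ⟨(Ψ 0).dev, ?_, ?_⟩
      commute := commute_of_diag vt (diag_basis vt hX') (diag_basis vt hYs')
      common_finrank := ?_
      offdiag_star := ?_
      offdiag := ?_ }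
  · rintro ⟨x, y⟩ hq
    have hxy := mem_triDom.1 hq
    refine map_vecLine_le_of_action ?_ ?_
    · rw [h.Xs_v x y hxy]
      exact sum_roots_mem_iSup_adj v (fun e => D e.1 e.2 x y) x y
    · rw [h.Ys_v x y hxy]
      exact tridiag_snd_mem_iSup_adj v _ _ _ x y
  · rintro ⟨i, j⟩ hq
    have hij := mem_triDom.1 hq
    refine map_vecLine_le_of_action ?_ ?_
    · rw [h.X_vs i j hij]
      exact tridiag_fst_mem_iSup_adj vs _ _ _ i j
    · rw [h.Y_vs i j hij]
      exact sum_roots_mem_iSup_adj vs (fun e => C e.1 e.2 i j) i j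
  · intro W h1 h2
    refine h.irreducible hG (fun u hu => ?_) (fun u hu => ?_) (fun u hu => ?_) fun u hu => ?_
    · exact h1 X (Submodule.subset_span (by simp)) (Submodule.mem_map_of_mem hu)
    · exact h1 Y (Submodule.subset_span (by simp)) (Submodule.mem_map_of_mem hu)
    · exact h2 Xs (Submodule.subset_span (by simp)) (Submodule.mem_map_of_mem hu)
    · exact h2 Ys (Submodule.subset_span (by simp)) (Submodule.mem_map_of_mem hu)
  · intro q hq
    rw [vecLine_eq v hq, vecLine_eq vs hq]
    exact ⟨finrank_span_singleton (v.ne_zero _), finrank_span_singleton (vs.ne_zero _)⟩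
  · rintro ⟨x, y⟩ hq ⟨x', y'⟩ hq' hne
    have hne' : ¬ (x = x' ∧ y = y') := by simpa using hne
    constructor
    · intro u hu u' hu'
      obtain ⟨a, rfl⟩ := mem_vecLine v hu
      obtain ⟨b, rfl⟩ := mem_vecLine v hu'
      simp [h.form _ _ _ _ (mem_triDom.1 hq) (mem_triDom.1 hq'), hne']
    · intro u hu u' hu'
      obtain ⟨a, rfl⟩ := mem_vecLine vs hu
      obtain ⟨b, rfl⟩ := mem_vecLine vs hu'
      simp [h.form_star _ _ _ _ (mem_triDom.1 hq) (mem_triDom.1 hq'), hne']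
  · exact fun x x' hx hx' => ⟨fun hne => fun he => hne (by rw [he]),
      hg0.ev_ne x x' (by omega) (by omega)⟩
  · rintro ⟨x, y⟩ hq u hu
    obtain ⟨a, rfl⟩ := mem_vecLine v hu
    rw [map_smul, hX x y (mem_triDom.1 hq), smul_comm]
  · exact fun x x' hx hx' => ⟨fun hne => fun he => hne (by rw [he]),
      hg0'.dev_ne x x' (by omega) (by omega)⟩
  · rintro ⟨x, y⟩ hq u hu
    obtain ⟨a, rfl⟩ := mem_vecLine vs hu
    rw [map_smul, hYs x y (mem_triDom.1 hq), smul_comm]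
  · intro W hW
    obtain ⟨q, rfl⟩ := eq_span_of_isCommonEigenspace vt (diag_basis vt hX') (diag_basis vt hYs')
      hG.separates_mid.subtype (by simp) (by simp) hW
    exact finrank_span_singleton (vt.ne_zero _)
  · intro i j hij u hu u' hu' hne hne'
    obtain ⟨a, rfl⟩ := mem_vecLine vs hu
    obtain ⟨b, rfl⟩ := mem_vecLine vs hu'
    have ha : a ≠ 0 := fun h0 => hne (by rw [h0, zero_smul])
    have hb : b ≠ 0 := fun h0 => hne' (by rw [h0, zero_smul])
    have hg := hG.goodΦ j (by omega)
    have hd := hG.diamΦ j (by omega)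
    constructor
    -- The diagonal form picks out the neighbouring coefficient, `c_{i+1}(Φ_j)` here and `b_i(Φ_j)`
    -- next, times a norm `G`; none of these vanishes.
    · rw [map_smul, map_smul, map_smul, LinearMap.smul_apply, h.X_vs i j (by omega)]
      simp only [map_add, map_smul, form_vec_int h.form_star hij, smul_eq_mul, and_true]
      rw [if_neg (by omega), if_neg (by omega), if_pos (by omega)]
      have h1 := hg.c_ne (i := i + 1) (by omega) (by omega)
      have h2 := hF.G_ne hG hij
      simp [ha, hb, h1, h2]
    · rw [map_smul, map_smul, map_smul, LinearMap.smul_apply, h.X_vs (i + 1) j (by omega)]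
      simp only [map_add, map_smul, form_vec_int h.form_star (by omega : i + j ≤ N), smul_eq_mul,
        and_true]
      rw [if_pos (by omega), if_neg (by omega), if_neg (by omega)]
      have h1 := hg.b_ne (i := i) (by omega)
      have h2 := hF.G_ne hG (by omega : i + j ≤ N)
      simp [ha, hb, h1, h2, ParamArray.bPrev]
  · intro x y hxy u hu u' hu' hne hne'
    obtain ⟨a, rfl⟩ := mem_vecLine v hu
    obtain ⟨b, rfl⟩ := mem_vecLine v hu'
    have ha : a ≠ 0 := fun h0 => hne (by rw [h0, zero_smul])
    have hb : b ≠ 0 := fun h0 => hne' (by rw [h0, zero_smul])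
    have hg := (hG.goodΨ x (by omega)).star
    have hd := hG.diamΨ x (by omega)
    constructor
    · rw [map_smul, map_smul, map_smul, LinearMap.smul_apply, h.Ys_v x y (by omega)]
      simp only [map_add, map_smul, form_vec_int h.form (by omega : x + (y + 1) ≤ N), smul_eq_mul,
        true_and]
      rw [if_neg (by omega), if_neg (by omega), if_pos (by omega)]
      have h1 := hg.c_ne (i := y + 1) (by omega) (by rw [ParamArray.star_diam]; omega)
      have h2 := hF.F_ne x (y + 1) (by omega)
      simp [ha, hb, h1, h2]
    · rw [map_smul, map_smul, map_smul, LinearMap.smul_apply, h.Ys_v x (y + 1) (by omega)]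
      simp only [map_add, map_smul, form_vec_int h.form (by omega : x + y ≤ N), smul_eq_mul,
        true_and]
      rw [if_pos (by omega), if_neg (by omega), if_neg (by omega)]
      have h1 := hg.b_ne (i := y) (by rw [ParamArray.star_diam]; omega)
      have h2 := hF.F_ne x y (by omega)
      simp [ha, hb, h1, h2, ParamArray.bPrev]

end RealizesActions

/-- Compatible families of arrays with the recurrences of Leonard systems give a factorized
`A_2`-Leonard pair. -/
theorem GoodFamilies.givesFactorizedPair (hN : 0 < N) (hG : GoodFamilies N Φ Ψ)
    (hΦ : ∀ j ≤ N, (Φ j).IsValid) (hΨ : ∀ x ≤ N, (Ψ x).IsValid) {C D : ℤ → ℤ → ℕ → ℕ → ℂ}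
    {F G : ℕ → ℕ → ℂ} (hC : CompatibleWith N Φ Ψ C D F G)
    (hdeg : ∀ i j, i + j ≤ N → ∃ P : MvPolynomial (Fin 2) ℂ,
      P.totalDegree = i + j ∧ P.degreeOf 1 = j ∧ ∀ x y, x + y ≤ N →
        tratnik Φ Ψ i j x y = MvPolynomial.eval ![(Φ 0).ev x, (Ψ x).ev y] P) :
    GivesFactorizedPair N Φ Ψ C D F G where
  validΦ j hj := ⟨hG.diamΦ j hj, hΦ j hj⟩
  validΨ x hx := ⟨hG.diamΨ x hx, hΨ x hx⟩
  compatible := hC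
  uniqueC C' h := hC.solvesC.unique hG h
  uniqueD D' h := hC.solvesD.unique hG h
  pair := by
    obtain ⟨X, Y, Xs, Ys, vt, vs, B, h⟩ :=
      exists_realizesActions hG hC (Pi.basisFun ℂ (triDom N))
    have hf := h.isFactorized hN hG hC.solvesFG
    obtain ⟨h1, h2, h3, h4, h5, h6, h7, h8, h9, h10, h11, h12, h13, h14, h15, h16, h17⟩ := h
    exact ⟨triDom N → ℂ, inferInstance, inferInstance, X, Y, Xs, Ys, Pi.basisFun ℂ (triDom N),
      vt, vs, B, ⟨hf, h1, h2, h3, h4, h5, h6, h7, h8, h9, h10, h11, h12, h13, h14, h15, h16,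
        h17⟩⟩
  degree := hdeg

end Factorized

/-! ### Pochhammer symbols and elementary products -/

section Poch

theorem poch_zero (a : ℂ) : poch a 0 = 1 := by simp [poch]

theorem poch_succ (a : ℂ) (n : ℕ) : poch a (n + 1) = poch a n * (a + n) := by
  simp [poch, Finset.prod_range_succ]

theorem poch_succ' (a : ℂ) (n : ℕ) : poch a (n + 1) = a * poch (a + 1) n := by
  unfold poch
  rw [Finset.prod_range_succ', mul_comm]
  simp only [Nat.cast_zero, add_zero]
  congr 1
  exact Finset.prod_congr rfl fun k _ => by push_cast; ring

theorem poch_ne_zero {a : ℂ} {n : ℕ} (h : ∀ k < n, a + k ≠ 0) : poch a n ≠ 0 :=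
  Finset.prod_ne_zero_iff.2 fun k hk => h k (Finset.mem_range.1 hk)

theorem poch_add (a : ℂ) (m n : ℕ) : poch a (m + n) = poch a m * poch (a + m) n := by
  unfold poch
  rw [Finset.prod_range_add]
  congr 1
  exact Finset.prod_congr rfl fun k _ => by push_cast; ring

/-- Reading the factors backwards, each with its sign changed. -/
theorem poch_reflect {a b : ℂ} {n : ℕ} (h : a + b = 1 - n) : poch a n = (-1) ^ n * poch b n := by
  have hb : b = 1 - n - a := by linear_combination h
  subst hb
  clear h
  induction n generalizing a with
  | zero => simp [poch_zero]
  | succ n ih =>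
    rw [poch_succ' a, ih, poch_succ]
    have : (1 - (n : ℂ) - (a + 1)) = 1 - ((n + 1 : ℕ) : ℂ) - a := by push_cast; ring
    rw [this]
    push_cast
    ring

/-- `(a)_i (a+i)(a+i+1) = a (a+1)_{i+1}`. -/
theorem poch_shift (a : ℂ) (n : ℕ) : a * poch (a + 1) n = poch a n * (a + n) := by
  rw [← poch_succ', poch_succ]

end Poch

section Products

theorem prod_range_sub_cast (i : ℕ) : ∏ h ∈ Finset.range i, ((i : ℂ) - h) = i.factorial := by
  rw [Finset.prod_range_natCast_sub, ← Nat.descFactorial_eq_prod_range, Nat.descFactorial_self]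

theorem prod_range_add_one_cast (n : ℕ) :
    ∏ t ∈ Finset.range n, ((t : ℂ) + 1) = n.factorial := by
  rw [← Finset.prod_range_add_one_eq_factorial]
  push_cast
  rfl

theorem prod_Icc_shift (f : ℕ → ℂ) (i d : ℕ) :
    ∏ h ∈ Finset.Icc (i + 1) d, f h = ∏ t ∈ Finset.range (d - i), f (i + 1 + t) := by
  rw [show Finset.Icc (i + 1) d = Finset.Ico (i + 1) (d + 1) by ext; simp,
    Finset.prod_Ico_eq_prod_range, Nat.add_sub_add_right]

end Products

/-! ### A single Hahn array and its dual -/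

/-- The dual array of the Hahn array of diameter `d`, in the same parameters. -/
noncomputable def dualBase (d : ℕ) (m r s : ℂ) : ParamArray where
  diam := d
  ev := fun x => m * x * (x + 1 + s)
  dev := fun x => x
  fst := fun x => m * x * (x - d - 1) * (x + r)
  snd := fun x => m * x * (x - d - 1) * (x + r - s - d - 1)

/-- The Hahn array of diameter `d`. -/
noncomputable def hahnBase (d : ℕ) (m r s : ℂ) : ParamArray where
  diam := d
  ev := fun x => x
  dev := fun x => m * x * (x + 1 + s)
  fst := fun x => m * x * (x - d - 1) * (x + r)
  snd := fun x => -m * x * (x - d - 1) * (x + s - r)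

/-- Passing to index `j` in the family lowers the diameter by `j` and raises `s` by `j`. All
computations can thus be made for one array with free `d` and `s`. -/
theorem hahnArray_eq {N j : ℕ} (hj : j ≤ N) (m r s : ℂ) :
    hahnArray N m r s j = hahnBase (N - j) m r (s + j) := by
  unfold hahnArray hahnBase
  congr 1 <;> funext x <;> push_cast [Nat.cast_sub hj] <;> ring

theorem dualHahnArray_eq {N x : ℕ} (hx : x ≤ N) (m r s : ℂ) :
    dualHahnArray N m r s x = dualBase (N - x) m r (s + x) := by
  unfold dualHahnArray dualBase
  congr 1 <;> funext j <;> push_cast [Nat.cast_sub hx] <;> ring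

/-- Hahn and dual Hahn arrays with equal parameters are dual to each other. This is what makes `D` a
copy of `C` with the parameters exchanged. -/
theorem hahnBase_star_agree (d : ℕ) (m r s : ℂ) :
    (hahnBase d m r s).star.Agree (dualBase d m r s) where
  diam := rfl
  ev _ _ := rfl
  dev _ _ := rfl
  fst _ _ _ := rfl
  snd i h1 h2 := by
    simp only [ParamArray.star, hahnBase, dualBase] at h2 ⊢
    rw [Nat.cast_sub (by omega)]
    push_cast
    ring

theorem HahnNondeg.shift {N j : ℕ} {m r s : ℂ} (hj : j ≤ N) (h : HahnNondeg N m r s) :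
    HahnNondeg (N - j) m r (s + j) := by
  obtain ⟨h1, h2, h3, h4⟩ := h
  refine ⟨h1, fun n hn hn' => h2 n hn (by omega), fun n hn hn' => ?_, fun n hn hn' => ?_⟩
  · have := h3 (n + j) (by omega) (by omega)
    push_cast at this
    intro h0
    apply this
    linear_combination h0
  · have := h4 (n + j) (by omega) (by omega)
    push_cast at this
    intro h0
    apply this
    linear_combination h0

section Base

variable {d : ℕ} {m r s : ℂ}

theorem hahnBase_dev_sub (i h : ℕ) : (hahnBase d m r s).dev i - (hahnBase d m r s).dev h =
    m * (i - h) * (i + h + 1 + s) := by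
  simp only [hahnBase]
  ring

theorem natCast_sub_natCast_ne {i j : ℕ} (h : i ≠ j) : (i : ℂ) - j ≠ 0 :=
  sub_ne_zero.2 (Nat.cast_injective.ne h)

theorem natCast_sub_sub_one_ne {i d : ℕ} (h : i ≤ d) : (i : ℂ) - d - 1 ≠ 0 := by
  have := natCast_sub_natCast_ne (i := i) (j := d + 1) (by omega)
  push_cast at this
  rwa [sub_sub]

theorem natCast_pos_ne {i : ℕ} (h : 1 ≤ i) : (i : ℂ) ≠ 0 := Nat.cast_ne_zero.2 (by omega)

theorem HahnNondeg.s_ne (h : HahnNondeg d m r s) {a : ℂ} (n : ℕ) (h1 : 2 ≤ n) (h2 : n ≤ 2 * d)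
    (ha : a = s + n) : a ≠ 0 := ha ▸ h.2.2.2 n h1 h2

theorem HahnNondeg.r_ne (h : HahnNondeg d m r s) {a : ℂ} (n : ℕ) (h1 : 1 ≤ n) (h2 : n ≤ d)
    (ha : a = r + n) : a ≠ 0 := ha ▸ h.2.1 n h1 h2

theorem HahnNondeg.sr_ne (h : HahnNondeg d m r s) {a : ℂ} (n : ℕ) (h1 : 1 ≤ n) (h2 : n ≤ d)
    (ha : a = s - r + n) : a ≠ 0 := ha ▸ h.2.2.1 n h1 h2

theorem hahnBase_nondeg (h : HahnNondeg d m r s) : (hahnBase d m r s).Nondeg where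
  ev_ne i j _ _ hij := Nat.cast_injective.ne hij
  dev_ne i j hi hj hij := by
    rw [← sub_ne_zero, hahnBase_dev_sub]
    simp only [hahnBase] at hi hj
    exact mul_ne_zero (mul_ne_zero h.1 (natCast_sub_natCast_ne hij))
      (h.s_ne (i + j + 1) (by omega) (by omega) (by push_cast; ring))
  fst_ne i h1 hi := by
    simp only [hahnBase] at hi ⊢
    exact mul_ne_zero (mul_ne_zero (mul_ne_zero h.1 (natCast_pos_ne h1))
      (natCast_sub_sub_one_ne hi)) (h.r_ne i h1 hi (by ring))
  snd_ne i h1 hi := by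
    simp only [hahnBase] at hi ⊢
    exact mul_ne_zero (mul_ne_zero (mul_ne_zero (neg_ne_zero.2 h.1) (natCast_pos_ne h1))
      (natCast_sub_sub_one_ne hi)) (h.sr_ne i h1 hi (by ring))

theorem ParamArray.Nondeg.congr {Φ Φ' : ParamArray} (h : Φ.Nondeg) (ha : Φ.Agree Φ') :
    Φ'.Nondeg where
  ev_ne i j hi hj hij := by
    rw [← ha.diam] at hi hj
    rw [← ha.ev i hi, ← ha.ev j hj]
    exact h.ev_ne i j hi hj hij
  dev_ne i j hi hj hij := by
    rw [← ha.diam] at hi hj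
    rw [← ha.dev i hi, ← ha.dev j hj]
    exact h.dev_ne i j hi hj hij
  fst_ne i h1 hi := by
    rw [← ha.diam] at hi
    rw [← ha.fst i h1 hi]
    exact h.fst_ne i h1 hi
  snd_ne i h1 hi := by
    rw [← ha.diam] at hi
    rw [← ha.snd i h1 hi]
    exact h.snd_ne i h1 hi

theorem dualBase_nondeg (h : HahnNondeg d m r s) : (dualBase d m r s).Nondeg :=
  (hahnBase_nondeg h).star.congr (hahnBase_star_agree d m r s)

/-- The hypothesis holds for linear and for quadratic eigenvalues alike, so one closed form of `ϑ_i`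
serves all the arrays. -/
theorem sum_linear_ratio {d i : ℕ} (hd : 1 ≤ d) {θ : ℕ → ℂ}
    (hθ : ∀ h ≤ d, (θ h - θ (d - h)) / (θ 0 - θ d) = (d - 2 * h) / d) (hi : i ≤ d) :
    ∑ h ∈ Finset.range i, (θ h - θ (d - h)) / (θ 0 - θ d) = i * (d - i + 1) / d := by
  have hd' := natCast_pos_ne hd
  induction i with
  | zero => simp
  | succ i ih =>
    rw [Finset.sum_range_succ, ih (by omega), hθ i (by omega)]
    push_cast
    field_simp
    ring

theorem linear_ratio {d h : ℕ} (hd : 1 ≤ d) (hh : h ≤ d) :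
    ((h : ℂ) - ((d - h : ℕ) : ℂ)) / (((0 : ℕ) : ℂ) - d) = (d - 2 * h) / d := by
  have hd' := natCast_pos_ne hd
  rw [Nat.cast_sub hh]
  push_cast
  rw [zero_sub, div_neg, ← neg_div]
  congr 1
  ring

theorem hahnBase_isValid (h : HahnNondeg d m r s) : (hahnBase d m r s).IsValid where
  ev_ne := (hahnBase_nondeg h).ev_ne
  dev_ne := (hahnBase_nondeg h).dev_ne
  fst_ne := (hahnBase_nondeg h).fst_ne
  snd_ne := (hahnBase_nondeg h).snd_ne
  fst_eq i h1 hi := by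
    simp only [hahnBase] at hi ⊢
    have hd := natCast_pos_ne (by omega : 1 ≤ d)
    rw [sum_linear_ratio (by omega : 1 ≤ d)
      (fun h hh => linear_ratio (by omega) hh) hi, Nat.cast_sub h1]
    push_cast
    field_simp
    ring
  snd_eq i h1 hi := by
    simp only [hahnBase] at hi ⊢
    have hd := natCast_pos_ne (by omega : 1 ≤ d)
    rw [sum_linear_ratio (by omega : 1 ≤ d)
      (fun h hh => linear_ratio (by omega) hh) hi, show d - i + 1 = d + 1 - i by omega,
      Nat.cast_sub (by omega)]
    push_cast
    field_simp
    ring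
  ratio_eq := by
    -- Third differences of linear and quadratic sequences vanish, which says `θ_{i-2} - θ_{i+1} = 3
    -- (θ_{i-1} - θ_i)`.
    refine ⟨3, fun i h1 hi => ?_⟩
    have h2 := (hahnBase_nondeg h).dev_ne (i - 1) i (by simp only [hahnBase] at hi ⊢; omega)
      (by omega) (by omega)
    obtain ⟨k, rfl⟩ := Nat.exists_eq_add_of_le' h1
    rw [← sub_ne_zero] at h2
    simp only [hahnBase, show k + 2 - 1 = k + 1 by omega, show k + 2 - 2 = k by omega] at h2 ⊢
    constructor
    · rw [div_eq_iff] <;> push_cast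
      · ring
      · ring_nf; norm_num
    · rw [div_eq_iff h2]
      push_cast
      ring

theorem dualBase_isValid (h : HahnNondeg d m r s) : (dualBase d m r s).IsValid where
  ev_ne := (dualBase_nondeg h).ev_ne
  dev_ne := (dualBase_nondeg h).dev_ne
  fst_ne := (dualBase_nondeg h).fst_ne
  snd_ne := (dualBase_nondeg h).snd_ne
  fst_eq i h1 hi := by
    simp only [dualBase] at hi ⊢
    have hd := natCast_pos_ne (by omega : 1 ≤ d)
    -- Numerator and denominator share the factor `m (d + 1 + s)`; what remains is the ratio of the
    -- linear case.
    have hθ : ∀ h ≤ d, (m * h * (h + 1 + s) - m * ((d - h : ℕ) : ℂ) * (((d - h : ℕ) : ℂ) + 1 + s)) /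
        (m * ((0 : ℕ) : ℂ) * (((0 : ℕ) : ℂ) + 1 + s) - m * d * (d + 1 + s)) =
        (d - 2 * h) / d := fun k hk => by
      have e := (dualBase_nondeg h).ev_ne 0 d (Nat.zero_le _) le_rfl (by omega)
      rw [← sub_ne_zero] at e
      simp only [dualBase] at e
      rw [div_eq_div_iff e hd, Nat.cast_sub hk]
      push_cast
      ring
    rw [sum_linear_ratio (θ := fun h => m * h * (h + 1 + s)) (by omega : 1 ≤ d) hθ hi,
      Nat.cast_sub h1]
    push_cast
    field_simp
    ring
  snd_eq i h1 hi := by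
    simp only [dualBase] at hi ⊢
    have hd := natCast_pos_ne (by omega : 1 ≤ d)
    have hθ : ∀ h ≤ d, (m * h * (h + 1 + s) - m * ((d - h : ℕ) : ℂ) * (((d - h : ℕ) : ℂ) + 1 + s)) /
        (m * ((0 : ℕ) : ℂ) * (((0 : ℕ) : ℂ) + 1 + s) - m * d * (d + 1 + s)) =
        (d - 2 * h) / d := fun k hk => by
      have e := (dualBase_nondeg h).ev_ne 0 d (Nat.zero_le _) le_rfl (by omega)
      rw [← sub_ne_zero] at e
      simp only [dualBase] at e
      rw [div_eq_div_iff e hd, Nat.cast_sub hk]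
      push_cast
      ring
    rw [sum_linear_ratio (θ := fun h => m * h * (h + 1 + s)) (by omega : 1 ≤ d) hθ hi,
      show d - i + 1 = d + 1 - i by omega, Nat.cast_sub (by omega)]
    push_cast
    field_simp
    ring
  ratio_eq := by
    obtain ⟨β, hβ⟩ := (hahnBase_isValid h).ratio_eq
    exact ⟨β, fun i h1 hi => (hβ i h1 hi).symm⟩

/-! ### Closed forms for the Hahn array and its dual -/

theorem hahnBase_prod_low (i : ℕ) : ∏ h ∈ Finset.range i,
    ((hahnBase d m r s).dev i - (hahnBase d m r s).dev h) =
      m ^ i * i.factorial * poch (i + 1 + s) i := by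
  simp only [hahnBase_dev_sub, Finset.prod_mul_distrib, prod_range_sub_cast,
    Finset.prod_const, Finset.card_range]
  congr 1
  exact Finset.prod_congr rfl fun h _ => by ring

theorem hahnBase_prod_high (i : ℕ) : ∏ h ∈ Finset.Icc (i + 1) d,
    ((hahnBase d m r s).dev i - (hahnBase d m r s).dev h) =
      (-m) ^ (d - i) * (d - i).factorial * poch (2 * i + 2 + s) (d - i) := by
  rw [prod_Icc_shift (fun h => (hahnBase d m r s).dev i - (hahnBase d m r s).dev h)]
  trans ∏ t ∈ Finset.range (d - i), ((-m) * ((t : ℂ) + 1) * (2 * i + 2 + s + t))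
  · refine Finset.prod_congr rfl fun t _ => ?_
    rw [hahnBase_dev_sub]
    push_cast
    ring
  · simp only [Finset.prod_mul_distrib, prod_range_add_one_cast, Finset.prod_const,
      Finset.card_range]
    rfl

theorem HahnNondeg.poch_low_ne (h : HahnNondeg d m r s) {i : ℕ} (hi : i ≤ d) :
    poch (i + 1 + s) i ≠ 0 :=
  poch_ne_zero fun k hk => h.s_ne (i + 1 + k) (by omega) (by omega) (by push_cast; ring)

theorem HahnNondeg.poch_high_ne (h : HahnNondeg d m r s) {i : ℕ} :
    poch (2 * i + 2 + s) (d - i) ≠ 0 :=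
  poch_ne_zero fun k hk => h.s_ne (2 * i + 2 + k) (by omega) (by omega) (by push_cast; ring)

theorem hahnBase_b (h : HahnNondeg d m r s) {i : ℕ} (hi : i < d) :
    (hahnBase d m r s).b i =
      (i - d) * (i + 1 + r) * (poch (i + 1 + s) i / poch (i + 2 + s) (i + 1)) := by
  unfold ParamArray.b
  rw [if_pos (by exact hi), hahnBase_prod_low, hahnBase_prod_low]
  have h1 := h.poch_low_ne (i := i + 1) (by omega)
  have h2 : ((i + 1 : ℕ) : ℂ) + 1 + s = i + 2 + s := by push_cast; ring
  rw [h2] at h1 ⊢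
  have h3 := h.1
  have h4 : (i.factorial : ℂ) ≠ 0 := Nat.cast_ne_zero.2 i.factorial_ne_zero
  have h5 : (i : ℂ) + 1 ≠ 0 := Nat.cast_add_one_ne_zero i
  rw [Nat.factorial_succ]
  simp only [hahnBase]
  push_cast
  field_simp
  ring

theorem hahnBase_c (h : HahnNondeg d m r s) {i : ℕ} (hi : i + 1 ≤ d) :
    (hahnBase d m r s).c (i + 1) = -((i + 1) * (i + 1 + s - r) *
      (poch (2 * i + 4 + s) (d - (i + 1)) / poch (2 * i + 2 + s) (d - i))) := by
  rw [ParamArray.c_eq' (by exact hi)]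
  have e1 : (hahnBase d m r s).diam = d := rfl
  rw [e1, hahnBase_prod_high, hahnBase_prod_high]
  have h1 := h.poch_high_ne (i := i)
  have h2 : 2 * ((i + 1 : ℕ) : ℂ) + 2 + s = 2 * i + 4 + s := by push_cast; ring
  rw [h2]
  obtain ⟨n, rfl⟩ := Nat.exists_eq_add_of_le' hi
  have h3 := h.1
  rw [show n + (i + 1) - (i + 1) = n by omega, show n + (i + 1) - i = n + 1 by omega] at *
  have h4 : (n.factorial : ℂ) ≠ 0 := Nat.cast_ne_zero.2 n.factorial_ne_zero
  have h5 : (n : ℂ) + 1 ≠ 0 := Nat.cast_add_one_ne_zero n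
  have h6 : (-m) ^ n ≠ 0 := pow_ne_zero _ (neg_ne_zero.2 h3)
  rw [Nat.factorial_succ, pow_succ]
  simp only [hahnBase]
  push_cast
  generalize (-m) ^ n = M at h6 ⊢
  field_simp
  ring

theorem cancelQuot_of_ne {a b : ℂ} (h : b ≠ 0) : cancelQuot a b = a / b := by
  unfold cancelQuot
  split_ifs with h1
  · rw [h1, div_self h]
  · rfl

theorem cancelQuot_self (a : ℂ) : cancelQuot a a = 1 := if_pos rfl

/-- The quotient of Pochhammer symbols telescopes. At `i = 0` the denominator `s + 1` may vanish;
there numerator and denominator of the bracket agree and the bracket is `1`. -/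
theorem hahnBase_b_eq (h : HahnNondeg d m r s) {i : ℕ} (hi : i ≤ d) :
    (hahnBase d m r s).b i = hahnB d r s 0 i := by
  rcases hi.lt_or_eq with hlt | rfl
  · rw [hahnBase_b h hlt]
    unfold hahnB
    have h1 := h.s_ne (a := 2 * i + s + 2) (2 * i + 2) (by omega) (by omega) (by push_cast; ring)
    rcases Nat.eq_zero_or_pos i with rfl | hpos
    · have e : cancelQuot (((0 : ℕ) : ℂ) + 1 + s + ((0 : ℕ) : ℂ))
          (2 * ((0 : ℕ) : ℂ) + ((0 : ℕ) : ℂ) + s + 1) = 1 := by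
        convert cancelQuot_self (1 + s) using 2 <;> push_cast <;> ring
      rw [e, poch_zero, zero_add, poch_succ, poch_zero]
      push_cast at h1 ⊢
      simp only [mul_zero, zero_add, add_zero] at h1 ⊢
      generalize hA : s + 2 = A at h1 ⊢
      rw [show (2 : ℂ) + s = A by rw [← hA]; ring]
      field_simp
    · have h2 := h.s_ne (a := 2 * i + s + 1) (2 * i + 1) (by omega) (by omega)
        (by push_cast; ring)
      have h3 := h.poch_low_ne (i := i + 1) (by omega)
      have h4 : ((i + 1 : ℕ) : ℂ) + 1 + s = i + 1 + s + 1 := by push_cast; ring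
      rw [h4] at h3
      have h5 : (i : ℂ) + 2 + s = i + 1 + s + 1 := by ring
      have h6 := poch_shift (i + 1 + s) (i + 1)
      rw [poch_succ (i + 1 + s)] at h6
      push_cast at h6 ⊢
      simp only [add_zero]
      rw [cancelQuot_of_ne h2, h5]
      generalize poch (i + 1 + s + 1) (i + 1) = Q at h3 h6 ⊢
      generalize poch (i + 1 + s) i = R at h6 ⊢
      generalize hA : 2 * (i : ℂ) + s + 2 = A at h1 ⊢
      generalize hB : 2 * (i : ℂ) + s + 1 = B at h2 ⊢
      field_simp
      subst hA hB
      linear_combination -((i : ℂ) - d) * (i + 1 + r) * h6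
  · rw [ParamArray.b_eq_zero (by exact le_rfl)]
    simp [hahnB]

/-- Telescoping again. The exceptional index is now `i = d`, where `2d + s + 1` is not covered by
nondegeneracy and the bracket reads `1`. -/
theorem hahnBase_c_eq (h : HahnNondeg d m r s) {i : ℕ} (hi : i ≤ d) :
    (hahnBase d m r s).c i = hahnCc d r s 0 i := by
  cases i with
  | zero => simp [hahnCc, ParamArray.c_zero]
  | succ i =>
    rw [hahnBase_c h hi]
    unfold hahnCc
    have h1 := h.s_ne (a := 2 * (i + 1) + s) (2 * i + 2) (by omega) (by omega) (by push_cast; ring)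
    have h3 := h.poch_high_ne (i := i)
    rcases hi.lt_or_eq with hlt | rfl
    · have h2 := h.s_ne (a := 2 * (i + 1) + s + 1) (2 * i + 3) (by omega) (by omega)
        (by push_cast; ring)
      push_cast
      simp only [add_zero]
      rw [cancelQuot_of_ne h2]
      obtain ⟨n, rfl⟩ := Nat.exists_eq_add_of_le' hi
      rw [show n + (i + 1) - (i + 1) = n by omega]
      rw [show n + (i + 1) - i = n + 1 by omega] at h3 ⊢
      have h4 := poch_shift (2 * i + 2 + s + 1) n
      have h5 := poch_succ' (2 * i + 2 + s) n
      rw [show 2 * (i : ℂ) + 2 + s + 1 + 1 = 2 * i + 4 + s by ring] at h4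
      push_cast
      generalize poch (2 * i + 2 + s) (n + 1) = Q at h3 h5 ⊢
      generalize poch (2 * i + 2 + s + 1) n = R at h4 h5
      generalize poch (2 * i + 4 + s) n = T at h4 ⊢
      generalize hA : 2 * ((i : ℂ) + 1) + s = A at h1 h2 ⊢
      generalize hB : A + 1 = B at h2 ⊢
      field_simp
      subst hB hA
      linear_combination -(i + 1 + s - r) * (2 * i + 2 + s) * h4 +
        (i + 1 + s - r) * (n + 2 * i + 3 + s) * h5
    · push_cast
      simp only [add_zero]
      have e : cancelQuot ((i : ℂ) + 1 + 1 + s + (i + 1)) (2 * (i + 1) + s + 1) = 1 := by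
        convert cancelQuot_self (2 * (i + 1) + s + 1) using 2; ring
      rw [e, Nat.sub_self, poch_zero, show i + 1 - i = 0 + 1 by omega, poch_succ, poch_zero]
      rw [show 2 * ((i : ℂ) + 1) + s = 2 * i + 2 + s by ring] at h1 ⊢
      push_cast
      rw [add_zero, one_mul]
      generalize 2 * (i : ℂ) + 2 + s = A at h1 ⊢
      field_simp

/-- A partial fraction identity in `2i + s`, `2i + s + 1` and `2i + s + 2`. The ends `i = 0` and `i
= d` are separate because the middle denominator may vanish there. -/
theorem hahnBase_a_eq (h : HahnNondeg d m r s) {i : ℕ} (hi : i ≤ d) :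
    (hahnBase d m r s).a i = hahnA d r s 0 i := by
  have hm := h.1
  have e1 : (if 1 ≤ i then (hahnBase d m r s).fst i /
      ((hahnBase d m r s).dev i - (hahnBase d m r s).dev (i - 1)) else 0) =
      i * (i - d - 1) * (i + r) / (2 * i + s) := by
    split_ifs with h1
    · rw [hahnBase_dev_sub, Nat.cast_sub h1]
      have h2 := h.s_ne (a := 2 * i + s) (2 * i) (by omega) (by omega) (by push_cast; ring)
      simp only [hahnBase]
      push_cast
      rw [show (i : ℂ) + (i - 1) + 1 + s = 2 * i + s by ring]
      field_simp
      ring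
    · rw [show i = 0 by omega]
      simp
  have e2 : (if i < (hahnBase d m r s).diam then (hahnBase d m r s).fst (i + 1) /
      ((hahnBase d m r s).dev i - (hahnBase d m r s).dev (i + 1)) else 0) =
      -((i + 1) * (i - d) * (i + 1 + r) / (2 * i + s + 2)) := by
    split_ifs with h1
    · have h1 : i < d := h1
      rw [hahnBase_dev_sub]
      have h2 := h.s_ne (a := 2 * i + s + 2) (2 * i + 2) (by omega) (by omega) (by push_cast; ring)
      simp only [hahnBase]
      push_cast
      rw [show (i : ℂ) + (i + 1) + 1 + s = 2 * i + s + 2 by ring]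
      field_simp
      ring
    · have h1 : ¬ i < d := h1
      rw [show i = d by omega]
      simp
  unfold ParamArray.a
  rw [e1, e2]
  unfold hahnA hahnB hahnCc
  simp only [hahnBase, Nat.cast_zero, add_zero]
  rcases Nat.eq_zero_or_pos i with rfl | hpos
  · simp only [Nat.cast_zero, mul_zero, zero_mul, zero_add, zero_div, neg_zero, sub_zero]
    rw [show cancelQuot (1 + s) (s + 1) = 1 by rw [add_comm 1 s]; exact cancelQuot_self _]
    ring
  · have h2 := h.s_ne (a := 2 * i + s) (2 * i) (by omega) (by omega) (by push_cast; ring)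
    rcases hi.lt_or_eq with hlt | rfl
    · have h3 := h.s_ne (a := 2 * i + s + 1) (2 * i + 1) (by omega) (by omega) (by push_cast; ring)
      have h4 := h.s_ne (a := 2 * i + s + 2) (2 * i + 2) (by omega) (by omega) (by push_cast; ring)
      rw [cancelQuot_of_ne h3, cancelQuot_of_ne h3]
      generalize hA : 2 * (i : ℂ) + s = A at h2 h3 h4 ⊢
      generalize hB : A + 1 = B at h3 ⊢
      generalize hC : A + 2 = C at h4 ⊢
      field_simp
      subst hB hC hA
      ring
    · rw [show (i : ℂ) + 1 + s + i = 2 * i + s + 1 by ring, cancelQuot_self]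
      simp only [sub_self, zero_mul, mul_zero, zero_div, neg_zero, zero_sub, neg_neg]
      generalize hA : 2 * (i : ℂ) + s = A at h2 ⊢
      field_simp
      subst hA
      ring

theorem dualBase_prod_low (i : ℕ) : ∏ h ∈ Finset.range i,
    ((dualBase d m r s).dev i - (dualBase d m r s).dev h) = i.factorial :=
  prod_range_sub_cast i

theorem dualBase_prod_high (i : ℕ) : ∏ h ∈ Finset.Icc (i + 1) d,
    ((dualBase d m r s).dev i - (dualBase d m r s).dev h) = (-1) ^ (d - i) * (d - i).factorial := by
  rw [prod_Icc_shift (fun h => (dualBase d m r s).dev i - (dualBase d m r s).dev h)]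
  trans ∏ t ∈ Finset.range (d - i), ((-1) * ((t : ℂ) + 1))
  · refine Finset.prod_congr rfl fun t _ => ?_
    simp only [dualBase]
    push_cast
    ring
  · simp only [Finset.prod_mul_distrib, prod_range_add_one_cast, Finset.prod_const,
      Finset.card_range]

theorem dualBase_b {i : ℕ} (hi : i ≤ d) :
    (dualBase d m r s).b i = m * (i - d) * (i + 1 + r) := by
  rcases hi.lt_or_eq with hlt | rfl
  · unfold ParamArray.b
    rw [if_pos (by exact hlt), dualBase_prod_low, dualBase_prod_low, Nat.factorial_succ]
    have h4 : (i.factorial : ℂ) ≠ 0 := Nat.cast_ne_zero.2 i.factorial_ne_zero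
    have h5 : (i : ℂ) + 1 ≠ 0 := Nat.cast_add_one_ne_zero i
    simp only [dualBase]
    push_cast
    field_simp
    ring
  · rw [ParamArray.b_eq_zero (by exact le_rfl)]
    simp

theorem dualBase_c {i : ℕ} (hi : i ≤ d) :
    (dualBase d m r s).c i = m * i * (i - d - 1 + r - s) := by
  cases i with
  | zero => simp [ParamArray.c_zero]
  | succ i =>
    rw [ParamArray.c_eq' (by exact hi)]
    have e1 : (dualBase d m r s).diam = d := rfl
    rw [e1, dualBase_prod_high, dualBase_prod_high]
    obtain ⟨n, rfl⟩ := Nat.exists_eq_add_of_le' hi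
    rw [show n + (i + 1) - (i + 1) = n by omega, show n + (i + 1) - i = n + 1 by omega] at *
    have h4 : (n.factorial : ℂ) ≠ 0 := Nat.cast_ne_zero.2 n.factorial_ne_zero
    have h5 : (n : ℂ) + 1 ≠ 0 := Nat.cast_add_one_ne_zero n
    rw [Nat.factorial_succ, pow_succ]
    simp only [dualBase]
    push_cast
    field_simp
    ring

theorem dualBase_a {i : ℕ} (hi : i ≤ d) :
    (dualBase d m r s).a i = -(dualBase d m r s).b i - (dualBase d m r s).c i := by
  rw [dualBase_b hi, dualBase_c hi]
  have e1 : (if 1 ≤ i then (dualBase d m r s).fst i /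
      ((dualBase d m r s).dev i - (dualBase d m r s).dev (i - 1)) else 0) =
      m * i * (i - d - 1) * (i + r) := by
    split_ifs with h1
    · simp only [dualBase]
      rw [Nat.cast_sub h1]
      push_cast
      rw [sub_sub_cancel, div_one]
    · rw [show i = 0 by omega]
      simp
  have e2 : (if i < (dualBase d m r s).diam then (dualBase d m r s).fst (i + 1) /
      ((dualBase d m r s).dev i - (dualBase d m r s).dev (i + 1)) else 0) =
      -(m * (i + 1) * (i - d) * (i + 1 + r)) := by
    split_ifs with h1
    · simp only [dualBase]
      push_cast
      rw [show (i : ℂ) - (i + 1) = -1 by ring]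
      ring
    · have h1 : ¬ i < d := h1
      rw [show i = d by omega]
      simp
  unfold ParamArray.a
  rw [e1, e2]
  simp only [dualBase]
  ring

end Base

/-! ### The three-term recurrences of Hahn and dual Hahn polynomials -/

/-- Expand both sides in the Newton basis `τ_k = ∏_{j<k} (λ - θ_j)/φ_{j+1}`. With `a_i = θ_0 - b_i -
c_i` the constant terms cancel, and `hcoef` is the equality of the coefficients of `τ_{l+1}`. -/
theorem ParamArray.Nondeg.rec_of_coeff {Φ : ParamArray} (h : Φ.Nondeg)
    (ha : ∀ i ≤ Φ.diam, Φ.a i = Φ.ev 0 - Φ.b i - Φ.c i)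
    (hcoef : ∀ i l, i ≤ Φ.diam → l < Φ.diam →
      (Φ.ev (l + 1) - Φ.ev 0) * ∏ j ∈ Finset.range (l + 1), (Φ.dev i - Φ.dev j) +
        Φ.fst (l + 1) * ∏ j ∈ Finset.range l, (Φ.dev i - Φ.dev j) =
      Φ.c i * (∏ j ∈ Finset.range (l + 1), (Φ.dev (i - 1) - Φ.dev j) -
        ∏ j ∈ Finset.range (l + 1), (Φ.dev i - Φ.dev j)) +
      Φ.b i * (∏ j ∈ Finset.range (l + 1), (Φ.dev (i + 1) - Φ.dev j) -
        ∏ j ∈ Finset.range (l + 1), (Φ.dev i - Φ.dev j))) : Φ.Rec := by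
  intro i x hi hx
  have hsplit : ∀ n ≤ Φ.diam, Φ.u n (Φ.ev x) = ∑ k ∈ Finset.range (Φ.diam + 1),
      (∏ j ∈ Finset.range k, (Φ.ev x - Φ.ev j) / Φ.fst (j + 1)) *
        ∏ j ∈ Finset.range k, (Φ.dev n - Φ.dev j) := fun n hn => by
    rw [u_eq_sum_range hn]
    refine Finset.sum_congr rfl fun k _ => ?_
    rw [← Finset.prod_mul_distrib]
    exact Finset.prod_congr rfl fun j _ => by ring
  have hb : Φ.b i * Φ.u (i + 1) (Φ.ev x) = Φ.b i * ∑ k ∈ Finset.range (Φ.diam + 1),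
      (∏ j ∈ Finset.range k, (Φ.ev x - Φ.ev j) / Φ.fst (j + 1)) *
        ∏ j ∈ Finset.range k, (Φ.dev (i + 1) - Φ.dev j) := by
    rcases hi.lt_or_eq with h1 | h1
    · rw [hsplit _ h1]
    · rw [b_eq_zero h1.ge, zero_mul, zero_mul]
  -- Multiplication by `λ - θ_k` raises the Newton basis by one step, with the factor `φ_{k+1}`.
  have hτ : ∀ k ∈ Finset.range Φ.diam,
      (Φ.ev x - Φ.ev k) * ∏ j ∈ Finset.range k, (Φ.ev x - Φ.ev j) / Φ.fst (j + 1) =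
      Φ.fst (k + 1) * ∏ j ∈ Finset.range (k + 1), (Φ.ev x - Φ.ev j) / Φ.fst (j + 1) := by
    intro k hk
    rw [Finset.mem_range] at hk
    have := h.fst_ne (k + 1) (by omega) (by omega)
    rw [Finset.prod_range_succ]
    field_simp
  -- The overflow at the top is the product of all `λ - θ_j`, up to a constant; it vanishes at
  -- eigenvalues, which is why the recurrence is claimed only there.
  have hlast : (Φ.ev x - Φ.ev Φ.diam) *
      ∏ j ∈ Finset.range Φ.diam, (Φ.ev x - Φ.ev j) / Φ.fst (j + 1) = 0 := by
    rcases hx.lt_or_eq with h1 | h1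
    · rw [Finset.prod_eq_zero (Finset.mem_range.2 h1) (by rw [sub_self, zero_div]), mul_zero]
    · rw [h1, sub_self, zero_mul]
  have key : (Φ.ev x - Φ.ev 0) * Φ.u i (Φ.ev x) =
      Φ.c i * (Φ.u (i - 1) (Φ.ev x) - Φ.u i (Φ.ev x)) +
        (Φ.b i * Φ.u (i + 1) (Φ.ev x) - Φ.b i * Φ.u i (Φ.ev x)) := by
    rw [hb, hsplit i hi, hsplit (i - 1) (by omega), ← Finset.sum_sub_distrib, ← mul_sub,
      ← Finset.sum_sub_distrib, Finset.mul_sum, Finset.mul_sum, Finset.mul_sum,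
      ← Finset.sum_add_distrib]
    trans ∑ k ∈ Finset.range (Φ.diam + 1), ((Φ.ev k - Φ.ev 0) *
        ((∏ j ∈ Finset.range k, (Φ.ev x - Φ.ev j) / Φ.fst (j + 1)) *
          ∏ j ∈ Finset.range k, (Φ.dev i - Φ.dev j))) +
      ∑ k ∈ Finset.range (Φ.diam + 1), ((Φ.ev x - Φ.ev k) *
        (∏ j ∈ Finset.range k, (Φ.ev x - Φ.ev j) / Φ.fst (j + 1))) *
          ∏ j ∈ Finset.range k, (Φ.dev i - Φ.dev j)
    · rw [← Finset.sum_add_distrib]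
      exact Finset.sum_congr rfl fun k _ => by ring
    rw [Finset.sum_range_succ', Finset.sum_range_succ _ Φ.diam, hlast,
      Finset.sum_range_succ' _ Φ.diam]
    simp only [sub_self, zero_mul, add_zero, Finset.range_zero, Finset.prod_empty, mul_zero,
      ← Finset.sum_add_distrib]
    refine Finset.sum_congr rfl fun k hk => ?_
    rw [hτ k hk]
    linear_combination (∏ j ∈ Finset.range (k + 1), (Φ.ev x - Φ.ev j) / Φ.fst (j + 1)) *
      hcoef i k hi (Finset.mem_range.1 hk)
  rw [ha i hi]
  linear_combination key

/-- The product `∏_{j<k} (i - j) (i + j + 1 + s)`. -/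
noncomputable def quadFact (s i : ℂ) (k : ℕ) : ℂ :=
  ∏ j ∈ Finset.range k, ((i - j) * (i + j + 1 + s))

section QuadFact

variable (s i : ℂ) (k : ℕ)

theorem quadFact_zero : quadFact s i 0 = 1 := by simp [quadFact]

theorem quadFact_succ :
    quadFact s i (k + 1) = quadFact s i k * ((i - k) * (i + k + 1 + s)) :=
  Finset.prod_range_succ _ _

/-- The factors `i + j + 1 + s` move up by one when `s` does, so one end factor is traded for the
other. With the next lemma this carries both the recurrence and the contiguity relations. -/
theorem quadFact_shift : (i + 1 + s) * quadFact (s + 1) i k = (i + k + 1 + s) * quadFact s i k := by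
  induction k with
  | zero => simp [quadFact_zero]
  | succ k ih =>
    rw [quadFact_succ, quadFact_succ]
    push_cast
    linear_combination (i - k) * (i + k + 2 + s) * ih

theorem quadFact_pred : i * quadFact (s + 1) (i - 1) k = (i - k) * quadFact s i k := by
  induction k with
  | zero => simp [quadFact_zero]
  | succ k ih =>
    rw [quadFact_succ, quadFact_succ]
    push_cast
    linear_combination (i - 1 - k) * (i + k + 1 + s) * ih

/-- Differencing a factorial power on a quadratic lattice lowers its order by one and shifts `s` to
`s + 1`. -/
theorem quadFact_add_one_sub :
    quadFact s (i + 1) (k + 1) - quadFact s i (k + 1) =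
      (k + 1) * (2 * i + 2 + s) * quadFact (s + 1) i k := by
  rw [quadFact_succ, quadFact_succ]
  have h1 := quadFact_shift s i k
  have h2 := quadFact_pred s (i + 1) k
  rw [add_sub_cancel_right] at h2
  linear_combination (i - k) * h1 - (i + k + 2 + s) * h2

theorem quadFact_sub_sub_one :
    quadFact s i (k + 1) - quadFact s (i - 1) (k + 1) =
      (k + 1) * (2 * i + s) * quadFact (s + 1) (i - 1) k := by
  have h := quadFact_add_one_sub s (i - 1) k
  rw [sub_add_cancel] at h
  linear_combination h

end QuadFact

section Base

variable {d : ℕ} {m r s : ℂ}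

theorem hahnBase_prod_dev (i k : ℕ) : ∏ j ∈ Finset.range k,
    ((hahnBase d m r s).dev i - (hahnBase d m r s).dev j) = m ^ k * quadFact s i k := by
  simp only [hahnBase_dev_sub, quadFact]
  rw [← Finset.card_range k, ← Finset.prod_const, Finset.card_range, ← Finset.prod_mul_distrib]
  exact Finset.prod_congr rfl fun j _ => by ring

theorem quadFact_zero_left (s : ℂ) (k : ℕ) : (k : ℂ) * quadFact s 0 k = 0 := by
  cases k with
  | zero => simp
  | succ k => rw [quadFact, Finset.prod_range_succ']; simp

theorem quadFact_zero_left' (s s' : ℂ) (k : ℕ) : quadFact s 0 k = quadFact s' 0 k := by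
  cases k with
  | zero => simp [quadFact]
  | succ k => rw [quadFact, quadFact, Finset.prod_range_succ', Finset.prod_range_succ']; simp

/-- The coefficient identity behind the recurrence, after the difference formulas have removed the
common factor `m^{l+1} (l+1)`. Both shifted factorials reduce to `quadFact s i l`, and a rational
identity is left. -/
theorem hahnBase_coeff (h : HahnNondeg d m r s) {i l : ℕ} (hi : i ≤ d) (hl : l < d) :
    (hahnBase d m r s).b i * ((2 * i + 2 + s) * quadFact (s + 1) i l) -
      (hahnBase d m r s).c i * ((2 * i + s) * quadFact (s + 1) (i - 1) l) =
    quadFact s i l * ((i - l) * (i + l + 1 + s) + (l - d) * (l + 1 + r)) := by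
  rw [hahnBase_b_eq h hi, hahnBase_c_eq h hi]
  unfold hahnB hahnCc
  have h1 := quadFact_shift s i l
  have h2 := quadFact_pred s i l
  simp only [Nat.cast_zero, add_zero]
  rcases Nat.eq_zero_or_pos i with rfl | hpos
  · have h3 := h.s_ne (a := s + 2) 2 (by omega) (by omega) (by push_cast; ring)
    have h4 := quadFact_zero_left s l
    simp only [Nat.cast_zero, mul_zero, zero_mul, zero_add, zero_div, neg_zero, sub_zero] at *
    rw [show cancelQuot (1 + s) (s + 1) = 1 by rw [add_comm 1 s]; exact cancelQuot_self _,
      quadFact_zero_left' (s + 1) s, add_comm 2 s]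
    field_simp
    linear_combination (s - r + d) * h4
  · have h2' := h.s_ne (a := 2 * i + s) (2 * i) (by omega) (by omega) (by push_cast; ring)
    generalize quadFact (s + 1) (i - 1) l = g' at h2 ⊢
    generalize quadFact (s + 1) i l = g at h1 ⊢
    rcases hi.lt_or_eq with hlt | rfl
    · have h3 := h.s_ne (a := 2 * i + s + 1) (2 * i + 1) (by omega) (by omega) (by push_cast; ring)
      have h4 := h.s_ne (a := 2 * i + s + 2) (2 * i + 2) (by omega) (by omega) (by push_cast; ring)
      rw [cancelQuot_of_ne h3, cancelQuot_of_ne h3]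
      rw [show (2 * (i : ℂ) + 2 + s) = 2 * i + s + 2 by ring]
      generalize hA : 2 * (i : ℂ) + s = A at h2' h3 h4 ⊢
      generalize hB : A + 1 = B at h3 ⊢
      generalize hC : A + 2 = C at h4 ⊢
      field_simp
      subst hB hC hA
      linear_combination (i - d) * (i + 1 + r) * h1 + (i + s - r) * (i + 1 + s + d) * h2
    · rw [show (i : ℂ) + 1 + s + i = 2 * i + s + 1 by ring, cancelQuot_self]
      simp only [sub_self, zero_mul, zero_div, zero_sub]
      generalize hA : 2 * (i : ℂ) + s = A at h2' ⊢
      field_simp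
      subst hA
      linear_combination (i + s - r) * h2

theorem hahnBase_rec (h : HahnNondeg d m r s) : (hahnBase d m r s).Rec := by
  refine (hahnBase_nondeg h).rec_of_coeff (fun i hi => ?_) fun i l hi hl => ?_
  · rw [hahnBase_a_eq h hi, hahnBase_b_eq h hi, hahnBase_c_eq h hi]
    simp [hahnA, hahnBase]
  · replace hi : i ≤ d := hi
    replace hl : l < d := hl
    have hc := hahnBase_coeff h hi hl
    simp only [hahnBase_prod_dev]
    -- At `i = 0` the truncated `i - 1` disagrees with the complex one, but `c_0 = 0`.
    have e : (hahnBase d m r s).c i * (m ^ (l + 1) * quadFact s ((i - 1 : ℕ) : ℂ) (l + 1)) =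
        (hahnBase d m r s).c i * (m ^ (l + 1) * quadFact s ((i : ℂ) - 1) (l + 1)) := by
      cases i with
      | zero => rw [ParamArray.c_zero, zero_mul, zero_mul]
      | succ i => rw [Nat.add_sub_cancel, Nat.cast_succ, add_sub_cancel_right]
    have h1 := quadFact_add_one_sub s i l
    have h2 := quadFact_sub_sub_one s i l
    have h3 := quadFact_succ s i l
    rw [mul_sub, e]
    simp only [show (hahnBase d m r s).ev = fun x : ℕ => (x : ℂ) from rfl,
      show (hahnBase d m r s).fst = fun x : ℕ => m * x * (x - d - 1) * (x + r) from rfl]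
    push_cast
    linear_combination m ^ (l + 1) * (-(hahnBase d m r s).b i * h1 +
      (hahnBase d m r s).c i * h2 - (l + 1) * hc + (l + 1) * h3)

theorem descProd_succ (i : ℂ) (k : ℕ) : ∏ j ∈ Finset.range (k + 1), (i - j) =
    (∏ j ∈ Finset.range k, (i - j)) * (i - k) :=
  Finset.prod_range_succ _ _

theorem descProd_pred (i : ℂ) (k : ℕ) : i * ∏ j ∈ Finset.range k, (i - 1 - j) =
    (∏ j ∈ Finset.range k, (i - j)) * (i - k) := by
  induction k with
  | zero => simp
  | succ k ih =>
    rw [Finset.prod_range_succ, Finset.prod_range_succ]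
    push_cast
    linear_combination (i - 1 - k) * ih

theorem descProd_add_one (i : ℂ) (k : ℕ) : ∏ j ∈ Finset.range (k + 1), (i + 1 - j) =
    (i + 1) * ∏ j ∈ Finset.range k, (i - j) := by
  have h := descProd_pred (i + 1) k
  rw [descProd_succ, ← h, add_sub_cancel_right]

theorem dualBase_rec (h : HahnNondeg d m r s) : (dualBase d m r s).Rec := by
  refine (dualBase_nondeg h).rec_of_coeff (fun i hi => ?_) fun i l hi hl => ?_
  · rw [dualBase_a (by exact hi)]
    simp [dualBase]
  · replace hi : i ≤ d := hi
    rw [dualBase_b hi, dualBase_c hi]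
    have e : (i : ℂ) * ∏ j ∈ Finset.range (l + 1), (((i - 1 : ℕ) : ℂ) - j) =
        i * ∏ j ∈ Finset.range (l + 1), ((i : ℂ) - 1 - j) := by
      cases i with
      | zero => simp
      | succ i => rw [Nat.add_sub_cancel, Nat.cast_succ, add_sub_cancel_right]
    have h1 := descProd_pred (i : ℂ) (l + 1)
    have h2 := descProd_add_one (i : ℂ) l
    have h3 := descProd_succ (i : ℂ) l
    simp only [show (dualBase d m r s).dev = fun x : ℕ => (x : ℂ) from rfl,
      show (dualBase d m r s).ev = fun x : ℕ => m * x * (x + 1 + s) from rfl,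
      show (dualBase d m r s).fst = fun x : ℕ => m * x * (x - d - 1) * (x + r) from rfl]
    push_cast at h1 h2 h3 e ⊢
    rw [h3] at h1 ⊢
    rw [h2]
    generalize ∏ j ∈ Finset.range l, ((i : ℂ) - j) = E at *
    generalize ∏ j ∈ Finset.range (l + 1), ((i : ℂ) - 1 - j) = E' at *
    generalize ∏ j ∈ Finset.range (l + 1), (((i - 1 : ℕ) : ℂ) - j) = E'' at *
    linear_combination -m * (i - d - 1 + r - s) * (e + h1)

/-- The dual recurrence is the recurrence of the dual Hahn array, carried over by agreement. -/
theorem hahnBase_good (h : HahnNondeg d m r s) : (hahnBase d m r s).Good where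
  toNondeg := hahnBase_nondeg h
  recur := hahnBase_rec h
  recur_star := (dualBase_rec h).congr (hahnBase_star_agree d m r s).symm

theorem dualBase_star_agree (d : ℕ) (m r s : ℂ) :
    (dualBase d m r s).star.Agree (hahnBase d m r s) where
  diam := rfl
  ev _ _ := rfl
  dev _ _ := rfl
  fst _ _ _ := rfl
  snd i h1 h2 := by
    simp only [ParamArray.star, hahnBase, dualBase] at h2 ⊢
    rw [Nat.cast_sub (by omega)]
    push_cast
    ring

theorem dualBase_good (h : HahnNondeg d m r s) : (dualBase d m r s).Good where
  toNondeg := dualBase_nondeg h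
  recur := dualBase_rec h
  recur_star := (hahnBase_rec h).congr (dualBase_star_agree d m r s).symm

end Base

theorem hahn_goodFamilies {N : ℕ} {m r s μ ρ σ : ℂ} (h : HahnNondeg N m r s)
    (h' : HahnNondeg N μ ρ σ) :
    GoodFamilies N (hahnArray N m r s) (dualHahnArray N μ ρ σ) where
  diamΦ _ _ := rfl
  goodΦ _ hj := hahnArray_eq hj m r s ▸ hahnBase_good (h.shift hj)
  diamΨ _ _ := rfl
  goodΨ _ hx := dualHahnArray_eq hx μ ρ σ ▸ dualBase_good (h'.shift hx)
  ev_eq _ _ _ := rfl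
  dev_eq _ _ _ := rfl

/-! ### Closed forms of `k_i` and `ν`, and their behaviour under `(d + 1, s) → (d, s + 1)` -/

/-- Closed form of `k_i` for the Hahn array of diameter `d`. -/
noncomputable def hahnK (d : ℕ) (r s : ℂ) (i : ℕ) : ℂ :=
  (d.choose i : ℂ) * poch (r + 1) i * poch (s + 2) d /
    (poch (s - r + 1) i * poch (i + 1 + s) i * poch (2 * i + 2 + s) (d - i))

/-- Closed form of `k_i` for the dual Hahn array of diameter `d`. -/
noncomputable def dualK (d : ℕ) (r s : ℂ) (i : ℕ) : ℂ :=
  (-1) ^ i * (d.choose i : ℂ) * poch (r + 1) i / poch (r - s - d) i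

section Base

variable {d : ℕ} {m r s : ℂ}

theorem HahnNondeg.poch_sr_ne (h : HahnNondeg d m r s) {i : ℕ} (hi : i ≤ d) :
    poch (s - r + 1) i ≠ 0 :=
  poch_ne_zero fun k hk => h.sr_ne (k + 1) (by omega) (by omega) (by push_cast; ring)

theorem HahnNondeg.poch_s_ne (h : HahnNondeg d m r s) {i : ℕ} (hi : i ≤ d) :
    poch (s + 2) i ≠ 0 :=
  poch_ne_zero fun k hk => h.s_ne (k + 2) (by omega) (by omega) (by push_cast; ring)

theorem HahnNondeg.poch_rs_ne (h : HahnNondeg d m r s) {i : ℕ} (hi : i ≤ d) :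
    poch (r - s - d) i ≠ 0 :=
  poch_ne_zero fun k hk => by
    have := h.sr_ne (a := s - r + ((d - k : ℕ) : ℂ)) (d - k) (by omega) (by omega) rfl
    rw [Nat.cast_sub (by omega)] at this
    intro h0
    exact this (by linear_combination -h0)

theorem cast_choose_succ {d i : ℕ} (hi : i ≤ d) :
    (d.choose (i + 1) : ℂ) * (i + 1) = d.choose i * (d - i) := by
  have := Nat.choose_succ_right_eq d i
  have h := congrArg (Nat.cast (R := ℂ)) this
  push_cast [Nat.cast_sub hi] at h
  exact h

/-- Induction through detailed balance; the quotient `b_i / c_{i+1}` supplies the step. -/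
theorem hahnBase_k (h : HahnNondeg d m r s) {i : ℕ} (hi : i ≤ d) :
    (hahnBase d m r s).k i = hahnK d r s i := by
  induction i with
  | zero =>
    rw [(hahnBase_nondeg h).k_zero]
    have h1 := h.poch_s_ne le_rfl
    simp [hahnK, poch_zero, add_comm 2 s, div_self h1]
  | succ i ih =>
    have hb := (hahnBase_nondeg h).k_mul_b (i := i) (by exact hi)
    rw [ih (by omega)] at hb
    refine mul_right_cancel₀ ((hahnBase_nondeg h).c_ne (i := i + 1) (by omega) (by exact hi)) ?_
    rw [← hb, hahnBase_b h hi, hahnBase_c h hi]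
    unfold hahnK
    have h1 := h.poch_sr_ne (i := i) (by omega)
    have h2 := h.poch_sr_ne (i := i + 1) (by omega)
    have h3 := h.poch_low_ne (i := i) (by omega)
    have h4 := h.poch_low_ne (i := i + 1) (by omega)
    have h5 := h.poch_high_ne (i := i)
    have h6 := h.poch_high_ne (i := i + 1)
    have h7 := cast_choose_succ (d := d) (i := i) (by omega)
    rw [poch_succ (s - r + 1)] at h2 ⊢
    rw [poch_succ (r + 1)]
    push_cast at *
    rw [show (i : ℂ) + 1 + 1 + s = i + 2 + s by ring] at *
    rw [show 2 * ((i : ℂ) + 1) + 2 + s = 2 * i + 4 + s by ring] at *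
    have h8 : s - r + 1 + i ≠ 0 := right_ne_zero_of_mul h2
    rw [show (i : ℂ) + 1 + s - r = s - r + 1 + i by ring]
    generalize poch (s - r + 1) i = a1 at *
    generalize poch (i + 2 + s) (i + 1) = a2 at *
    generalize poch (2 * i + 4 + s) (d - (i + 1)) = a3 at *
    generalize poch (2 * i + 2 + s) (d - i) = a4 at *
    generalize poch (i + 1 + s) i = a5 at *
    generalize s - r + 1 + i = a6 at *
    field_simp
    linear_combination poch (r + 1) i * poch (s + 2) d * (r + 1 + i) * h7

theorem dualBase_k (h : HahnNondeg d m r s) {i : ℕ} (hi : i ≤ d) :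
    (dualBase d m r s).k i = dualK d r s i := by
  induction i with
  | zero =>
    rw [(dualBase_nondeg h).k_zero]
    simp [dualK, poch_zero]
  | succ i ih =>
    have hb := (dualBase_nondeg h).k_mul_b (i := i) (by exact hi)
    rw [ih (by omega)] at hb
    refine mul_right_cancel₀ ((dualBase_nondeg h).c_ne (i := i + 1) (by omega) (by exact hi)) ?_
    rw [← hb, dualBase_b (by omega), dualBase_c hi]
    unfold dualK
    have h1 := h.poch_rs_ne (i := i) (by omega)
    have h2 := h.poch_rs_ne (i := i + 1) (by omega)
    have h7 := cast_choose_succ (d := d) (i := i) (by omega)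
    rw [poch_succ (r - s - d)] at h2 ⊢
    rw [poch_succ (r + 1), pow_succ]
    have h8 : r - s - d + i ≠ 0 := right_ne_zero_of_mul h2
    push_cast
    rw [show (i : ℂ) + 1 - d - 1 + r - s = r - s - d + i by ring]
    generalize poch (r - s - d) i = a1 at *
    generalize r - s - d + i = a6 at *
    field_simp
    linear_combination poch (r + 1) i * m * (r + 1 + i) * h7

theorem hahnBase_nu (h : HahnNondeg d m r s) :
    (hahnBase d m r s).nu = poch (s + 2) d / poch (s - r + 1) d := by
  unfold ParamArray.nu poch
  rw [ParamArray.prod_Icc_one, Finset.prod_div_distrib, Finset.prod_mul_distrib]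
  have hm := h.1
  have e1 : ∏ k ∈ Finset.range d, ((hahnBase d m r s).ev 0 - (hahnBase d m r s).ev (k + 1)) =
      ∏ k ∈ Finset.range d, ((k : ℂ) - d) := by
    rw [← Finset.prod_range_reflect]
    refine Finset.prod_congr rfl fun k hk => ?_
    rw [Finset.mem_range] at hk
    simp only [hahnBase]
    rw [show d - 1 - k + 1 = d - k by omega, Nat.cast_sub (by omega)]
    push_cast
    ring
  have e2 : ∏ k ∈ Finset.range d, ((k : ℂ) - d) ≠ 0 := Finset.prod_ne_zero_iff.2 fun k hk =>
    natCast_sub_natCast_ne (by rw [Finset.mem_range] at hk; omega)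
  rw [show (hahnBase d m r s).diam = d from rfl, e1, ← Finset.prod_div_distrib, ← Finset.prod_mul_distrib, ← Finset.prod_div_distrib]
  refine Finset.prod_congr rfl fun k hk => ?_
  rw [Finset.mem_range] at hk
  have h1 := h.sr_ne (a := s - r + 1 + k) (k + 1) (by omega) (by omega) (by push_cast; ring)
  have h2 := natCast_sub_natCast_ne (i := k) (j := d) (by omega)
  have h3 : (k : ℂ) + 1 ≠ 0 := Nat.cast_add_one_ne_zero k
  simp only [hahnBase]
  push_cast
  rw [show (k : ℂ) + 1 - d - 1 = k - d by ring, show (k : ℂ) + 1 + s - r = s - r + 1 + k by ring]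
  generalize (k : ℂ) - d = a1 at *
  generalize hA : s - r + 1 + (k : ℂ) = a2 at *
  field_simp
  ring

theorem dualBase_nu (h : HahnNondeg d m r s) :
    (dualBase d m r s).nu = poch (s + 2) d / poch (s - r + 1) d := by
  rw [← (hahnBase_star_agree d m r s).nu_eq, ParamArray.nu_star, hahnBase_nu h]

/-- Consecutive Pochhammer symbols differ by their end factors. The empty product at `i = 0` matches
the bracket convention. -/
theorem poch_low_div (h : HahnNondeg d m r s) {i : ℕ} (hi : i < d) :
    poch (i + 1 + s) i / poch (i + 2 + s) i = cancelQuot (i + 1 + s) (2 * i + s + 1) := by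
  rcases Nat.eq_zero_or_pos i with rfl | hpos
  · rw [poch_zero, poch_zero, div_one]
    convert (cancelQuot_self (1 + s)).symm using 2 <;> push_cast <;> ring
  · have h1 := h.s_ne (a := 2 * i + s + 1) (2 * i + 1) (by omega) (by omega) (by push_cast; ring)
    have h2 : poch (i + 2 + s) i ≠ 0 := poch_ne_zero fun k hk =>
      h.s_ne (i + 2 + k) (by omega) (by omega) (by push_cast; ring)
    rw [cancelQuot_of_ne h1, div_eq_div_iff h2 h1]
    have h3 := poch_shift (i + 1 + s) i
    rw [show (i : ℂ) + 1 + s + 1 = i + 2 + s by ring] at h3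
    linear_combination -h3

theorem poch_high_div (h : HahnNondeg d m r s) {i : ℕ} (h1 : 1 ≤ i) (hi : i ≤ d) :
    poch (2 * i + 2 + s) (d - i) / poch (2 * i + 1 + s) (d - i) =
      cancelQuot (i + 1 + s + d) (2 * i + s + 1) := by
  rcases hi.lt_or_eq with hlt | rfl
  · have h1 := h.s_ne (a := 2 * i + s + 1) (2 * i + 1) (by omega) (by omega) (by push_cast; ring)
    have h2 : poch (2 * i + 1 + s) (d - i) ≠ 0 := poch_ne_zero fun k hk =>
      h.s_ne (2 * i + 1 + k) (by omega) (by omega) (by push_cast; ring)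
    rw [cancelQuot_of_ne h1, div_eq_div_iff h2 h1]
    have h3 := poch_shift (2 * i + 1 + s) (d - i)
    rw [show 2 * (i : ℂ) + 1 + s + 1 = 2 * i + 2 + s by ring, Nat.cast_sub hi] at h3
    linear_combination h3
  · rw [Nat.sub_self, poch_zero, poch_zero, div_one]
    convert (cancelQuot_self (2 * i + s + 1)).symm using 2
    ring

/-- Compares the normalizations of the arrays `(d, s + 1)` and `(d + 1, s)` at equal `i`. This and
the companion with `i + 1` determine the coefficients of both contiguity relations. -/
theorem hahnK_beta (h : HahnNondeg (d + 1) m r s) {i : ℕ} (hi : i ≤ d) :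
    (i + 1 + s - r) * (s + 2) / ((2 * i + s + 2) * (s + 1 - r)) * hahnK d r (s + 1) i * (d + 1) =
      hahnK (d + 1) r s i * (d + 1 - i) * cancelQuot (i + 1 + s) (2 * i + s + 1) := by
  rw [← poch_low_div h (by omega)]
  unfold hahnK
  have h1 := h.poch_sr_ne (i := i) (by omega)
  have h2 := h.poch_sr_ne (i := i + 1) (by omega)
  have h3 := h.poch_low_ne (i := i) (by omega)
  have h5 := h.poch_high_ne (i := i)
  have h6 : poch (i + 2 + s) i ≠ 0 := poch_ne_zero fun k hk =>
      h.s_ne (i + 2 + k) (by omega) (by omega) (by push_cast; ring)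
  have h7 : (d.choose i : ℂ) * (d + 1) = (d + 1).choose i * (d + 1 - i) := by
    have := congrArg (Nat.cast (R := ℂ)) (Nat.choose_mul_succ_eq d i)
    rw [Nat.cast_mul, Nat.cast_mul, Nat.cast_sub (by omega)] at this
    push_cast at this
    exact this
  rw [poch_succ'] at h2
  rw [show d + 1 - i = d - i + 1 by omega, poch_succ' (2 * i + 2 + s)] at h5 ⊢
  rw [poch_succ' (s + 2)]
  have h8 := poch_shift (s - r + 1) i
  rw [show 2 * (i : ℂ) + 2 + (s + 1) = 2 * i + 2 + s + 1 by ring,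
    show (i : ℂ) + 1 + (s + 1) = i + 2 + s by ring, show s + 1 + 2 = s + 2 + 1 by ring,
    show s + 1 - r = s - r + 1 by ring, show (i : ℂ) + 1 + s - r = s - r + 1 + i by ring,
    show 2 * (i : ℂ) + s + 2 = 2 * i + 2 + s by ring]
  have h9 := left_ne_zero_of_mul h2
  have h10 := right_ne_zero_of_mul h2
  have h11 := left_ne_zero_of_mul h5
  have h12 := right_ne_zero_of_mul h5
  generalize poch (s - r + 1) i = a1 at *
  generalize poch (s - r + 1 + 1) i = a2 at *
  generalize poch (i + 1 + s) i = a3 at *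
  generalize poch (i + 2 + s) i = a4 at *
  generalize poch (2 * i + 2 + s + 1) (d - i) = a5 at *
  generalize (2 * i + 2 + s) = a6 at *
  generalize poch (s + 2 + 1) d = a7 at *
  generalize hA : (s - r + 1) = a8 at *
  generalize s + 2 = a9 at *
  field_simp
  linear_combination poch (r + 1) i * a7 * a9 *
    (a1 * (a8 + i) * h7 - ((d + 1).choose i : ℂ) * (d + 1 - i) * h8)

theorem hahnK_alpha (h : HahnNondeg (d + 1) m r s) {i : ℕ} (hi : i ≤ d) :
    (i + 1 + r) * (s + 2) / ((2 * i + 2 + s) * (s + 1 - r)) * hahnK d r (s + 1) i * (d + 1) =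
      hahnK (d + 1) r s (i + 1) * (i + 1) * cancelQuot (i + 2 + s + (d + 1)) (2 * i + s + 3) := by
  have h0 := poch_high_div h (i := i + 1) (by omega) (by omega)
  push_cast at h0
  rw [show (i : ℂ) + 2 + s + (d + 1) = i + 1 + 1 + s + (d + 1) by ring,
    show 2 * (i : ℂ) + s + 3 = 2 * (i + 1) + s + 1 by ring, ← h0]
  unfold hahnK
  have h2 := h.poch_sr_ne (i := i + 1) (by omega)
  have h3 := h.poch_low_ne (i := i + 1) (by omega)
  have h5 := h.poch_high_ne (i := i + 1)
  have h6 : poch (2 * i + 3 + s) (d - i) ≠ 0 := poch_ne_zero fun k hk =>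
      h.s_ne (2 * i + 3 + k) (by omega) (by omega) (by push_cast; ring)
  have h7 : (d.choose i : ℂ) * (d + 1) = (d + 1).choose (i + 1) * (i + 1) := by
    have := congrArg (Nat.cast (R := ℂ)) (Nat.add_one_mul_choose_eq d i)
    push_cast at this
    linear_combination this
  rw [poch_succ'] at h2
  rw [show d + 1 - (i + 1) = d - i by omega] at h5 ⊢
  rw [poch_succ] at h3
  rw [poch_succ' (s + 2), poch_succ (r + 1), poch_succ' (s - r + 1), poch_succ]
  push_cast at *
  rw [show 2 * (i : ℂ) + 2 + (s + 1) = 2 * i + 3 + s by ring,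
    show (i : ℂ) + 1 + (s + 1) = i + 1 + 1 + s by ring, show s + 1 + 2 = s + 2 + 1 by ring,
    show s + 1 - r = s - r + 1 by ring, show (i : ℂ) + 1 + r = r + 1 + i by ring,
    show s - r + 1 + 1 = s + 1 - r + 1 by ring,
    show 2 * ((i : ℂ) + 1) + 1 + s = 2 * i + 3 + s by ring] at *
  rw [show (i : ℂ) + 1 + 1 + s + i = 2 * i + 2 + s by ring] at *
  have h9 := left_ne_zero_of_mul h2
  have h10 := right_ne_zero_of_mul h2
  have h11 := left_ne_zero_of_mul h3
  have h12 := right_ne_zero_of_mul h3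
  rw [show s + 1 - r + 1 = s - r + 1 + 1 by ring] at *
  generalize poch (s - r + 1 + 1) i = a2 at *
  generalize poch (i + 1 + 1 + s) i = a3 at *
  generalize poch (2 * (i + 1) + 2 + s) (d - i) = a4 at *
  generalize poch (2 * i + 3 + s) (d - i) = a5 at *
  generalize (2 * i + 2 + s) = a6 at *
  generalize poch (s + 2 + 1) d = a7 at *
  generalize hA : (s - r + 1) = a8 at *
  generalize s + 2 = a9 at *
  field_simp
  linear_combination a9 * poch (r + 1) i * a7 * (r + 1 + i) * h7

end Base

/-! ### Raising and lowering relations for Hahn polynomials -/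

/-- The product `∏_{j<k} (x - j) / ((j + 1) (j - d) (j + 1 + r))`. -/
noncomputable def hahnTau (d r x : ℂ) (k : ℕ) : ℂ :=
  ∏ j ∈ Finset.range k, ((x - j) / ((j + 1) * (j - d) * (j + 1 + r)))

theorem hahnTau_succ (d r x : ℂ) (k : ℕ) : hahnTau d r x (k + 1) =
    hahnTau d r x k * ((x - k) / ((k + 1) * (k - d) * (k + 1 + r))) :=
  Finset.prod_range_succ _ _

theorem quadFact_of_lt {s : ℂ} {i k : ℕ} (h : i < k) : quadFact s i k = 0 :=
  Finset.prod_eq_zero (Finset.mem_range.2 h) (by simp)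

section Base

variable {d : ℕ} {m r s : ℂ}

/-- The diameter enters only through the factors `j - d`, so raising it by one changes the product
by its end factors. -/
theorem hahnTau_shift {x k : ℕ} (hr : ∀ n : ℕ, 1 ≤ n → n ≤ d + 1 → r + n ≠ 0) (hk : k ≤ d) :
    hahnTau (d + 1) r x k * (d + 1) = hahnTau d r x k * (d + 1 - k) := by
  induction k with
  | zero => simp [hahnTau]
  | succ k ih =>
    have ih := ih (by omega)
    rw [hahnTau_succ, hahnTau_succ]
    have h1 : (k : ℂ) - d ≠ 0 := natCast_sub_natCast_ne (by omega)
    have h2 : (k : ℂ) - (d + 1) ≠ 0 := by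
      have := natCast_sub_natCast_ne (i := k) (j := d + 1) (by omega)
      push_cast at this
      exact this
    have h3 : (k : ℂ) + 1 ≠ 0 := Nat.cast_add_one_ne_zero k
    have h4 : (k : ℂ) + 1 + r ≠ 0 := by
      have := hr (k + 1) (by omega) (by omega)
      push_cast at this
      rwa [add_comm] at this
    push_cast
    rw [show (d : ℂ) + 1 - (k + 1) = -(k - d) by ring]
    rw [show (d : ℂ) + 1 - k = -(k - (d + 1)) by ring] at ih
    generalize (k : ℂ) - d = a at *
    generalize (k : ℂ) - (d + 1) = b at *
    generalize (k : ℂ) + 1 + r = c at *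
    field_simp
    linear_combination (x - k) * ih

/-- At `k = d + 1` the left side contains the factor `x - x` and the right side the factor `d + 1 -
k`; a vanishing denominator in the last term is therefore harmless. -/
theorem hahnTau_shift_of_le {x k : ℕ} (hr : ∀ n : ℕ, 1 ≤ n → n ≤ d + 1 → r + n ≠ 0)
    (hx : x ≤ d) (hk : k ≤ d + 1) :
    hahnTau (d + 1) r x k * (d + 1) = hahnTau d r x k * (d + 1 - k) := by
  rcases Nat.lt_succ_iff_lt_or_eq.1 (Nat.lt_succ_of_le hk) with h | rfl
  · exact hahnTau_shift hr (by omega)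
  · rw [hahnTau, Finset.prod_eq_zero (i := x) (Finset.mem_range.2 (by omega)) (by simp)]
    push_cast
    ring

/-- The parameter `m` cancels. The free upper limit `n` lets polynomials of different degree be
summed over the same range. -/
theorem hahnBase_u (hm : m ≠ 0) {i n : ℕ} (hi : i ≤ n) (x : ℂ) :
    (hahnBase d m r s).u i x =
      ∑ k ∈ Finset.range (n + 1), hahnTau d r x k * quadFact s i k := by
  rw [ParamArray.u_eq_sum_range hi]
  refine Finset.sum_congr rfl fun k _ => ?_
  rw [hahnTau, quadFact, ← Finset.prod_mul_distrib]
  refine Finset.prod_congr rfl fun j _ => ?_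
  rw [hahnBase_dev_sub]
  simp only [hahnBase]
  push_cast
  rw [show m * ((j : ℂ) + 1) * (j + 1 - d - 1) * (j + 1 + r) =
    m * ((j + 1) * (j - d) * (j + 1 + r)) by ring, mul_assoc m, mul_left_comm,
    mul_div_mul_left _ _ hm]
  ring

theorem hahnBase_p (h : HahnNondeg d m r s) {x i n : ℕ} (hx : x ≤ d) (hi : i ≤ d) (hn : i ≤ n) :
    (hahnBase d m r s).p x i = hahnK d r s i *
      ∑ k ∈ Finset.range (n + 1), hahnTau d r x k * quadFact s i k := by
  rw [ParamArray.p_of_le (by exact hx) (by exact hi), hahnBase_k h hi, hahnBase_u h.1 hn]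
  rfl

theorem HahnNondeg.pred (h : HahnNondeg (d + 1) m r s) : HahnNondeg d m r (s + 1) := by
  have := h.shift (j := 1) (by omega)
  simpa using this

/-- The coefficient of the raising relation. -/
noncomputable def upB (r s : ℂ) (i : ℕ) : ℂ :=
  (i + 1 + s - r) * (s + 2) / ((2 * i + s + 2) * (s + 1 - r))

noncomputable def upA (r s : ℂ) (i : ℕ) : ℂ :=
  (i + 1 + r) * (s + 2) / ((2 * i + 2 + s) * (s + 1 - r))

theorem cast_add_one_ne (d : ℕ) : (d : ℂ) + 1 ≠ 0 := Nat.cast_add_one_ne_zero d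

theorem hahnBase_up_zero (h : HahnNondeg (d + 1) m r s) {x : ℕ} (hx : x ≤ d) :
    (hahnBase (d + 1) m r s).p x 0 = upB r s 0 * (hahnBase d m r (s + 1)).p x 0 := by
  have h1 := h.s_ne (a := s + 2) 2 (by omega) (by omega) (by push_cast; ring)
  have h2 := h.sr_ne (a := 1 + s - r) 1 (by omega) (by omega) (by push_cast; ring)
  rw [ParamArray.p_of_le (by exact Nat.le_succ_of_le hx) (Nat.zero_le _),
    ParamArray.p_of_le (by exact hx) (Nat.zero_le _), (hahnBase_nondeg h).k_zero,
    (hahnBase_nondeg h.pred).k_zero, ParamArray.u_zero, ParamArray.u_zero, upB]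
  simp only [Nat.cast_zero, mul_zero, zero_add, mul_one]
  rw [show s + 1 - r = 1 + s - r by ring, mul_comm, div_self (mul_ne_zero h1 h2)]

/-- Compare coefficients of `hahnTau d r x k`. By the shift relations all of them are multiples of
`quadFact s (i + 1) k`, and it remains to write `d + 1 - k` as a combination of `i + 1 - k` and `i +
2 + k + s`. -/
theorem hahnBase_up_succ (h : HahnNondeg (d + 1) m r s) {x i : ℕ} (hx : x ≤ d) (hi : i ≤ d) :
    (hahnBase (d + 1) m r s).p x (i + 1) = upA r s i * (hahnBase d m r (s + 1)).p x i +
      upB r s (i + 1) * (hahnBase d m r (s + 1)).p x (i + 1) := by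
  have hd := cast_add_one_ne d
  have hα := hahnK_alpha h hi
  rw [← upA] at hα
  rw [hahnBase_p h (Nat.le_succ_of_le hx) (by omega : i + 1 ≤ d + 1) (by omega : i + 1 ≤ d + 1),
    hahnBase_p h.pred hx hi (by omega : i ≤ d + 1)]
  refine mul_right_cancel₀ hd ?_
  have htau := fun k (hk : k ∈ Finset.range (d + 1 + 1)) =>
    hahnTau_shift_of_le (x := x) h.2.1 hx (Finset.mem_range_succ_iff.1 hk)
  have e1 : (hahnK (d + 1) r s (i + 1) * ∑ k ∈ Finset.range (d + 1 + 1),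
      hahnTau (d + 1 : ℕ) r x k * quadFact s (i + 1 : ℕ) k) * (d + 1) =
      ∑ k ∈ Finset.range (d + 1 + 1), hahnTau d r x k *
        (hahnK (d + 1) r s (i + 1) * (d + 1 - k) * quadFact s (i + 1) k) := by
    rw [Finset.mul_sum, Finset.sum_mul]
    refine Finset.sum_congr rfl fun k hk => ?_
    push_cast
    linear_combination hahnK (d + 1) r s (i + 1) * quadFact s (i + 1) k * htau k hk
  rw [e1]
  have hp : ∀ k, ((i : ℂ) + 1) * quadFact (s + 1) i k = (i + 1 - k) * quadFact s (i + 1) k :=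
    fun k => by simpa using quadFact_pred s ((i : ℂ) + 1) k
  rcases hi.lt_or_eq with hlt | rfl
  · have hβ := hahnK_beta h (i := i + 1) hlt
    rw [← upB] at hβ
    rw [hahnBase_p h.pred hx (by omega : i + 1 ≤ d) (by omega : i + 1 ≤ d + 1), add_mul]
    simp only [Finset.mul_sum, Finset.sum_mul, ← Finset.sum_add_distrib]
    refine Finset.sum_congr rfl fun k _ => ?_
    have hs := quadFact_shift s ((i : ℂ) + 1) k
    have hne := h.s_ne (a := 2 * i + s + 3) (2 * i + 3) (by omega) (by omega) (by push_cast; ring)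
    push_cast at hβ ⊢
    rw [show 2 * ((i : ℂ) + 1) + s + 1 = 2 * i + s + 3 by ring] at hβ
    rw [cancelQuot_of_ne hne, mul_div_assoc', eq_div_iff hne] at hα hβ
    refine mul_right_cancel₀ hne ?_
    linear_combination -hahnTau d r x k * (quadFact (s + 1) i k * hα +
      quadFact (s + 1) (i + 1) k * hβ + hahnK (d + 1) r s (i + 1) * ((i + 2 + s + (d + 1)) * hp k +
        (d - i) * hs))
  -- For `i = d` the second term is absent, and the bracket is `1` even if `2d + s + 3` vanishes.
  · rw [show (i : ℂ) + 2 + s + (i + 1) = 2 * i + s + 3 by ring, cancelQuot_self, mul_one] at hα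
    rw [ParamArray.p_of_lt_right (i := i + 1) (by exact Nat.lt_succ_self _), mul_zero, add_zero]
    simp only [Finset.mul_sum, Finset.sum_mul]
    refine Finset.sum_congr rfl fun k _ => ?_
    linear_combination -hahnTau i r x k * (quadFact (s + 1) i k * hα +
      hahnK (i + 1) r s (i + 1) * hp k)

/-- The coefficients of the lowering relation. -/
noncomputable def downA (d : ℕ) (r s : ℂ) (i : ℕ) : ℂ :=
  (d - i) * (r - s - 1) / (s + 2) * cancelQuot (i + 1 + s) (2 * i + s + 1)

noncomputable def downB (d : ℕ) (r s : ℂ) (i : ℕ) : ℂ :=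
  (i + 1) * (r - s - 1) / (s + 2) * cancelQuot (i + 2 + s + d) (2 * i + s + 3)

/-- The inverse passage, from diameter `d` to `d + 1`. The factor `x - (d + 1)` makes the relation
meaningful at `x = d + 1`, where the smaller array has no such eigenvalue. -/
theorem hahnBase_down (h : HahnNondeg (d + 1) m r s) {x i : ℕ} (hx : x ≤ d + 1) (hi : i ≤ d) :
    (x - (d + 1)) * (hahnBase d m r (s + 1)).p x i =
      downA (d + 1) r s i * (hahnBase (d + 1) m r s).p x i +
      downB (d + 1) r s i * (hahnBase (d + 1) m r s).p x (i + 1) := by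
  have h1 := h.s_ne (a := s + 2) 2 (by omega) (by omega) (by push_cast; ring)
  have h2 := h.sr_ne (a := s + 1 - r) 1 (by omega) (by omega) (by push_cast; ring)
  have h3 := h.s_ne (a := 2 * i + 2 + s) (2 * i + 2) (by omega) (by omega) (by push_cast; ring)
  have hα := hahnK_alpha h hi
  have hβ := hahnK_beta h hi
  have hA : downA (d + 1) r s i * hahnK (d + 1) r s i * (2 * i + 2 + s) =
      -((d + 1) * hahnK d r (s + 1) i * (i + 1 + s - r)) := by
    unfold downA
    push_cast
    rw [show 2 * (i : ℂ) + s + 2 = 2 * i + 2 + s by ring] at hβ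
    generalize cancelQuot (i + 1 + s) (2 * i + s + 1) = q at *
    generalize 2 * (i : ℂ) + 2 + s = a at *
    generalize s + 2 = b at *
    rw [show r - s - 1 = -(s + 1 - r) by ring]
    generalize s + 1 - r = c at *
    field_simp at hβ ⊢
    linear_combination hβ
  have hB : downB (d + 1) r s i * hahnK (d + 1) r s (i + 1) * (2 * i + 2 + s) =
      -((d + 1) * hahnK d r (s + 1) i * (i + 1 + r)) := by
    unfold downB
    push_cast
    generalize cancelQuot (i + 2 + s + (d + 1)) (2 * i + s + 3) = q at *
    generalize 2 * (i : ℂ) + 2 + s = a at *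
    generalize s + 2 = b at *
    rw [show r - s - 1 = -(s + 1 - r) by ring]
    generalize s + 1 - r = c at *
    field_simp at hα ⊢
    linear_combination hα
  rw [hahnBase_p h hx (by omega : i ≤ d + 1) (by omega : i ≤ d + 1),
    hahnBase_p h hx (by omega : i + 1 ≤ d + 1) (by omega : i + 1 ≤ d + 1)]
  have hL : (x - (d + 1)) * (hahnBase d m r (s + 1)).p x i = hahnK d r (s + 1) i *
      ∑ k ∈ Finset.range (d + 1), (x - (d + 1)) * hahnTau d r x k * quadFact (s + 1) i k := by
    rcases hx.lt_or_eq with h4 | rfl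
    · rw [hahnBase_p h.pred (by omega : x ≤ d) hi hi, mul_left_comm, Finset.mul_sum]
      simp only [mul_assoc]
    · push_cast
      simp
  rw [hL]
  -- Write `x - (d + 1) = (x - k) + (k - (d + 1))`: the first part raises `k`, the second changes
  -- the diameter.
  have hT : ∀ k ∈ Finset.range (d + 1), (x - (d + 1)) * hahnTau d r x k =
      -((d + 1) * (hahnTau (d + 1) r x k +
        (k + 1) * (k + 1 + r) * hahnTau (d + 1) r x (k + 1))) := by
    intro k hk
    rw [Finset.mem_range] at hk
    have e := hahnTau_shift (x := x) (r := r) (d := d) h.2.1 (by omega : k ≤ d)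
    rw [hahnTau_succ]
    have e3 : (k : ℂ) + 1 ≠ 0 := Nat.cast_add_one_ne_zero k
    have e4 : (k : ℂ) + 1 + r ≠ 0 := by
      have := h.2.1 (k + 1) (by omega) (by omega)
      push_cast at this
      rwa [add_comm] at this
    have e2 : (k : ℂ) - (d + 1) ≠ 0 := by
      have := natCast_sub_natCast_ne (i := k) (j := d + 1) (by omega)
      push_cast at this
      exact this
    rw [show (d : ℂ) + 1 - k = -(k - (d + 1)) by ring] at e
    rw [show (x : ℂ) - (d + 1) = x - k + (k - (d + 1)) by ring]
    generalize (k : ℂ) - (d + 1) = b at *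
    generalize (k : ℂ) + 1 + r = c at *
    field_simp
    linear_combination (x - k + b) * e
  have hq0 : quadFact (s + 1) i (d + 1) = 0 := quadFact_of_lt (by omega)
  -- Split off `k = 0` and shift the index, then compare the coefficients of `T (k + 1)` by the
  -- relations for `quadFact`.
  have hsum : ∑ k ∈ Finset.range (d + 1 + 1), hahnTau (d + 1) r x k *
        ((i + 1 + s - r) * quadFact s i k + (i + 1 + r) * quadFact s (i + 1) k) =
      (2 * i + 2 + s) * ∑ k ∈ Finset.range (d + 1), (hahnTau (d + 1) r x k +
        (k + 1) * (k + 1 + r) * hahnTau (d + 1) r x (k + 1)) * quadFact (s + 1) i k := by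
    have e0 : ∑ k ∈ Finset.range (d + 1), hahnTau (d + 1) r x k * quadFact (s + 1) i k =
        ∑ k ∈ Finset.range (d + 1), hahnTau (d + 1) r x (k + 1) * quadFact (s + 1) i (k + 1) +
          1 := by
      have := Finset.sum_range_succ (fun k => hahnTau (d + 1) r x k * quadFact (s + 1) i k) (d + 1)
      rw [hq0, mul_zero, add_zero] at this
      rw [← this, Finset.sum_range_succ']
      simp [hahnTau, quadFact_zero]
    have e1 : hahnTau (d + 1) r x 0 = 1 := by simp [hahnTau]
    generalize hahnTau ((d : ℂ) + 1) r x = T at e0 e1 ⊢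
    rw [Finset.sum_congr rfl fun k _ => add_mul (T k) _ _, Finset.sum_add_distrib, e0,
      Finset.sum_range_succ', quadFact_zero, quadFact_zero, e1, add_right_comm (Finset.sum _ _) (1 : ℂ),
      ← Finset.sum_add_distrib, mul_add (2 * (i : ℂ) + 2 + s) (Finset.sum _ _), Finset.mul_sum]
    congr 1
    · refine Finset.sum_congr rfl fun k _ => ?_
      have q1 := quadFact_shift s i k
      have q2 := quadFact_pred s (i + 1) k
      rw [add_sub_cancel_right] at q2
      rw [quadFact_succ, quadFact_succ, quadFact_succ]
      linear_combination T (k + 1) *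
        (-(i + 1 + s - r) * (i - k) * q1 - (i + 1 + r) * (i + k + 2 + s) * q2)
    · ring
  refine mul_right_cancel₀ h3 ?_
  trans -((d + 1) * hahnK d r (s + 1) i) * ((2 * i + 2 + s) * ∑ k ∈ Finset.range (d + 1),
      (hahnTau (d + 1) r x k +
        (k + 1) * (k + 1 + r) * hahnTau (d + 1) r x (k + 1)) * quadFact (s + 1) i k)
  · simp only [Finset.mul_sum, Finset.sum_mul]
    refine Finset.sum_congr rfl fun k hk => ?_
    rw [hT k hk]
    ring
  · rw [← hsum, add_mul]
    simp only [Finset.mul_sum, Finset.sum_mul, ← Finset.sum_add_distrib]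
    refine Finset.sum_congr rfl fun k _ => ?_
    push_cast
    linear_combination -hahnTau (d + 1) r x k * (quadFact s i k * hA +
      quadFact s (i + 1) k * hB)

end Base

/-! ### The coefficients `C` and `D` of the Hahn / dual Hahn families -/

theorem hahnB_shift {N j : ℕ} (hj : j ≤ N) (r s : ℂ) (i : ℕ) :
    hahnB N r s j i = hahnB (N - j) r (s + j) 0 i := by
  unfold hahnB
  rw [Nat.cast_sub hj]
  congr 1
  · rw [Nat.cast_zero]; congr 1 <;> ring
  · congr 1 <;> rw [Nat.cast_zero] <;> ring

theorem hahnCc_shift {N j : ℕ} (hj : j ≤ N) (r s : ℂ) (i : ℕ) :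
    hahnCc N r s j i = hahnCc (N - j) r (s + j) 0 i := by
  unfold hahnCc
  rw [Nat.cast_sub hj]
  congr 2
  · rw [Nat.cast_zero]; congr 1 <;> ring
  · congr 1 <;> (try rw [Nat.cast_zero]) <;> ring

theorem hahnArray_b {N : ℕ} {m r s : ℂ} (h : HahnNondeg N m r s) {i j : ℕ} (hij : i + j ≤ N) :
    (hahnArray N m r s j).b i = hahnB N r s j i := by
  rw [hahnArray_eq (by omega), hahnB_shift (by omega), hahnBase_b_eq (h.shift (by omega))
    (by omega)]

theorem hahnArray_c {N : ℕ} {m r s : ℂ} (h : HahnNondeg N m r s) {i j : ℕ} (hij : i + j ≤ N) :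
    (hahnArray N m r s j).c i = hahnCc N r s j i := by
  rw [hahnArray_eq (by omega), hahnCc_shift (by omega), hahnBase_c_eq (h.shift (by omega))
    (by omega)]

theorem hahnArray_a {N : ℕ} {m r s : ℂ} (h : HahnNondeg N m r s) {i j : ℕ} (hij : i + j ≤ N) :
    (hahnArray N m r s j).a i = hahnA N r s j i := by
  unfold hahnA
  rw [hahnArray_eq (by omega), hahnB_shift (by omega), hahnCc_shift (by omega),
    hahnBase_a_eq (h.shift (by omega)) (by omega), hahnA]

theorem dualHahnArray_b {N : ℕ} {m r s : ℂ} {j x : ℕ} (hij : j + x ≤ N) :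
    (dualHahnArray N m r s x).b j = m * (j - N + x) * (j + 1 + r) := by
  rw [dualHahnArray_eq (by omega), dualBase_b (by omega), Nat.cast_sub (by omega)]
  ring

theorem dualHahnArray_c {N : ℕ} {m r s : ℂ} {j x : ℕ} (hij : j + x ≤ N) :
    (dualHahnArray N m r s x).c j = m * j * (j - N - 1 + r - s) := by
  rw [dualHahnArray_eq (by omega), dualBase_c (by omega), Nat.cast_sub (by omega)]
  ring

theorem dualHahnArray_a {N : ℕ} {m r s : ℂ} {j x : ℕ} (hij : j + x ≤ N) :
    (dualHahnArray N m r s x).a j =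
      -(dualHahnArray N m r s x).b j - (dualHahnArray N m r s x).c j := by
  rw [dualHahnArray_eq (by omega), dualBase_a (by omega)]

section HahnC

variable (N : ℕ) (P : HahnParams) (i j : ℕ)

theorem hahnC_neg_zero : hahnC N P (-1) 0 i j =
    -P.μ * (j + 1 + P.ρ) * hahnB N P.r P.s j (i - 1) := by simp [hahnC]

theorem hahnC_one_zero : hahnC N P 1 0 i j =
    -P.μ * (j + 1 + P.ρ) * hahnCc N P.r P.s j (i + 1) := by simp [hahnC]

theorem hahnC_zero_zero : hahnC N P 0 0 i j =
    -P.μ * (j + 1 + P.ρ) * hahnA N P.r P.s j i + P.μ * (N - j) * (j + 1 + P.ρ)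
      + P.μ * j * (N - j + 1 + P.σ - P.ρ) := by simp [hahnC]

theorem hahnC_neg_one : hahnC N P (-1) 1 i j =
    P.μ * (j + 1) * (j - N + P.ρ - P.σ) * (i + P.r) * (P.s + j + 2) /
      ((2 * i + P.s + j) * (P.s + j + 1 - P.r)) := by simp [hahnC]

theorem hahnC_zero_one : hahnC N P 0 1 i j =
    P.μ * (j + 1) * (j - N + P.ρ - P.σ) * (i + 1 + P.s + j - P.r) * (P.s + j + 2) /
      ((2 * i + P.s + j + 2) * (P.s + j + 1 - P.r)) := by simp [hahnC]

theorem hahnC_zero_neg : hahnC N P 0 (-1) i j =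
    P.μ * (j + P.ρ) * (N - j + 1 - i) * (P.r - P.s - j) / (P.s + j + 1) *
      cancelQuot (i + P.s + j) (2 * i + P.s + j) := by simp [hahnC]

theorem hahnC_one_neg : hahnC N P 1 (-1) i j =
    P.μ * (j + P.ρ) * (i + 1) * (P.r - P.s - j) / (P.s + j + 1) *
      cancelQuot (i + P.s + N + 2) (2 * i + P.s + j + 2) := by simp [hahnC]

end HahnC

theorem sum_pair_neg (f : ℤ → ℂ) : ∑ ε ∈ ({-1, 0} : Finset ℤ), f ε = f (-1) + f 0 := by simp

theorem sum_pair_pos (f : ℤ → ℂ) : ∑ ε ∈ ({0, 1} : Finset ℤ), f ε = f 0 + f 1 := by simp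

theorem sum_triple (f : ℤ → ℂ) :
    ∑ ε ∈ ({-1, 0, 1} : Finset ℤ), f ε = f (-1) + f 0 + f 1 := by simp [add_assoc]

section Solves

variable {N : ℕ} {m r s μ ρ σ : ℂ}

/-- A transition coefficient of a family of diameters `N - j`, extended by zero. -/
theorem zeroExt_p {Φ : ℕ → ParamArray} (hd : ∀ j ≤ N, (Φ j).diam = N - j) (x i j : ℕ)
    (hj : j ≤ N) : zeroExt N (fun k l => (Φ l).p x k) i j = (Φ j).p x i := by
  by_cases h : i + j ≤ N
  · exact zeroExt_nat _ h
  · rw [zeroExt_eq_zero _ (by omega), ParamArray.p_of_lt_right (by rw [hd j hj]; omega)]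

/-- `c_{j+1}(Ψ_x)` is independent of `x`, so this is the raising relation multiplied by a constant.
For `x + j = N` or more both sides vanish by convention. -/
theorem hahn_solvesC_up (h : HahnNondeg N m r s) {i j x : ℕ} (hij : i + j ≤ N) :
    (dualHahnArray N μ ρ σ x).c (j + 1) * (hahnArray N m r s j).p x i =
      ∑ ε ∈ ({-1, 0} : Finset ℤ), hahnC N ⟨m, r, s, μ, ρ, σ⟩ ε 1 i j *
        zeroExt N (fun k l => (hahnArray N m r s l).p x k) (i + ε) (j + 1) := by
  have hd : ∀ j ≤ N, (hahnArray N m r s j).diam = N - j := fun _ _ => rfl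
  rw [sum_pair_neg]
  by_cases hx : x + (j + 1) ≤ N
  · obtain ⟨d, rfl⟩ : ∃ d, N = d + 1 + j := ⟨N - j - 1, by omega⟩
    have e1 : hahnArray (d + 1 + j) m r s j = hahnBase (d + 1) m r (s + j) := by
      rw [hahnArray_eq (by omega), Nat.add_sub_cancel]
    have e2 : hahnArray (d + 1 + j) m r s (j + 1) = hahnBase d m r (s + j + 1) := by
      rw [hahnArray_eq (by omega), show d + 1 + j - (j + 1) = d by omega]
      push_cast
      rw [add_assoc]
    have h' : HahnNondeg (d + 1) m r (s + j) := by
      simpa using h.shift (j := j) (by omega)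
    have e3 : zeroExt (d + 1 + j) (fun k l => (hahnArray (d + 1 + j) m r s l).p x k) i (j + 1) =
        (hahnBase d m r (s + j + 1)).p x i := by
      rw [← e2]; exact_mod_cast zeroExt_p hd x i (j + 1) (by omega)
    rw [dualHahnArray_c (by omega), hahnC_neg_one, hahnC_zero_one, add_zero, e3, e1]
    cases i with
    | zero =>
      rw [zeroExt_eq_zero _ (by omega), hahnBase_up_zero h' (by omega), upB]
      push_cast
      ring
    | succ i =>
      rw [show ((i + 1 : ℕ) : ℤ) + -1 = (i : ℕ) by push_cast; ring]
      have e4 : zeroExt (d + 1 + j) (fun k l => (hahnArray (d + 1 + j) m r s l).p x k) i (j + 1) =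
          (hahnBase d m r (s + j + 1)).p x i := by
        rw [← e2]; exact_mod_cast zeroExt_p hd x i (j + 1) (by omega)
      rw [e4, hahnBase_up_succ h' (by omega) (by omega), upA, upB]
      push_cast
      rw [show (i : ℂ) + 1 + 1 + s + j - r = i + 1 + 1 + (s + j) - r by ring,
        show 2 * ((i : ℂ) + 1) + (s + j) + 2 = 2 * (i + 1) + s + j + 2 by ring,
        show 2 * ((i : ℂ) + 1) + s + j = 2 * i + 2 + (s + j) by ring]
      ring
  · rw [ParamArray.c_eq_zero (by change N - x < j + 1; omega), zero_mul]
    have : ∀ I : ℤ, zeroExt N (fun k l => (hahnArray N m r s l).p x k) I (j + 1) = 0 := by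
      intro I
      by_cases hI : 0 ≤ I ∧ 0 ≤ (j : ℤ) + 1 ∧ I + (j + 1) ≤ N
      · obtain ⟨I, rfl⟩ := Int.eq_ofNat_of_zero_le hI.1
        have e := zeroExt_p hd x I (j + 1) (by omega)
        push_cast at e
        rw [e, ParamArray.p_of_lt_left (by change N - (j + 1) < x; omega)]
      · exact zeroExt_eq_zero _ hI
    rw [this, this, mul_zero, mul_zero, add_zero]

/-- `b_{j-1}(Ψ_x)` is a constant times `x - (N - j + 1)`, exactly the prefactor of the lowering
relation with `d = N - j`. -/
theorem hahn_solvesC_down (h : HahnNondeg N m r s) {i j x : ℕ} (hij : i + j ≤ N) :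
    (dualHahnArray N μ ρ σ x).bPrev j * (hahnArray N m r s j).p x i =
      ∑ ε ∈ ({0, 1} : Finset ℤ), hahnC N ⟨m, r, s, μ, ρ, σ⟩ ε (-1) i j *
        zeroExt N (fun k l => (hahnArray N m r s l).p x k) (i + ε) (j - 1) := by
  have hd : ∀ j ≤ N, (hahnArray N m r s j).diam = N - j := fun _ _ => rfl
  rw [sum_pair_pos]
  cases j with
  | zero =>
    rw [zeroExt_eq_zero _ (by omega), zeroExt_eq_zero _ (by omega)]
    simp [ParamArray.bPrev]
  | succ j =>
    obtain ⟨d, rfl⟩ : ∃ d, N = d + 1 + j := ⟨N - j - 1, by omega⟩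
    have e1 : hahnArray (d + 1 + j) m r s j = hahnBase (d + 1) m r (s + j) := by
      rw [hahnArray_eq (by omega), Nat.add_sub_cancel]
    have e2 : hahnArray (d + 1 + j) m r s (j + 1) = hahnBase d m r (s + j + 1) := by
      rw [hahnArray_eq (by omega), show d + 1 + j - (j + 1) = d by omega]
      push_cast
      rw [add_assoc]
    have h' : HahnNondeg (d + 1) m r (s + j) := by
      simpa using h.shift (j := j) (by omega)
    have e3 : ∀ i : ℕ, zeroExt (d + 1 + j) (fun k l => (hahnArray (d + 1 + j) m r s l).p x k) i j =
        (hahnBase (d + 1) m r (s + j)).p x i := fun i => by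
      rw [← e1]; exact_mod_cast zeroExt_p hd x i j (by omega)
    have e4 := e3 (i + 1)
    push_cast at e4
    rw [show ((j + 1 : ℕ) : ℤ) - 1 = j by push_cast; ring, add_zero, e3, e4, e2,
      hahnC_zero_neg, hahnC_one_neg]
    by_cases hx : x ≤ d + 1
    · have hdown := hahnBase_down h' (x := x) (i := i) hx (by omega)
      simp only [ParamArray.bPrev]
      rw [dualHahnArray_b (by omega)]
      unfold downA downB at hdown
      push_cast at hdown ⊢
      rw [show (i : ℂ) + s + (j + 1) = i + 1 + (s + j) by ring,
        show 2 * (i : ℂ) + s + (j + 1) + 2 = 2 * i + (s + j) + 3 by ring,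
        show 2 * (i : ℂ) + s + (j + 1) = 2 * i + (s + j) + 1 by ring,
        show (i : ℂ) + s + (d + 1 + j) + 2 = i + 2 + (s + j) + (d + 1) by ring,
        show s + ((j : ℂ) + 1) + 1 = s + j + 2 by ring]
      linear_combination μ * (j + 1 + ρ) * hdown
    · rw [ParamArray.p_of_lt_left (by change d < x; omega),
        ParamArray.p_of_lt_left (by change d + 1 < x; omega),
        ParamArray.p_of_lt_left (by change d + 1 < x; omega)]
      simp

/-- `a_j(Ψ_x)` is affine in `t_x = x`, so this is the recurrence of `Φ_j` scaled by `-μ (j + 1 + ρ)`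
and shifted by a multiple of the identity. -/
theorem hahn_solvesC_level (h : HahnNondeg N m r s) {i j x : ℕ} (hij : i + j ≤ N) :
    (dualHahnArray N μ ρ σ x).a j * (hahnArray N m r s j).p x i =
      ∑ ε ∈ ({-1, 0, 1} : Finset ℤ), hahnC N ⟨m, r, s, μ, ρ, σ⟩ ε 0 i j *
        zeroExt N (fun k l => (hahnArray N m r s l).p x k) (i + ε) j := by
  have hd : ∀ j ≤ N, (hahnArray N m r s j).diam = N - j := fun _ _ => rfl
  rw [sum_triple]
  have e0 := zeroExt_p hd x i j (by omega)
  have e1 := zeroExt_p hd x (i + 1) j (by omega)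
  push_cast at e1
  rw [add_zero, e0, e1, hahnC_neg_zero, hahnC_zero_zero, hahnC_one_zero]
  by_cases hx : x + j ≤ N
  · have hgood : (hahnArray N m r s j).Good := hahnArray_eq (show j ≤ N by omega) m r s ▸
      hahnBase_good (h.shift (by omega))
    have hrec := hgood.p_rec (x := x) (i := i) (by change x ≤ N - j; omega)
      (by change i ≤ N - j; omega)
    rw [dualHahnArray_a (by omega), dualHahnArray_b (by omega), dualHahnArray_c (by omega)]
    have e2 : (hahnArray N m r s j).bPrev i * (hahnArray N m r s j).p x (i - 1) =
        hahnB N r s j (i - 1) *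
          zeroExt N (fun k l => (hahnArray N m r s l).p x k) (i + -1) j := by
      cases i with
      | zero =>
        rw [zeroExt_eq_zero _ (by omega)]
        simp [ParamArray.bPrev]
      | succ i =>
        rw [show ((i + 1 : ℕ) : ℤ) + -1 = (i : ℕ) by push_cast; ring, Nat.add_sub_cancel,
          zeroExt_p hd x i j (by omega), ← hahnArray_b h (by omega)]
        rfl
    have e3 : (hahnArray N m r s j).c (i + 1) * (hahnArray N m r s j).p x (i + 1) =
        hahnCc N r s j (i + 1) * (hahnArray N m r s j).p x (i + 1) := by
      by_cases hi : i + 1 + j ≤ N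
      · rw [hahnArray_c h hi]
      · rw [ParamArray.p_of_lt_right (by change N - j < i + 1; omega), mul_zero, mul_zero]
    rw [e2, e3, hahnArray_a h hij] at hrec
    have e4 : (hahnArray N m r s j).ev x = x := rfl
    rw [e4] at hrec
    linear_combination -μ * (j + 1 + ρ) * hrec
  · have : ∀ i, (hahnArray N m r s j).p x i = 0 := fun i =>
      ParamArray.p_of_lt_left (by change N - j < x; omega)
    have h2 : zeroExt N (fun k l => (hahnArray N m r s l).p x k) (i + -1) j = 0 := by
      cases i with
      | zero => exact zeroExt_eq_zero _ (by omega)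
      | succ i =>
        rw [show ((i + 1 : ℕ) : ℤ) + -1 = (i : ℕ) by push_cast; ring,
          zeroExt_p hd x i j (by omega), this]
    rw [h2, this, this]
    ring

theorem hahn_solvesC (h : HahnNondeg N m r s) :
    SolvesC N (hahnArray N m r s) (dualHahnArray N μ ρ σ) (hahnC N ⟨m, r, s, μ, ρ, σ⟩) where
  up _ _ _ hij _ := hahn_solvesC_up h hij
  level _ _ _ hij _ := hahn_solvesC_level h hij
  down _ _ _ hij _ := hahn_solvesC_down h hij

end Solves

theorem SolvesC.congr_coef {N : ℕ} {Φ Ψ : ℕ → ParamArray} {C C' : ℤ → ℤ → ℕ → ℕ → ℂ}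
    (h : SolvesC N Φ Ψ C) (hC : CoefEq N C C') : SolvesC N Φ Ψ C' := by
  rw [solvesC_iff] at h ⊢
  intro ε' hε' i j x hij hx
  rw [h ε' hε' i j x hij hx]
  refine Finset.sum_congr rfl fun ε hε => ?_
  by_cases hc : 0 ≤ (i : ℤ) + ε ∧ 0 ≤ (j : ℤ) + ε' ∧ (i : ℤ) + ε + (j + ε') ≤ N
  · rw [hC ε ε' i j ⟨mem_rootsA2_iff.2 ⟨hε', hε⟩, hij, hc⟩]
  · rw [zeroExt_eq_zero _ hc, mul_zero, mul_zero]

theorem SolvesC.congr_agree {N : ℕ} {Φ Ψ Φ' Ψ' : ℕ → ParamArray} {C : ℤ → ℤ → ℕ → ℕ → ℂ}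
    (h : SolvesC N Φ Ψ C) (hdΦ : ∀ j ≤ N, (Φ j).diam = N - j)
    (hdΨ : ∀ x ≤ N, (Ψ x).diam = N - x) (hΦ : ∀ j ≤ N, (Φ j).Agree (Φ' j))
    (hΨ : ∀ x ≤ N, (Ψ x).Agree (Ψ' x)) : SolvesC N Φ' Ψ' C := by
  rw [solvesC_iff] at h ⊢
  intro ε' hε' i j x hij hx
  have e1 : (Ψ' x).wt ε' j * (Φ' j).p x i = (Ψ x).wt ε' j * (Φ j).p x i := by
    rw [← (hΦ j (by omega)).p_eq]
    -- Agreement says nothing on `a_j` beyond the diameter of `Ψ_x`; for such `x` the factor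
    -- `p_{xi}(Φ_j)` is zero.
    by_cases hxj : x + j ≤ N
    · congr 1
      unfold ParamArray.wt
      rw [(hΨ x hx).c_eq, (hΨ x hx).bPrev_eq, (hΨ x hx).a_eq (by rw [hdΨ x hx]; omega)]
    · rw [ParamArray.p_of_lt_left (by rw [hdΦ j (by omega)]; omega), mul_zero, mul_zero]
  rw [e1, h ε' hε' i j x hij hx]
  refine Finset.sum_congr rfl fun ε _ => ?_
  congr 1
  unfold zeroExt
  split_ifs with hc
  · exact (hΦ _ (by omega)).p_eq _ _
  · rfl

theorem hahnArray_star_agree {N j : ℕ} (hj : j ≤ N) (m r s : ℂ) :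
    (hahnArray N m r s j).star.Agree (dualHahnArray N m r s j) := by
  rw [hahnArray_eq hj, dualHahnArray_eq hj]
  exact hahnBase_star_agree _ _ _ _

theorem dualHahnArray_star_agree {N j : ℕ} (hj : j ≤ N) (m r s : ℂ) :
    (dualHahnArray N m r s j).star.Agree (hahnArray N m r s j) := by
  rw [hahnArray_eq hj, dualHahnArray_eq hj]
  exact dualBase_star_agree _ _ _ _

section Hahn

variable {N : ℕ} {m r s μ ρ σ : ℂ}

theorem dualHahnArray_nu (h : HahnNondeg N μ ρ σ) {x : ℕ} (hx : x ≤ N) :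
    (dualHahnArray N μ ρ σ x).nu = poch (σ + x + 2) (N - x) / poch (σ + x - ρ + 1) (N - x) := by
  rw [dualHahnArray_eq hx, dualBase_nu (h.shift hx)]

theorem hahnArray_nu (h : HahnNondeg N m r s) {j : ℕ} (hj : j ≤ N) :
    (hahnArray N m r s j).nu = poch (s + j + 2) (N - j) / poch (s + j - r + 1) (N - j) := by
  rw [hahnArray_eq hj, hahnBase_nu (h.shift hj)]

theorem dualHahnArray_nu_ne (h : HahnNondeg N μ ρ σ) {x : ℕ} (hx : x ≤ N) :
    (dualHahnArray N μ ρ σ x).nu ≠ 0 := by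
  rw [dualHahnArray_eq hx]
  exact (dualBase_nondeg (h.shift hx)).nu_ne

theorem nu_ratio_succ (h : HahnNondeg N μ ρ σ) {x : ℕ} (hx : x + 1 ≤ N) :
    (dualHahnArray N μ ρ σ (x + 1)).nu / (dualHahnArray N μ ρ σ x).nu = nuRatio ρ σ 1 x := by
  rw [dualHahnArray_nu h hx, dualHahnArray_nu h (by omega)]
  have h1 := (h.shift (j := x) (by omega)).poch_s_ne le_rfl
  have h2 := (h.shift (j := x) (by omega)).poch_sr_ne le_rfl
  have h3 := (h.shift hx).poch_sr_ne le_rfl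
  obtain ⟨n, rfl⟩ := Nat.exists_eq_add_of_le' hx
  rw [show n + (x + 1) - x = n + 1 by omega, poch_succ'] at h1 h2 ⊢
  rw [poch_succ' (σ + x - ρ + 1)]
  rw [show n + (x + 1) - (x + 1) = n by omega] at h3 ⊢
  have e1 : σ + ((x + 1 : ℕ) : ℂ) + 2 = σ + x + 2 + 1 := by push_cast; ring
  have e2 : σ + ((x + 1 : ℕ) : ℂ) - ρ + 1 = σ + x - ρ + 1 + 1 := by push_cast; ring
  rw [e1]
  rw [e2] at h3 ⊢
  have h4 := left_ne_zero_of_mul h1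
  have h5 := right_ne_zero_of_mul h1
  have h6 := left_ne_zero_of_mul h2
  rw [nuRatio, if_pos rfl, show σ - ρ + x + 1 = σ + x - ρ + 1 by ring]
  generalize poch (σ + x + 2 + 1) n = a at *
  generalize poch (σ + x - ρ + 1 + 1) n = b at *
  generalize σ + x + 2 = c at *
  generalize σ + x - ρ + 1 = e at *
  field_simp

theorem nu_ratio_pred (h : HahnNondeg N μ ρ σ) {x : ℕ} (hx : x + 1 ≤ N) :
    (dualHahnArray N μ ρ σ x).nu / (dualHahnArray N μ ρ σ (x + 1)).nu =
      nuRatio ρ σ (-1) (x + 1) := by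
  rw [← inv_div, nu_ratio_succ h hx]
  simp only [nuRatio, if_pos]
  rw [if_neg (by decide), inv_div]
  push_cast
  congr 1 <;> ring

/-- The swapped families agree with the Hahn family in `(μ, ρ, σ)` and the dual Hahn family in `(m,
r, s)`, so the constraints on `C` apply with exchanged parameters. `key` checks that `nuRatio`
cancels the ratio of the `ν`. -/
theorem hahn_solvesD (h' : HahnNondeg N μ ρ σ) :
    SolvesD N (hahnArray N m r s) (dualHahnArray N μ ρ σ) (hahnD N ⟨m, r, s, μ, ρ, σ⟩) := by
  rw [solvesD_iff fun x hx => dualHahnArray_nu_ne h' hx]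
  refine ((hahn_solvesC (μ := m) (ρ := r) (σ := s) h').congr_agree (fun _ _ => rfl)
    (fun _ _ => rfl) (fun x hx => (dualHahnArray_star_agree hx μ ρ σ).symm)
    (fun j hj => (hahnArray_star_agree hj m r s).symm)).congr_coef ?_
  rintro ε' ε y x ⟨hr, hxy, h1, h2, h3⟩
  unfold dualCoef hahnD HahnParams.swap
  have key : nuRatio ρ σ ε x * ((dualHahnArray N μ ρ σ x).nu /
      (dualHahnArray N μ ρ σ ((x : ℤ) + ε).toNat).nu) = 1 := by
    obtain ⟨hε, -⟩ := mem_rootsA2_iff.1 hr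
    simp only [Finset.mem_insert, Finset.mem_singleton] at hε
    rcases hε with rfl | rfl | rfl
    · rw [show ((x : ℤ) + 1).toNat = x + 1 by omega, ← nu_ratio_succ h' (by omega),
        div_mul_div_cancel₀ (dualHahnArray_nu_ne h' (by omega)),
        div_self (dualHahnArray_nu_ne h' (by omega))]
    · rw [add_zero, Int.toNat_natCast, div_self (dualHahnArray_nu_ne h' (by omega))]
      simp [nuRatio]
    · obtain ⟨x, rfl⟩ := Nat.exists_eq_add_of_le' (by omega : 1 ≤ x)
      rw [show (((x + 1 : ℕ) : ℤ) + -1).toNat = x by omega, ← nu_ratio_pred h' (by omega),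
        div_mul_div_cancel₀ (dualHahnArray_nu_ne h' (by omega)),
        div_self (dualHahnArray_nu_ne h' (by omega))]
  simp only
  rw [mul_assoc, key, mul_one]

/-! ### The weights `F` and `G` -/

theorem hahnArray_k (h : HahnNondeg N m r s) {i j : ℕ} (hij : i + j ≤ N) :
    (hahnArray N m r s j).k i = hahnK (N - j) r (s + j) i := by
  rw [hahnArray_eq (by omega), hahnBase_k (h.shift (by omega)) (by omega)]

theorem dualHahnArray_k (h : HahnNondeg N m r s) {i j : ℕ} (hij : i + j ≤ N) :
    (dualHahnArray N m r s j).k i = dualK (N - j) r (s + j) i := by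
  rw [dualHahnArray_eq (by omega), dualBase_k (h.shift (by omega)) (by omega)]

theorem hahnArray_star_k (h : HahnNondeg N m r s) {i j : ℕ} (hij : i + j ≤ N) :
    (hahnArray N m r s j).star.k i = dualK (N - j) r (s + j) i := by
  rw [(hahnArray_star_agree (by omega) m r s).k_eq (show i ≤ N - j by omega),
    dualHahnArray_k h hij]

theorem dualHahnArray_star_k (h : HahnNondeg N m r s) {i j : ℕ} (hij : i + j ≤ N) :
    (dualHahnArray N m r s j).star.k i = hahnK (N - j) r (s + j) i := by
  rw [(dualHahnArray_star_agree (by omega) m r s).k_eq (show i ≤ N - j by omega),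
    hahnArray_k h hij]

theorem trinom_eq {N i j : ℕ} (hij : i + j ≤ N) :
    trinom N i j = N.choose j * (N - j).choose i := by
  rw [Nat.cast_choose ℂ (by omega : j ≤ N), Nat.cast_choose ℂ (by omega : i ≤ N - j), trinom,
    show N - j - i = N - i - j by omega]
  have h1 : ((N - j).factorial : ℂ) ≠ 0 := Nat.cast_ne_zero.2 (Nat.factorial_ne_zero _)
  field_simp

theorem trinom_swap (N i j : ℕ) : trinom N i j = trinom N j i := by
  unfold trinom
  rw [show N - i - j = N - j - i by omega]
  ring

/-- The structural form of the weight. With it, and the analogous one for `F`, the weight condition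
is a statement about the `k` alone, and the limit arguments need no closed form. -/
theorem hahnG_eq (h : HahnNondeg N m r s) (h' : HahnNondeg N μ ρ σ) {i j : ℕ} (hij : i + j ≤ N) :
    hahnG N ⟨m, r, s, μ, ρ, σ⟩ i j = (dualHahnArray N μ ρ σ 0).k j *
      (hahnArray N m r s j).k i * (hahnArray N m r s j).nu := by
  rw [dualHahnArray_k h' (by omega), hahnArray_k h hij, hahnArray_nu h (by omega)]
  unfold hahnG hahnK dualK
  rw [trinom_eq hij]
  simp only [Nat.sub_zero, Nat.cast_zero, add_zero]
  have e1 : poch (r - s - N) (N - j) = (-1) ^ (N - j) * poch (s + j - r + 1) (N - j) :=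
    poch_reflect (by rw [Nat.cast_sub (by omega)]; ring)
  have e2 : ((-1 : ℂ)) ^ N = (-1) ^ (N - j) * (-1) ^ j := by rw [← pow_add]; congr 1; omega
  have e3 : ((-1 : ℂ)) ^ (N - j) * (-1) ^ (N - j) = 1 := by
    rw [← mul_pow]; norm_num
  have h1 := (h.shift (j := j) (by omega)).poch_sr_ne le_rfl
  rw [e1, e2, show 2 + s + (j : ℂ) = s + j + 2 by ring,
    show s + (j : ℂ) + 1 + i = i + 1 + (s + j) by ring,
    show s + (j : ℂ) + 2 * i + 2 = 2 * i + 2 + (s + j) by ring]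
  have h2 : ((-1 : ℂ)) ^ (N - j) ≠ 0 := by
    intro h0
    rw [h0] at e3
    simp at e3
  generalize ((-1 : ℂ)) ^ (N - j) = ε at *
  field_simp

theorem hahnF_eq (h : HahnNondeg N m r s) (h' : HahnNondeg N μ ρ σ) {x y : ℕ} (hxy : x + y ≤ N) :
    hahnF N ⟨m, r, s, μ, ρ, σ⟩ x y = (hahnArray N m r s 0).star.k x *
      (dualHahnArray N μ ρ σ x).star.k y / (dualHahnArray N μ ρ σ x).nu := by
  rw [hahnArray_star_k h (by omega), dualHahnArray_star_k h' (by omega),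
    dualHahnArray_nu h' (by omega)]
  unfold hahnF hahnK dualK
  rw [trinom_swap, trinom_eq (by omega)]
  simp only [Nat.sub_zero, Nat.cast_zero, add_zero]
  have e1 : poch (ρ - N - σ) (N - x - y) =
      (-1) ^ (N - x - y) * poch (σ + x - ρ + 1 + y) (N - x - y) :=
    poch_reflect (by rw [Nat.cast_sub (by omega), Nat.cast_sub (by omega)]; ring)
  have e2 : ((-1 : ℂ)) ^ (N - y) = (-1) ^ (N - x - y) * (-1) ^ x := by
    rw [← pow_add]; congr 1; omega
  have e3 : ((-1 : ℂ)) ^ (N - x - y) * (-1) ^ (N - x - y) = 1 := by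
    rw [← mul_pow]; norm_num
  have e4 : poch (σ + x - ρ + 1) (N - x) =
      poch (σ + x - ρ + 1) y * poch (σ + x - ρ + 1 + y) (N - x - y) := by
    rw [← poch_add]; congr 1; omega
  have h1 := (h'.shift (j := x) (by omega)).poch_s_ne le_rfl
  have h2 := (h'.shift (j := x) (by omega)).poch_sr_ne (i := y) (by omega)
  rw [e1, e2, e4, show σ + (x : ℂ) + y + 1 = y + 1 + (σ + x) by ring,
    show σ + (x : ℂ) + 2 * y + 2 = 2 * y + 2 + (σ + x) by ring]
  generalize ((-1 : ℂ)) ^ (N - x - y) = ε at *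
  generalize poch (σ + x - ρ + 1) y = a at *
  generalize poch (σ + x + 2) (N - x) = b at *
  field_simp
  rw [show ε ^ 2 = 1 by rw [sq, e3], mul_one]

/-- The Pochhammer denominators depend only on `ρ - σ - N` and `r - s - N`. What is left is `C(N-x,
j) C(N, x) = C(N, j) C(N-j, x)`, two readings of one trinomial coefficient. -/
theorem dualK_mul_dualK {x j : ℕ} (hxj : x + j ≤ N) :
    dualK (N - x) ρ (σ + x) j * dualK N r s x = dualK N ρ σ j * dualK (N - j) r (s + j) x := by
  unfold dualK
  rw [Nat.cast_sub (by omega), Nat.cast_sub (by omega),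
    show ρ - (σ + x) - (N - x : ℂ) = ρ - σ - N by ring,
    show r - (s + j) - (N - j : ℂ) = r - s - N by ring]
  have e := (trinom_eq (N := N) (i := x) (j := j) hxj).symm.trans
    ((trinom_swap N x j).trans (trinom_eq (by omega)))
  rw [div_mul_div_comm, div_mul_div_comm]
  congr 1
  linear_combination -(-1) ^ j * (-1) ^ x * poch (ρ + 1) j * poch (r + 1) x * e

theorem hahn_solvesFG (h : HahnNondeg N m r s) (h' : HahnNondeg N μ ρ σ) :
    SolvesFG N (hahnArray N m r s) (dualHahnArray N μ ρ σ) (hahnF N ⟨m, r, s, μ, ρ, σ⟩)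
      (hahnG N ⟨m, r, s, μ, ρ, σ⟩) := by
  have hG := hahn_goodFamilies h h'
  constructor
  · intro x y hxy
    rw [hahnF_eq h h' hxy]
    exact div_ne_zero (mul_ne_zero ((hG.goodΦ 0 (by omega)).star.k_ne (show x ≤ N by omega))
      ((hG.goodΨ x (by omega)).star.k_ne (show y ≤ N - x by omega)))
      (hG.goodΨ x (by omega)).nu_ne
  · intro i j x y hij hxy hxj
    have h1 := (hG.goodΦ j (by omega)).star.k_ne (show x ≤ N - j by omega)
    have h2 := (hG.goodΨ x (by omega)).star.k_ne (show y ≤ N - x by omega)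
    have h3 := (hG.goodΨ x (by omega)).nu_ne
    have h4 := (hG.goodΦ j (by omega)).nu_ne
    rw [hahnF_eq h h' hxy, hahnG_eq h h' hij]
    have e := dualK_mul_dualK (r := r) (s := s) (ρ := ρ) (σ := σ) hxj
    have e1 := hahnArray_star_k h (show x + 0 ≤ N by omega)
    have e2 := dualHahnArray_k h' (show j + 0 ≤ N by omega)
    simp only [Nat.sub_zero, Nat.cast_zero, add_zero] at e1 e2
    rw [← e1, ← e2, ← dualHahnArray_k h' (by omega), ← hahnArray_star_k h (by omega)] at e
    field_simp
    linear_combination (hahnArray N m r s j).k i * e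

end Hahn

/-! ### Hypergeometric form of `T` -/

theorem poch_neg_of_lt {i k : ℕ} (h : i < k) : poch (-(i : ℂ)) k = 0 :=
  Finset.prod_eq_zero (Finset.mem_range.2 h) (by simp)

theorem poch_neg (a : ℂ) (k : ℕ) :
    ∏ j ∈ Finset.range k, (a - j) = (-1) ^ k * poch (-a) k := by
  unfold poch
  rw [← Finset.card_range k, ← Finset.prod_const, Finset.card_range, ← Finset.prod_mul_distrib]
  exact Finset.prod_congr rfl fun j _ => by ring

theorem quadFact_eq_poch (s i : ℂ) (k : ℕ) :
    quadFact s i k = (-1) ^ k * poch (-i) k * poch (i + 1 + s) k := by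
  rw [quadFact, Finset.prod_mul_distrib, poch_neg]
  congr 1
  exact Finset.prod_congr rfl fun j _ => by ring

theorem hahnTau_eq_poch (d r x : ℂ) (k : ℕ) :
    hahnTau d r x k =
      (-1) ^ k * poch (-x) k / (poch (r + 1) k * poch (-d) k * (k.factorial : ℂ)) := by
  rw [hahnTau, Finset.prod_div_distrib, poch_neg, Finset.prod_mul_distrib,
    Finset.prod_mul_distrib, prod_range_add_one_cast]
  congr 1
  rw [mul_assoc, mul_comm, mul_comm (Finset.prod _ _)]
  congr 2 <;> exact Finset.prod_congr rfl fun j _ => by ring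

theorem hahnTau_mul_quadFact (d r s x i : ℂ) (k : ℕ) : hahnTau d r x k * quadFact s i k =
    poch (-i) k * poch (i + 1 + s) k * poch (-x) k /
      (poch (r + 1) k * poch (-d) k * (k.factorial : ℂ)) * 1 ^ k := by
  rw [hahnTau_eq_poch, quadFact_eq_poch, one_pow, mul_one, div_mul_eq_mul_div]
  congr 1
  have : ((-1 : ℂ)) ^ k * (-1) ^ k = 1 := by rw [← mul_pow]; norm_num
  linear_combination poch (-i) k * poch (i + 1 + s) k * poch (-x) k * this

/-- The series stops since `(-i)_k = 0` for `k > i`; this also disposes of the later terms whose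
denominators vanish. -/
theorem sum_eq_hyp3F2_left (d r s x : ℂ) {i n : ℕ} (hi : i ≤ n) :
    ∑ k ∈ Finset.range (n + 1), hahnTau d r x k * quadFact s i k =
      hyp3F2 (-i) (i + 1 + s) (-x) (r + 1) (-d) 1 := by
  unfold hyp3F2
  rw [tsum_eq_sum (s := Finset.range (n + 1))]
  · exact Finset.sum_congr rfl fun k _ => hahnTau_mul_quadFact _ _ _ _ _ _
  · intro k hk
    rw [poch_neg_of_lt (by rw [Finset.mem_range] at hk; omega)]
    simp

theorem sum_eq_hyp3F2_right (d r s : ℂ) {j y n : ℕ} (hy : y ≤ n) :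
    ∑ k ∈ Finset.range (n + 1), hahnTau d r j k * quadFact s y k =
      hyp3F2 (-j) (-y) (y + 1 + s) (r + 1) (-d) 1 := by
  rw [sum_eq_hyp3F2_left d r s j hy]
  unfold hyp3F2
  exact tsum_congr fun k => by ring

section Hahn

variable {N : ℕ} {m r s μ ρ σ : ℂ}

theorem tratnik_hahn (h : HahnNondeg N m r s) (h' : HahnNondeg N μ ρ σ) {i j x y : ℕ}
    (hij : i + j ≤ N) (hxy : x + y ≤ N) :
    tratnik (hahnArray N m r s) (dualHahnArray N μ ρ σ) i j x y =
      hahnT N ⟨m, r, s, μ, ρ, σ⟩ i j x y := by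
  unfold tratnik
  by_cases hxj : x + j ≤ N
  · have e1 : (hahnArray N m r s j).p x i = hahnK (N - j) r (s + j) i *
        hyp3F2 (-i) (i + 1 + s + j) (-x) (r + 1) (-N + j) 1 := by
      rw [hahnArray_eq (by omega), hahnBase_p (h.shift (by omega)) (by omega) (by omega) le_rfl,
        sum_eq_hyp3F2_left _ _ _ _ le_rfl, Nat.cast_sub (by omega), neg_sub', sub_neg_eq_add,
        add_assoc ((i : ℂ) + 1)]
    have e2 : (dualHahnArray N μ ρ σ x).p y j = dualK (N - x) ρ (σ + x) j *
        hyp3F2 (-j) (-y) (y + 1 + σ + x) (ρ + 1) (-N + x) 1 := by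
      have h1 := h'.shift (j := x) (by omega)
      rw [dualHahnArray_eq (by omega), ParamArray.p_of_le (show y ≤ N - x by omega)
        (show j ≤ N - x by omega), dualBase_k h1 (by omega), ParamArray.u_star,
        (dualBase_star_agree _ _ _ _).u_eq (show y ≤ N - x by omega),
        hahnBase_u h1.1 le_rfl]
      rw [show (dualBase (N - x) μ ρ (σ + x)).dev j = (j : ℂ) from rfl,
        sum_eq_hyp3F2_right _ _ _ le_rfl, Nat.cast_sub (by omega), neg_sub', sub_neg_eq_add,
        add_assoc ((y : ℂ) + 1)]
    rw [e1, e2]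
    unfold hahnT hahnK dualK
    simp only
    rw [Nat.cast_sub (show x ≤ N by omega), show ρ - (σ + x) - (N - x : ℂ) = ρ - σ - N by ring,
      show s + (j : ℂ) + 2 = 2 + s + j by ring, show (i : ℂ) + 1 + (s + j) = s + j + 1 + i by ring,
      show 2 * (i : ℂ) + 2 + (s + j) = s + j + 2 * i + 2 by ring]
    ring
  -- For `x + j > N` both sides are zero, on the right because `C(N - x, j) = 0`.
  · rw [ParamArray.p_of_lt_left (by change N - j < x; omega), zero_mul]
    unfold hahnT
    rw [Nat.choose_eq_zero_of_lt (show N - x < j by omega)]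
    simp

end Hahn

/-! ### Degrees of bivariate Newton expansions -/

section NewtonDegree

open Polynomial in
theorem natDegree_newton (a c : ℕ → ℂ) (n : ℕ) (hc : c n ≠ 0) :
    (∑ k ∈ Finset.range (n + 1), C (c k) * ∏ j ∈ Finset.range k, (X - C (a j))).natDegree = n := by
  have hdeg : ∀ k, (C (c k) * ∏ j ∈ Finset.range k, (X - C (a j))).natDegree ≤ k := fun k => by
    refine (natDegree_C_mul_le _ _).trans ?_
    rw [natDegree_prod_of_monic _ _ fun j _ => monic_X_sub_C _]
    simp
  refine natDegree_eq_of_le_of_coeff_ne_zero (natDegree_sum_le_of_forall_le _ _ fun k hk =>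
    (hdeg k).trans (by rw [Finset.mem_range] at hk; omega)) ?_
  rw [finsetSum_coeff, Finset.sum_range_succ, Finset.sum_eq_zero fun k hk => ?_, zero_add,
    coeff_C_mul]
  · have hm : (∏ j ∈ Finset.range n, (X - C (a j))).Monic :=
      monic_prod_of_monic _ _ fun j _ => monic_X_sub_C _
    have hn : (∏ j ∈ Finset.range n, (X - C (a j))).natDegree = n := by
      rw [natDegree_prod_of_monic _ _ fun j _ => monic_X_sub_C _]
      simp
    have := hm.coeff_natDegree
    rw [hn] at this
    rwa [this, mul_one]
  · rw [Finset.mem_range] at hk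
    exact coeff_eq_zero_of_natDegree_lt ((hdeg k).trans_lt hk)

open MvPolynomial

/-- Setting the other variable to zero cannot raise the degree. It is used to bound `degreeOf` from
below by a one-variable leading coefficient. -/
theorem natDegree_aeval_le_degreeOf (P : MvPolynomial (Fin 2) ℂ) (k : Fin 2) :
    (aeval (Pi.single k (Polynomial.X : Polynomial ℂ)) P).natDegree ≤ P.degreeOf k := by
  rw [aeval_def, eval₂_eq']
  refine Polynomial.natDegree_sum_le_of_forall_le _ _ fun m hm => ?_
  rw [← Polynomial.C_eq_algebraMap]
  refine (Polynomial.natDegree_C_mul_le _ _).trans ?_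
  refine (Polynomial.natDegree_prod_le _ _).trans ?_
  rw [Finset.sum_eq_single k]
  · rw [Pi.single_eq_same, Polynomial.natDegree_X_pow]
    exact monomial_le_degreeOf k hm
  · intro l _ hl
    rw [Pi.single_eq_of_ne hl]
    refine Nat.eq_zero_of_le_zero (Polynomial.natDegree_pow_le.trans ?_)
    simp
  · simp

theorem totalDegree_prod_le_card {ι : Type*} (s : Finset ι) (f : ι → MvPolynomial (Fin 2) ℂ)
    (h : ∀ k ∈ s, (f k).totalDegree ≤ 1) : (∏ k ∈ s, f k).totalDegree ≤ s.card := by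
  refine (totalDegree_finsetProd _ _).trans ?_
  simpa using Finset.sum_le_card_nsmul s _ 1 h

theorem totalDegree_C_sub_mul_X_le (a b : ℂ) (k : Fin 2) :
    (C a - C b * X k : MvPolynomial (Fin 2) ℂ).totalDegree ≤ 1 := by
  refine (totalDegree_sub _ _).trans (max_le (by simp) ?_)
  refine (totalDegree_mul _ _).trans ?_
  simp

theorem totalDegree_X_sub_C_le (a : ℂ) (k : Fin 2) :
    (X k - C a : MvPolynomial (Fin 2) ℂ).totalDegree ≤ 1 :=
  (totalDegree_sub _ _).trans (max_le (by simp) (by simp))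

theorem totalDegree_linear_le (a b : ℂ) :
    (X 1 - (C a + C b * X 0) : MvPolynomial (Fin 2) ℂ).totalDegree ≤ 1 := by
  refine (totalDegree_sub _ _).trans (max_le (by simp) ?_)
  refine (totalDegree_add _ _).trans (max_le (by simp) ?_)
  refine (totalDegree_mul _ _).trans ?_
  simp

/-- A polynomial of degree `n` in the first variable only. -/
theorem exists_newton_first (a c : ℕ → ℂ) (n : ℕ) (hc : c n ≠ 0) :
    ∃ P : MvPolynomial (Fin 2) ℂ, P ≠ 0 ∧ P.totalDegree = n ∧ P.degreeOf 1 = 0 ∧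
      ∀ v : Fin 2 → ℂ, eval v P =
        ∑ k ∈ Finset.range (n + 1), c k * ∏ j ∈ Finset.range k, (v 0 - a j) := by
  set P : MvPolynomial (Fin 2) ℂ :=
    ∑ k ∈ Finset.range (n + 1), C (c k) * ∏ j ∈ Finset.range k, (X 0 - C (a j)) with hP
  have h1 : P.totalDegree ≤ n := by
    refine totalDegree_finsetSum_le fun k hk => ?_
    refine (totalDegree_mul _ _).trans ?_
    rw [totalDegree_C, zero_add]
    refine (totalDegree_prod_le_card _ _ fun j _ => totalDegree_X_sub_C_le _ _).trans ?_
    rw [Finset.card_range]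
    exact Finset.mem_range_succ_iff.1 hk
  have h5 : aeval (Pi.single 0 (Polynomial.X : Polynomial ℂ)) P =
      ∑ k ∈ Finset.range (n + 1),
        Polynomial.C (c k) * ∏ j ∈ Finset.range k, (Polynomial.X - Polynomial.C (a j)) := by
    simp [hP, Polynomial.C_eq_algebraMap]
  have h2 : n ≤ P.degreeOf 0 := by
    refine le_trans (le_of_eq ?_) (natDegree_aeval_le_degreeOf P 0)
    rw [h5, natDegree_newton a c n hc]
  have h3 : ∀ v : Fin 2 → ℂ, eval v P =
      ∑ k ∈ Finset.range (n + 1), c k * ∏ j ∈ Finset.range k, (v 0 - a j) := fun v => by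
    simp [hP]
  refine ⟨P, fun h0 => ?_, le_antisymm h1 (h2.trans (degreeOf_le_totalDegree _ _)), ?_, h3⟩
  · have h4 := natDegree_newton a c n hc
    rw [h0, map_zero] at h5
    have h7 : (∑ k ∈ Finset.range (n + 1), Polynomial.C (c k) *
        ∏ j ∈ Finset.range k, (Polynomial.X - Polynomial.C (a j))) = 0 := h5.symm
    have h8 : n = 0 := by rw [← h4, h7, Polynomial.natDegree_zero]
    subst h8
    simp at h7
    exact hc h7
  · refine Nat.eq_zero_of_le_zero ((degreeOf_sum_le _ _ _).trans ?_)
    refine Finset.sup_le fun k _ => (degreeOf_C_mul_le _ _ _).trans ?_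
    refine (degreeOf_prod_le _ _ _).trans (le_of_eq (Finset.sum_eq_zero fun j _ => ?_))
    refine Nat.eq_zero_of_le_zero ((degreeOf_sub_le _ _ _).trans (max_le ?_ ?_))
    · rw [degreeOf_X_of_ne (by decide)]
    · rw [degreeOf_C]

/-- A polynomial of total degree `n` and of degree `n` in the second variable. -/
theorem exists_newton_second (M : ℂ) (α β c : ℕ → ℂ) (n : ℕ) (hc : c n ≠ 0) :
    ∃ P : MvPolynomial (Fin 2) ℂ, P ≠ 0 ∧ P.totalDegree = n ∧ P.degreeOf 1 = n ∧
      ∀ v : Fin 2 → ℂ, eval v P = ∑ k ∈ Finset.range (n + 1), c k *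
        ((∏ j ∈ Finset.Ico k n, (M - j - v 0)) *
          ∏ j ∈ Finset.range k, (v 1 - (α j + β j * v 0))) := by
  set P : MvPolynomial (Fin 2) ℂ := ∑ k ∈ Finset.range (n + 1), C (c k) *
    ((∏ j ∈ Finset.Ico k n, (C (M - j) - C 1 * X 0)) *
      ∏ j ∈ Finset.range k, (X 1 - (C (α j) + C (β j) * X 0))) with hP
  have h1 : P.totalDegree ≤ n := by
    refine totalDegree_finsetSum_le fun k hk => ?_
    refine (totalDegree_mul _ _).trans ?_
    rw [totalDegree_C, zero_add]
    refine (totalDegree_mul _ _).trans ?_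
    have e1 := totalDegree_prod_le_card (Finset.Ico k n)
      (fun j => (C (M - j) - C 1 * X 0 : MvPolynomial (Fin 2) ℂ))
      fun j _ => totalDegree_C_sub_mul_X_le _ _ _
    have e2 := totalDegree_prod_le_card (Finset.range k)
      (fun j => (X 1 - (C (α j) + C (β j) * X 0) : MvPolynomial (Fin 2) ℂ))
      fun j _ => totalDegree_linear_le _ _
    rw [Nat.card_Ico] at e1
    rw [Finset.card_range] at e2
    have := Finset.mem_range_succ_iff.1 hk
    omega
  -- At first variable zero the polynomial is a Newton sum of degree `n`; the leading coefficient `c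
  -- n` is unaffected, as the product over `Ico n n` is empty.
  have h4 : (aeval (Pi.single 1 (Polynomial.X : Polynomial ℂ)) P).natDegree = n := by
    have hc' : c n * ∏ j ∈ Finset.Ico n n, (M - j) ≠ 0 := by simpa using hc
    rw [hP]
    conv_rhs => rw [← natDegree_newton α (fun k => c k * ∏ j ∈ Finset.Ico k n, (M - j)) n hc']
    congr 1
    rw [map_sum]
    refine Finset.sum_congr rfl fun k _ => ?_
    rw [map_mul, map_mul, map_prod, map_prod, Polynomial.C_mul, Polynomial.C_eq_algebraMap, mul_assoc]
    simp
  have h2 : n ≤ P.degreeOf 1 := h4.symm.le.trans (natDegree_aeval_le_degreeOf P 1)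
  have h3 : P.degreeOf 1 ≤ P.totalDegree := degreeOf_le_totalDegree _ _
  refine ⟨P, fun h0 => ?_, by omega, by omega, fun v => by simp [hP]⟩
  have hn : n = 0 := by
    rw [h0, map_zero, Polynomial.natDegree_zero] at h4
    exact h4.symm
  subst hn
  rw [hP] at h0
  simp at h0
  exact hc h0

end NewtonDegree

/-- The data of a family `(Ψ_x)` of dual Hahn or Krawtchouk type. -/
structure IsDualHahnType (N : ℕ) (Ψ : ℕ → ParamArray) (α β f g : ℕ → ℂ) : Prop where
  diam : ∀ x ≤ N, (Ψ x).diam = N - x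
  ev : ∀ x ≤ N, ∀ k, (Ψ x).ev k = α k + β k * x
  dev : ∀ x ≤ N, ∀ k, (Ψ x).dev k = k
  fst : ∀ x ≤ N, ∀ k, (Ψ x).fst k = k * (k - N + x - 1) * f k
  snd : ∀ x ≤ N, ∀ k, (Ψ x).snd k = k * (k - N + x - 1) * g k
  f_ne : ∀ k, 1 ≤ k → k ≤ N → f k ≠ 0
  g_ne : ∀ k, 1 ≤ k → k ≤ N → g k ≠ 0

section Degree

variable {N : ℕ} {Ψ : ℕ → ParamArray} {α β f g : ℕ → ℂ}

theorem prod_Icc_sub_cast (j e : ℕ) :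
    ∏ h ∈ Finset.Icc (j + 1) e, ((j : ℂ) - h) = (-1) ^ (e - j) * (e - j).factorial := by
  rw [prod_Icc_shift (fun h => (j : ℂ) - h)]
  trans ∏ t ∈ Finset.range (e - j), ((-1) * ((t : ℂ) + 1))
  · refine Finset.prod_congr rfl fun t _ => ?_
    push_cast
    ring
  · simp only [Finset.prod_mul_distrib, prod_range_add_one_cast, Finset.prod_const,
      Finset.card_range]

/-- Here `k_j(Ψ_x)` depends on `x` only through a polynomial of degree `j`, the falling factorial of
`N - x`. -/
theorem IsDualHahnType.k_eq (h : IsDualHahnType N Ψ α β f g) {x j : ℕ} (hxj : x + j ≤ N) :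
    (Ψ x).k j = (∏ h ∈ Finset.Icc 1 j, f h / g h) * ((-1) ^ j / j.factorial) *
      ∏ k ∈ Finset.range j, ((N : ℂ) - k - x) := by
  obtain ⟨e, rfl⟩ : ∃ e, N = e + x := ⟨N - x, by omega⟩
  have hx : x ≤ e + x := by omega
  have hd : (Ψ x).diam = e := by rw [h.diam x hx]; omega
  have hje : j ≤ e := by omega
  unfold ParamArray.k
  rw [hd, ParamArray.prod_split_index _ hje]
  simp only [h.dev x hx]
  rw [prod_range_sub_cast, prod_Icc_sub_cast j e, prod_Icc_sub_cast 0 e, Nat.sub_zero]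
  have e1 : ∏ k ∈ Finset.Icc 1 j, (Ψ x).fst k / (Ψ x).snd k = ∏ k ∈ Finset.Icc 1 j, f k / g k := by
    refine Finset.prod_congr rfl fun k hk => ?_
    rw [Finset.mem_Icc] at hk
    rw [h.fst x hx, h.snd x hx, mul_div_mul_left]
    refine mul_ne_zero (natCast_pos_ne hk.1) ?_
    have := natCast_sub_sub_one_ne (i := k) (d := e) (by omega)
    push_cast
    intro h0
    exact this (by linear_combination h0)
  have e2 : (∏ k ∈ Finset.range j, (((e + x : ℕ) : ℂ) - k - x)) * (e - j).factorial =
      e.factorial := by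
    trans (∏ k ∈ Finset.range j, ((e : ℂ) - k)) * (e - j).factorial
    · congr 1
      exact Finset.prod_congr rfl fun k _ => by push_cast; ring
    · rw [Finset.prod_range_natCast_sub, ← Nat.descFactorial_eq_prod_range,
        ← Nat.cast_mul, mul_comm, Nat.factorial_mul_descFactorial hje]
  rw [e1, ← e2]
  have h1 : ((e - j).factorial : ℂ) ≠ 0 := Nat.cast_ne_zero.2 (Nat.factorial_ne_zero _)
  have h2 : (j.factorial : ℂ) ≠ 0 := Nat.cast_ne_zero.2 (Nat.factorial_ne_zero _)
  have h3 : ((-1 : ℂ)) ^ e = (-1) ^ (e - j) * (-1) ^ j := by rw [← pow_add]; congr 1; omega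
  have h4 : ((-1 : ℂ)) ^ (e - j) ≠ 0 := pow_ne_zero _ (by norm_num)
  rw [h3]
  generalize ((-1 : ℂ)) ^ (e - j) = ε at *
  field_simp

/-- The denominators in `u_j` contribute the first `n` factors `N - k - x`, and these divide the
falling factorial in `k_j`. Each term `n` is thus a polynomial of total degree at most `j`, and only
`n = j` has degree `j` in the second variable. -/
theorem IsDualHahnType.exists_poly (h : IsDualHahnType N Ψ α β f g) {j : ℕ} (hj : j ≤ N) :
    ∃ P : MvPolynomial (Fin 2) ℂ, P ≠ 0 ∧ P.totalDegree = j ∧ P.degreeOf 1 = j ∧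
      ∀ x y, x + y ≤ N → (Ψ x).p y j = MvPolynomial.eval ![(x : ℂ), (Ψ x).ev y] P := by
  set c : ℕ → ℂ := fun n => (∏ h ∈ Finset.Icc 1 j, f h / g h) * ((-1) ^ j / j.factorial) *
    ∏ k ∈ Finset.range n, (-((j : ℂ) - k) / ((k + 1) * f (k + 1))) with hc
  have hcj : c j ≠ 0 := by
    refine mul_ne_zero (mul_ne_zero (Finset.prod_ne_zero_iff.2 fun k hk => ?_)
      (div_ne_zero (pow_ne_zero _ (by norm_num)) (Nat.cast_ne_zero.2 (Nat.factorial_ne_zero _))))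
      (Finset.prod_ne_zero_iff.2 fun k hk => ?_)
    · rw [Finset.mem_Icc] at hk
      exact div_ne_zero (h.f_ne k hk.1 (by omega)) (h.g_ne k hk.1 (by omega))
    · rw [Finset.mem_range] at hk
      exact div_ne_zero (neg_ne_zero.2 (natCast_sub_natCast_ne (by omega)))
        (mul_ne_zero (Nat.cast_add_one_ne_zero k) (h.f_ne _ (by omega) (by omega)))
  obtain ⟨P, h1, h2, h3, h4⟩ := exists_newton_second N α β c j hcj
  refine ⟨P, h1, h2, h3, fun x y hxy => ?_⟩
  have hx : x ≤ N := by omega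
  rw [h4]
  simp only [Matrix.cons_val_zero, Matrix.cons_val_one]
  have hev : ∀ n, ∏ k ∈ Finset.range n, ((Ψ x).ev y - (α k + β k * x)) =
      ∏ k ∈ Finset.range n, ((Ψ x).ev y - (Ψ x).ev k) := fun n =>
    Finset.prod_congr rfl fun k _ => by rw [h.ev x hx k]
  simp only [hev]
  by_cases hxj : x + j ≤ N
  · rw [ParamArray.p_of_le (by rw [h.diam x hx]; omega) (by rw [h.diam x hx]; omega),
      h.k_eq hxj, ParamArray.u, Finset.mul_sum]
    refine Finset.sum_congr rfl fun n hn => ?_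
    rw [Finset.mem_range] at hn
    have hne : ∏ k ∈ Finset.range n, ((N : ℂ) - k - x) ≠ 0 :=
      Finset.prod_ne_zero_iff.2 fun k hk => by
        rw [Finset.mem_range] at hk
        have := natCast_sub_natCast_ne (i := N) (j := k + x) (by omega)
        push_cast at this
        rwa [sub_sub]
    have e1 : ∏ k ∈ Finset.range n, (((Ψ x).ev y - (Ψ x).ev k) * ((Ψ x).dev j - (Ψ x).dev k) /
        (Ψ x).fst (k + 1)) = (∏ k ∈ Finset.range n, ((Ψ x).ev y - (Ψ x).ev k)) *
        (∏ k ∈ Finset.range n, (-((j : ℂ) - k) / ((k + 1) * f (k + 1)))) /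
          ∏ k ∈ Finset.range n, ((N : ℂ) - k - x) := by
      rw [← Finset.prod_mul_distrib, ← Finset.prod_div_distrib]
      refine Finset.prod_congr rfl fun k hk => ?_
      rw [h.dev x hx, h.dev x hx, h.fst x hx]
      push_cast
      rw [show ((k : ℂ) + 1) * (k + 1 - N + x - 1) * f (k + 1) =
        -(((k + 1) * f (k + 1)) * (N - k - x)) by ring]
      simp only [div_eq_mul_inv, mul_inv, inv_neg]
      ring
    rw [e1, ← Finset.prod_range_mul_prod_Ico (fun k : ℕ => (N : ℂ) - k - x) (by omega : n ≤ j)]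
    simp only [hc]
    field_simp
  -- If `x + j > N` the coefficient is zero by convention, and so is the polynomial: for `n ≤ N - x`
  -- the factor with `k = N - x` vanishes, otherwise the factor with `k = y`.
  · rw [ParamArray.p_of_lt_right (by rw [h.diam x hx]; omega)]
    refine (Finset.sum_eq_zero fun n hn => ?_).symm
    rw [Finset.mem_range] at hn
    by_cases hnx : n ≤ N - x
    · rw [Finset.prod_eq_zero (i := N - x) (s := Finset.Ico n j) (by rw [Finset.mem_Ico]; omega)]
      · simp
      · rw [Nat.cast_sub hx]; ring
    · rw [Finset.prod_eq_zero (i := y) (s := Finset.range n) (by rw [Finset.mem_range]; omega)]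
      · simp
      · exact sub_self _

theorem ParamArray.Nondeg.exists_poly {Φ : ParamArray} (h : Φ.Nondeg) {i : ℕ}
    (hi : i ≤ Φ.diam) :
    ∃ P : MvPolynomial (Fin 2) ℂ, P ≠ 0 ∧ P.totalDegree = i ∧ P.degreeOf 1 = 0 ∧
      ∀ v : Fin 2 → ℂ, ∀ x ≤ Φ.diam, v 0 = Φ.ev x → MvPolynomial.eval v P = Φ.p x i := by
  set c : ℕ → ℂ := fun n => Φ.k i * ∏ j ∈ Finset.range n, ((Φ.dev i - Φ.dev j) / Φ.fst (j + 1))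
    with hc
  have hci : c i ≠ 0 := mul_ne_zero (h.k_ne hi) (Finset.prod_ne_zero_iff.2 fun k hk => by
    rw [Finset.mem_range] at hk
    exact div_ne_zero (sub_ne_zero.2 (h.dev_ne _ _ hi (by omega) (by omega)))
      (h.fst_ne _ (by omega) (by omega)))
  obtain ⟨P, h1, h2, h3, h4⟩ := exists_newton_first Φ.ev c i hci
  refine ⟨P, h1, h2, h3, fun v x hx hv => ?_⟩
  rw [h4, hv, ParamArray.p_of_le hx hi, ParamArray.u, Finset.mul_sum]
  refine Finset.sum_congr rfl fun n _ => ?_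
  simp only [hc]
  rw [mul_assoc, ← Finset.prod_mul_distrib]
  congr 1
  exact Finset.prod_congr rfl fun k _ => by ring

/-- Degrees add under multiplication in a domain. For `x + j > N` the polynomial of `Φ_j` is not
tied to any coefficient, but the factor of `Ψ_x` already vanishes. -/
theorem IsDualHahnType.degree {Φ : ℕ → ParamArray} (h : IsDualHahnType N Ψ α β f g)
    (hG : GoodFamilies N Φ Ψ) (ht : ∀ x ≤ N, (Φ 0).ev x = x) (i j : ℕ) (hij : i + j ≤ N) :
    ∃ P : MvPolynomial (Fin 2) ℂ, P.totalDegree = i + j ∧ P.degreeOf 1 = j ∧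
      ∀ x y, x + y ≤ N → tratnik Φ Ψ i j x y = MvPolynomial.eval ![(Φ 0).ev x, (Ψ x).ev y] P := by
  have hd := hG.diamΦ j (by omega)
  obtain ⟨P, hP, hP1, hP2, hP3⟩ := (hG.goodΦ j (by omega)).toNondeg.exists_poly (i := i) (by omega)
  obtain ⟨Q, hQ, hQ1, hQ2, hQ3⟩ := h.exists_poly (j := j) (by omega)
  refine ⟨P * Q, ?_, ?_, fun x y hxy => ?_⟩
  · rw [MvPolynomial.totalDegree_mul_of_isDomain hP hQ, hP1, hQ1]
  · rw [MvPolynomial.degreeOf_mul_eq hP hQ, hP2, hQ2, zero_add]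
  · rw [map_mul, ht x (by omega), ← hQ3 x y hxy, tratnik]
    by_cases hxj : x + j ≤ N
    · rw [hP3 _ x (by omega)]
      rw [Matrix.cons_val_zero, hG.ev_eq x j hxj, ht x (by omega)]
    · rw [ParamArray.p_of_lt_right (Φ := Ψ x) (by rw [h.diam x (by omega)]; omega), mul_zero,
        mul_zero]

end Degree

theorem dualHahn_isDualHahnType {N : ℕ} {μ ρ σ : ℂ} (h : HahnNondeg N μ ρ σ) :
    IsDualHahnType N (dualHahnArray N μ ρ σ) (fun k => μ * k * (k + 1 + σ)) (fun k => μ * k)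
      (fun k => μ * (k + ρ)) (fun k => μ * (k + ρ - σ - N - 1)) where
  diam _ _ := rfl
  ev x _ k := by simp only [dualHahnArray]; ring
  dev _ _ _ := rfl
  fst x _ k := by simp only [dualHahnArray]; ring
  snd x _ k := by simp only [dualHahnArray]; ring
  f_ne k h1 hk := mul_ne_zero h.1 (h.r_ne k h1 hk (by ring))
  -- The factor `k + ρ - σ - N - 1` is minus `σ - ρ + n` with `n = N + 1 - k`.
  g_ne k h1 hk := mul_ne_zero h.1 fun h0 =>
    h.sr_ne (N + 1 - k) (by omega) (by omega) rfl (by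
      rw [Nat.cast_sub (by omega)]
      push_cast
      linear_combination -h0)

theorem krawtchouk_isDualHahnType {N : ℕ} {ρ : ℂ} (h0 : ρ ≠ 0) (h1 : ρ ≠ 1) :
    IsDualHahnType N (krawtchoukArray N ρ) (fun k => k) (fun _ => 0)
      (fun _ => ρ) (fun _ => ρ - 1) where
  diam _ _ := rfl
  ev x _ k := by simp only [krawtchoukArray]; ring
  dev _ _ _ := rfl
  fst x _ k := by simp only [krawtchoukArray]; ring
  snd x _ k := by simp only [krawtchoukArray]; ring
  f_ne _ _ _ := h0
  g_ne _ _ _ := sub_ne_zero.2 h1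

/-! ### Passage to the limit in arrays and families -/

section Limits

variable {α : Type*} {l : Filter α} {Φa : α → ParamArray} {Φ : ParamArray}

theorem TendstoArray.const (Φ : ParamArray) : TendstoArray l (fun _ => Φ) Φ :=
  ⟨fun _ => rfl, fun _ _ => tendsto_const_nhds, fun _ _ => tendsto_const_nhds,
    fun _ _ _ => tendsto_const_nhds, fun _ _ _ => tendsto_const_nhds⟩

theorem TendstoArray.comp {β : Type*} {l' : Filter β} {g : β → α} (h : TendstoArray l Φa Φ)
    (hg : Filter.Tendsto g l' l) : TendstoArray l' (fun b => Φa (g b)) Φ :=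
  ⟨fun _ => h.diam _, fun i hi => (h.ev i hi).comp hg, fun i hi => (h.dev i hi).comp hg,
    fun i h1 hi => (h.fst i h1 hi).comp hg, fun i h1 hi => (h.snd i h1 hi).comp hg⟩

theorem TendstoArray.star (h : TendstoArray l Φa Φ) :
    TendstoArray l (fun a => (Φa a).star) Φ.star where
  diam := h.diam
  ev := h.dev
  dev := h.ev
  fst := h.fst
  snd i h1 hi := by
    have hi : i ≤ Φ.diam := hi
    simp only [ParamArray.star, h.diam]
    exact h.snd _ (by omega) (by omega)

theorem TendstoArray.dev_sub (h : TendstoArray l Φa Φ) {i j : ℕ} (hi : i ≤ Φ.diam)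
    (hj : j ≤ Φ.diam) :
    Filter.Tendsto (fun a => (Φa a).dev i - (Φa a).dev j) l (𝓝 (Φ.dev i - Φ.dev j)) :=
  (h.dev i hi).sub (h.dev j hj)

theorem TendstoArray.prod_dev (h : TendstoArray l Φa Φ) {i : ℕ} (hi : i ≤ Φ.diam) (s : Finset ℕ)
    (f : ℕ → ℕ) (hs : ∀ k ∈ s, f k ≤ Φ.diam) :
    Filter.Tendsto (fun a => ∏ k ∈ s, ((Φa a).dev i - (Φa a).dev (f k))) l
      (𝓝 (∏ k ∈ s, (Φ.dev i - Φ.dev (f k)))) :=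
  tendsto_finsetProd s fun k hk => h.dev_sub hi (hs k hk)

/-- Only the limit array has to be nondegenerate: its nonzero denominators make the quotient
continuous. The same holds for the other quantities below. -/
theorem TendstoArray.b (h : TendstoArray l Φa Φ) (hn : Φ.Nondeg) (i : ℕ) :
    Filter.Tendsto (fun a => (Φa a).b i) l (𝓝 (Φ.b i)) := by
  unfold ParamArray.b
  simp only [h.diam]
  split_ifs with hi
  · refine ((h.fst _ (by omega) (by omega)).mul
      (h.prod_dev (by omega) _ (fun k => k) fun k hk => ?_)).div
      (h.prod_dev (by omega) _ (fun k => k) fun k hk => ?_) (hn.prod_dev_ne (by omega) fun k hk => ?_)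
      <;> rw [Finset.mem_range] at hk <;> omega
  · exact tendsto_const_nhds

theorem TendstoArray.bPrev (h : TendstoArray l Φa Φ) (hn : Φ.Nondeg) (i : ℕ) :
    Filter.Tendsto (fun a => (Φa a).bPrev i) l (𝓝 (Φ.bPrev i)) := by
  cases i with
  | zero => exact tendsto_const_nhds
  | succ i => exact h.b hn i

theorem TendstoArray.c (h : TendstoArray l Φa Φ) (hn : Φ.Nondeg) (i : ℕ) :
    Filter.Tendsto (fun a => (Φa a).c i) l (𝓝 (Φ.c i)) := by
  unfold ParamArray.c
  simp only [h.diam]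
  split_ifs with hi
  · refine ((h.snd _ (by omega) (by omega)).mul
      (h.prod_dev (by omega) _ (fun k => Φ.diam - k) fun k hk => ?_)).div
      (h.prod_dev (by omega) _ (fun k => Φ.diam - k) fun k hk => ?_) ?_
    · omega
    · omega
    · refine Finset.prod_ne_zero_iff.2 fun k hk => sub_ne_zero.2
        (hn.dev_ne _ _ (by omega) (by omega) ?_)
      rw [Finset.mem_range] at hk
      omega
  · exact tendsto_const_nhds

theorem TendstoArray.a (h : TendstoArray l Φa Φ) (hn : Φ.Nondeg) {i : ℕ} (hi : i ≤ Φ.diam) :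
    Filter.Tendsto (fun a => (Φa a).a i) l (𝓝 (Φ.a i)) := by
  unfold ParamArray.a
  simp only [h.diam]
  refine ((h.ev i hi).add ?_).add ?_
  · split_ifs with h1
    · exact (h.fst i h1 hi).div (h.dev_sub hi (by omega))
        (sub_ne_zero.2 (hn.dev_ne _ _ hi (by omega) (by omega)))
    · exact tendsto_const_nhds
  · split_ifs with h1
    · exact (h.fst _ (by omega) (by omega)).div (h.dev_sub hi (by omega))
        (sub_ne_zero.2 (hn.dev_ne _ _ hi (by omega) (by omega)))
    · exact tendsto_const_nhds

theorem TendstoArray.u (h : TendstoArray l Φa Φ) (hn : Φ.Nondeg) {i x : ℕ} (hi : i ≤ Φ.diam)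
    (hx : x ≤ Φ.diam) :
    Filter.Tendsto (fun a => (Φa a).u i ((Φa a).ev x)) l (𝓝 (Φ.u i (Φ.ev x))) := by
  unfold ParamArray.u
  refine tendsto_finsetSum _ fun k hk => tendsto_finsetProd _ fun j hj => ?_
  rw [Finset.mem_range] at hk hj
  exact (((h.ev x hx).sub (h.ev j (by omega))).mul (h.dev_sub hi (by omega))).div
    (h.fst _ (by omega) (by omega)) (hn.fst_ne _ (by omega) (by omega))

theorem TendstoArray.k (h : TendstoArray l Φa Φ) (hn : Φ.Nondeg) {i : ℕ} (hi : i ≤ Φ.diam) :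
    Filter.Tendsto (fun a => (Φa a).k i) l (𝓝 (Φ.k i)) := by
  unfold ParamArray.k
  simp only [h.diam]
  refine ((tendsto_finsetProd _ fun k hk => ?_).mul
    (h.prod_dev (Nat.zero_le _) _ (fun k => k) fun k hk => ?_)).div
    (h.prod_dev hi _ (fun k => k) fun k hk => ?_) (hn.prod_dev_ne hi fun k hk => ?_)
  · rw [Finset.mem_Icc] at hk
    exact (h.fst _ (by omega) (by omega)).div (h.snd _ (by omega) (by omega))
      (hn.snd_ne _ (by omega) (by omega))
  · rw [Finset.mem_Icc] at hk; omega
  · rw [Finset.mem_erase, Finset.mem_range] at hk; omega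
  · rw [Finset.mem_erase, Finset.mem_range] at hk; omega

theorem TendstoArray.nu (h : TendstoArray l Φa Φ) (hn : Φ.Nondeg) :
    Filter.Tendsto (fun a => (Φa a).nu) l (𝓝 Φ.nu) := by
  unfold ParamArray.nu
  simp only [h.diam]
  refine tendsto_finsetProd _ fun k hk => ?_
  rw [Finset.mem_Icc] at hk
  exact (((h.ev _ (by omega)).sub (h.ev _ (by omega))).mul
    (h.dev_sub (Nat.zero_le _) (by omega))).div (h.snd _ (by omega) (by omega))
      (hn.snd_ne _ (by omega) (by omega))

theorem TendstoArray.p (h : TendstoArray l Φa Φ) (hn : Φ.Nondeg) (x i : ℕ) :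
    Filter.Tendsto (fun a => (Φa a).p x i) l (𝓝 (Φ.p x i)) := by
  unfold ParamArray.p
  simp only [h.diam]
  split_ifs with hi
  · exact (h.k hn hi.2).mul (h.u hn hi.2 hi.1)
  · exact tendsto_const_nhds

/-- The recurrence is an equation between continuous expressions. For `i = d` the possibly
ill-behaved `u_{d+1}` is multiplied by `b_d = 0` throughout. -/
theorem TendstoArray.isRec [l.NeBot] (h : TendstoArray l Φa Φ) (hn : Φ.Nondeg)
    (hr : ∀ᶠ a in l, (Φa a).Rec) : Φ.Rec := by
  intro i x hi hx
  have hb : Filter.Tendsto (fun a => (Φa a).b i * (Φa a).u (i + 1) ((Φa a).ev x)) l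
      (𝓝 (Φ.b i * Φ.u (i + 1) (Φ.ev x))) := by
    rcases hi.lt_or_eq with h1 | h1
    · exact (h.b hn i).mul (h.u hn h1 hx)
    · have : ∀ a, (Φa a).b i = 0 := fun a => ParamArray.b_eq_zero (by rw [h.diam a]; omega)
      simp only [this, ParamArray.b_eq_zero h1.ge, zero_mul]
      exact tendsto_const_nhds
  refine tendsto_nhds_unique ((h.ev x hx).mul (h.u hn hi hx)) (Filter.Tendsto.congr' ?_
    ((((h.c hn i).mul (h.u hn (i := i - 1) (by omega) hx)).add
      ((h.a hn hi).mul (h.u hn hi hx))).add hb))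
  filter_upwards [hr] with a ha
  exact (ha i x (by rw [h.diam]; exact hi) (by rw [h.diam]; exact hx)).symm

theorem TendstoArray.good [l.NeBot] (h : TendstoArray l Φa Φ) (hn : Φ.Nondeg)
    (hg : ∀ᶠ a in l, (Φa a).Good) : Φ.Good where
  toNondeg := hn
  recur := h.isRec hn (hg.mono fun _ ha => ha.recur)
  recur_star := h.star.isRec hn.star (hg.mono fun _ ha => ha.recur_star)

end Limits

section FamilyLimits

variable {α : Type*} {l : Filter α} {N : ℕ} {Φa Ψa : α → ℕ → ParamArray} {Φ Ψ : ℕ → ParamArray}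

theorem tendsto_wt_mul_p (hΦ : ∀ j ≤ N, TendstoArray l (fun a => Φa a j) (Φ j))
    (hΨ : ∀ x ≤ N, TendstoArray l (fun a => Ψa a x) (Ψ x)) (hG : GoodFamilies N Φ Ψ) (ε' : ℤ)
    {i j x : ℕ} (hj : j ≤ N) (hx : x ≤ N) :
    Filter.Tendsto (fun a => (Ψa a x).wt ε' j * (Φa a j).p x i) l
      (𝓝 ((Ψ x).wt ε' j * (Φ j).p x i)) := by
  by_cases hxj : x + j ≤ N
  · refine Filter.Tendsto.mul ?_ ((hΦ j hj).p (hG.goodΦ j hj).toNondeg x i)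
    have hn := (hG.goodΨ x hx).toNondeg
    unfold ParamArray.wt
    split_ifs
    · exact (hΨ x hx).c hn _
    · exact (hΨ x hx).a hn (by rw [hG.diamΨ x hx]; omega)
    · exact (hΨ x hx).bPrev hn _
  · have h1 : (Φ j).diam < x := by rw [hG.diamΦ j hj]; omega
    have h2 : ∀ a, (Φa a j).p x i = 0 := fun a => ParamArray.p_of_lt_left (by
      rw [(hΦ j hj).diam a]; exact h1)
    simp only [h2, ParamArray.p_of_lt_left h1, mul_zero]
    exact tendsto_const_nhds

/-- The orthogonality expression for the coefficients has a limit by itself, so convergence of the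
explicit Hahn coefficients follows without evaluating them. -/
theorem tendsto_coefC (hΦ : ∀ j ≤ N, TendstoArray l (fun a => Φa a j) (Φ j))
    (hΨ : ∀ x ≤ N, TendstoArray l (fun a => Ψa a x) (Ψ x)) (hG : GoodFamilies N Φ Ψ)
    {ε ε' : ℤ} {i j : ℕ} (h : CoefIndex N ε ε' i j) :
    Filter.Tendsto (fun a => coefC N (Φa a) (Ψa a) ε ε' i j) l (𝓝 (coefC N Φ Ψ ε ε' i j)) := by
  obtain ⟨-, hij, h1, h2, h3⟩ := h
  have hJ : ((j : ℤ) + ε').toNat ≤ N := by omega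
  unfold coefC
  refine Filter.Tendsto.div (tendsto_finsetSum _ fun x hx => ?_)
    ((hΦ _ hJ).nu (hG.goodΦ _ hJ).toNondeg) (hG.goodΦ _ hJ).nu_ne
  exact ((hΦ _ hJ).star.p (hG.goodΦ _ hJ).toNondeg.star _ _).mul
    (tendsto_wt_mul_p hΦ hΨ hG ε' (by omega) (Finset.mem_range_succ_iff.1 hx))

theorem SolvesC.of_tendsto [l.NeBot] (hΦ : ∀ j ≤ N, TendstoArray l (fun a => Φa a j) (Φ j))
    (hΨ : ∀ x ≤ N, TendstoArray l (fun a => Ψa a x) (Ψ x)) (hG : GoodFamilies N Φ Ψ)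
    {Ca : α → ℤ → ℤ → ℕ → ℕ → ℂ} {C : ℤ → ℤ → ℕ → ℕ → ℂ}
    (hC : ∀ ε ε' i j, CoefIndex N ε ε' i j →
      Filter.Tendsto (fun a => Ca a ε ε' i j) l (𝓝 (C ε ε' i j)))
    (h : ∀ᶠ a in l, SolvesC N (Φa a) (Ψa a) (Ca a)) : SolvesC N Φ Ψ C := by
  rw [solvesC_iff]
  intro ε' hε' i j x hij hx
  refine tendsto_nhds_unique (tendsto_wt_mul_p hΦ hΨ hG ε' (by omega) hx)
    (Filter.Tendsto.congr' (h.mono fun a ha => (solvesC_iff.1 ha ε' hε' i j x hij hx).symm)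
      (tendsto_finsetSum _ fun ε hε => ?_))
  by_cases hc : 0 ≤ (i : ℤ) + ε ∧ 0 ≤ (j : ℤ) + ε' ∧ (i : ℤ) + ε + (j + ε') ≤ N
  · refine (hC ε ε' i j ⟨mem_rootsA2_iff.2 ⟨hε', hε⟩, hij, hc⟩).mul ?_
    unfold zeroExt
    simp only [if_pos hc]
    exact (hΦ _ (by omega)).p (hG.goodΦ _ (by omega)).toNondeg _ _
  · simp only [zeroExt_eq_zero _ hc, mul_zero]
    exact tendsto_const_nhds

/-- The coefficients `D` computed from the arrays. -/
noncomputable def coefD (N : ℕ) (Φ Ψ : ℕ → ParamArray) (ε ε' : ℤ) (x y : ℕ) : ℂ :=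
  coefC N (fun x => (Ψ x).star) (fun j => (Φ j).star) ε' ε y x *
    ((Ψ ((x : ℤ) + ε).toNat).nu / (Ψ x).nu)

theorem SolvesD.eq_coefD {D : ℤ → ℤ → ℕ → ℕ → ℂ} (hG : GoodFamilies N Φ Ψ)
    (h : SolvesD N Φ Ψ D) : CoefEq N D (coefD N Φ Ψ) := by
  intro ε ε' x y hi
  have h1 := ((solvesD_iff hG.nuΨ_ne).1 h).eq_coefC hG.swap ε' ε y x hi.swap
  obtain ⟨-, h2, h3, h4, h5⟩ := hi
  have n1 := hG.nuΨ_ne x (by omega)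
  have n2 := hG.nuΨ_ne ((x : ℤ) + ε).toNat (by omega)
  unfold coefD
  rw [← h1, dualCoef]
  field_simp

theorem tendsto_coefD (hΦ : ∀ j ≤ N, TendstoArray l (fun a => Φa a j) (Φ j))
    (hΨ : ∀ x ≤ N, TendstoArray l (fun a => Ψa a x) (Ψ x)) (hG : GoodFamilies N Φ Ψ)
    {ε ε' : ℤ} {x y : ℕ} (h : CoefIndex N ε ε' x y) :
    Filter.Tendsto (fun a => coefD N (Φa a) (Ψa a) ε ε' x y) l (𝓝 (coefD N Φ Ψ ε ε' x y)) := by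
  have h0 := tendsto_coefC (fun x hx => (hΨ x hx).star) (fun j hj => (hΦ j hj).star) hG.swap h.swap
  obtain ⟨-, h2, h3, h4, h5⟩ := h
  have hx : x ≤ N := by omega
  have hx' : ((x : ℤ) + ε).toNat ≤ N := by omega
  exact h0.mul (((hΨ _ hx').nu (hG.goodΨ _ hx').toNondeg).div
    ((hΨ x hx).nu (hG.goodΨ x hx).toNondeg) (hG.nuΨ_ne x hx))

theorem SolvesD.of_tendsto [l.NeBot] (hΦ : ∀ j ≤ N, TendstoArray l (fun a => Φa a j) (Φ j))
    (hΨ : ∀ x ≤ N, TendstoArray l (fun a => Ψa a x) (Ψ x)) (hG : GoodFamilies N Φ Ψ)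
    {Da : α → ℤ → ℤ → ℕ → ℕ → ℂ} {D : ℤ → ℤ → ℕ → ℕ → ℂ}
    (hD : ∀ ε ε' x y, CoefIndex N ε ε' x y →
      Filter.Tendsto (fun a => Da a ε ε' x y) l (𝓝 (D ε ε' x y)))
    (h : ∀ᶠ a in l, GoodFamilies N (Φa a) (Ψa a) ∧ SolvesD N (Φa a) (Ψa a) (Da a)) :
    SolvesD N Φ Ψ D := by
  rw [solvesD_iff hG.nuΨ_ne]
  refine SolvesC.of_tendsto (fun x hx => (hΨ x hx).star) (fun j hj => (hΦ j hj).star) hG.swap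
    (Ca := fun a => dualCoef (Ψa a) (Da a)) (fun ε' ε y x hi => ?_)
    (h.mono fun a ha => (solvesD_iff ha.1.nuΨ_ne).1 ha.2)
  have hi' := hi.swap
  refine (hD _ _ _ _ hi').mul ?_
  obtain ⟨-, h2, h3, h4, h5⟩ := hi'
  have hx : x ≤ N := by omega
  have hx' : ((x : ℤ) + ε).toNat ≤ N := by omega
  exact ((hΨ x hx).nu (hG.goodΨ x hx).toNondeg).div ((hΨ _ hx').nu (hG.goodΨ _ hx').toNondeg)
    (hG.nuΨ_ne _ hx')

end FamilyLimits

/-- The coefficients are `coefC` and `coefD` of the limit arrays, the weights their structural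
expressions in `k` and `ν`. Eventually along `l` these agree with the explicit Hahn quantities,
which gives convergence; the recurrences, the constraints and the weight condition pass to the limit
because limits are unique. -/
theorem exists_isHahnLimit {N : ℕ} (hN : 0 < N) {α : Type*} {l : Filter α} [l.NeBot]
    {P : α → HahnParams} {Φ Ψ : ℕ → ParamArray}
    (hP : ∀ᶠ a in l, HahnNondeg N (P a).m (P a).r (P a).s)
    (hP' : ∀ᶠ a in l, HahnNondeg N (P a).μ (P a).ρ (P a).σ)
    (hΦ : ∀ j ≤ N, TendstoArray l (fun a => hahnArray N (P a).m (P a).r (P a).s j) (Φ j))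
    (hΨ : ∀ x ≤ N, TendstoArray l (fun a => dualHahnArray N (P a).μ (P a).ρ (P a).σ x) (Ψ x))
    (hΦv : ∀ j ≤ N, (Φ j).IsValid) (hΨv : ∀ x ≤ N, (Ψ x).IsValid)
    (hev : ∀ j, ∀ x : ℕ, (Φ j).ev x = x) {ξ η f g : ℕ → ℂ} (hT : IsDualHahnType N Ψ ξ η f g)
    (hdiam : ∀ j, (Φ j).diam = N - j) :
    ∃ (C D : ℤ → ℤ → ℕ → ℕ → ℂ) (F G : ℕ → ℕ → ℂ),
      GivesFactorizedPair N Φ Ψ C D F G ∧ IsHahnLimit N l P Φ Ψ C D F G := by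
  have hgood : ∀ᶠ a in l, GoodFamilies N (hahnArray N (P a).m (P a).r (P a).s)
      (dualHahnArray N (P a).μ (P a).ρ (P a).σ) := by
    filter_upwards [hP, hP'] with a h h' using hahn_goodFamilies h h'
  have hG : GoodFamilies N Φ Ψ :=
    { diamΦ := fun j _ => hdiam j
      goodΦ := fun j hj => (hΦ j hj).good (hΦv j hj).nondeg (hgood.mono fun a ha => ha.goodΦ j hj)
      diamΨ := hT.diam
      goodΨ := fun x hx => (hΨ x hx).good (hΨv x hx).nondeg (hgood.mono fun a ha => ha.goodΨ x hx)
      ev_eq := fun x j _ => by rw [hev, hev]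
      dev_eq := fun x j h => by rw [hT.dev x (by omega), hT.dev 0 (by omega)] }
  have hnΦ := fun j hj => (hG.goodΦ j hj).toNondeg
  have hnΨ := fun x hx => (hG.goodΨ x hx).toNondeg
  have hC : ∀ ε ε' i j, CoefIndex N ε ε' i j →
      Filter.Tendsto (fun a => hahnC N (P a) ε ε' i j) l (𝓝 (coefC N Φ Ψ ε ε' i j)) := by
    intro ε ε' i j h
    refine (tendsto_coefC hΦ hΨ hG h).congr' ?_
    filter_upwards [hP, hgood] with a h1 h2
    exact ((hahn_solvesC h1).eq_coefC h2 ε ε' i j h).symm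
  have hD : ∀ ε ε' x y, CoefIndex N ε ε' x y →
      Filter.Tendsto (fun a => hahnD N (P a) ε ε' x y) l (𝓝 (coefD N Φ Ψ ε ε' x y)) := by
    intro ε ε' x y h
    refine (tendsto_coefD hΦ hΨ hG h).congr' ?_
    filter_upwards [hP', hgood] with a h1 h2
    exact ((hahn_solvesD h1).eq_coefD h2 ε ε' x y h).symm
  set F : ℕ → ℕ → ℂ := fun x y => (Φ 0).star.k x * (Ψ x).star.k y / (Ψ x).nu with hF
  set G : ℕ → ℕ → ℂ := fun i j => (Ψ 0).k j * (Φ j).k i * (Φ j).nu with hGdef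
  have hFl : ∀ x y, x + y ≤ N → Filter.Tendsto (fun a => hahnF N (P a) x y) l (𝓝 (F x y)) := by
    intro x y hxy
    have hx : x ≤ N := by omega
    refine Filter.Tendsto.congr' ?_
      ((((hΦ 0 (by omega)).star.k (hnΦ 0 (by omega)).star (i := x) ?_).mul
        ((hΨ x hx).star.k (hnΨ x hx).star (i := y) ?_)).div ((hΨ x hx).nu (hnΨ x hx))
        (hG.nuΨ_ne x hx))
    · filter_upwards [hP, hP'] with a h1 h2
      exact (hahnF_eq h1 h2 hxy).symm
    · rw [ParamArray.star_diam, hG.diamΦ 0 (by omega)]; omega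
    · rw [ParamArray.star_diam, hG.diamΨ x hx]; omega
  have hGl : ∀ i j, i + j ≤ N → Filter.Tendsto (fun a => hahnG N (P a) i j) l (𝓝 (G i j)) := by
    intro i j hij
    have hj : j ≤ N := by omega
    refine Filter.Tendsto.congr' ?_
      ((((hΨ 0 (by omega)).k (hnΨ 0 (by omega)) (i := j) ?_).mul
        ((hΦ j hj).k (hnΦ j hj) (i := i) ?_)).mul ((hΦ j hj).nu (hnΦ j hj)))
    · filter_upwards [hP, hP'] with a h1 h2
      exact (hahnG_eq h1 h2 hij).symm
    · rw [hG.diamΨ 0 (by omega)]; omega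
    · rw [hG.diamΦ j hj]; omega
  have hFG : SolvesFG N Φ Ψ F G := by
    constructor
    · intro x y hxy
      refine div_ne_zero (mul_ne_zero ((hnΦ 0 (by omega)).star.k_ne ?_)
        ((hnΨ x (by omega)).star.k_ne ?_)) (hG.nuΨ_ne x (by omega))
      · rw [ParamArray.star_diam, hG.diamΦ 0 (by omega)]; omega
      · rw [ParamArray.star_diam, hG.diamΨ x (by omega)]; omega
    · intro i j x y hij hxy hxj
      have hx : x ≤ N := by omega
      have hj : j ≤ N := by omega
      have d1 : (Φ j).diam = N - j := hG.diamΦ j hj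
      have d2 : (Ψ x).diam = N - x := hG.diamΨ x hx
      have b1 : i ≤ (Φ j).diam := by omega
      have b2 : x ≤ (Φ j).star.diam := by rw [ParamArray.star_diam]; omega
      have b3 : j ≤ (Ψ x).diam := by omega
      have b4 : y ≤ (Ψ x).star.diam := by rw [ParamArray.star_diam]; omega
      refine tendsto_nhds_unique (Filter.Tendsto.mul (Filter.Tendsto.mul
        (((hΦ j hj).k (hnΦ j hj) b1).div ((hΦ j hj).star.k (hnΦ j hj).star b2)
          ((hnΦ j hj).star.k_ne b2))
        (((hΨ x hx).k (hnΨ x hx) b3).div ((hΨ x hx).star.k (hnΨ x hx).star b4)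
          ((hnΨ x hx).star.k_ne b4))) (hFl x y hxy)) (Filter.Tendsto.congr' ?_
        ((hGl i j hij).div (((hΨ x hx).nu (hnΨ x hx)).mul ((hΦ j hj).nu (hnΦ j hj)))
          (mul_ne_zero (hnΨ x hx).nu_ne (hnΦ j hj).nu_ne)))
      filter_upwards [hP, hP'] with a h1 h2
      exact ((hahn_solvesFG h1 h2).eq i j x y hij hxy hxj).symm
  refine ⟨coefC N Φ Ψ, coefD N Φ Ψ, F, G, hG.givesFactorizedPair hN hΦv hΨv ⟨?_, ?_, hFG⟩
    (hT.degree hG fun x _ => hev 0 x), hΦ, hΨ, hC, hD, hFl, hGl, fun i j x y hij hxy => ?_⟩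
  · exact SolvesC.of_tendsto hΦ hΨ hG hC (hP.mono fun a h => hahn_solvesC h)
  · refine SolvesD.of_tendsto hΦ hΨ hG hD ?_
    filter_upwards [hgood, hP'] with a h1 h2 using ⟨h1, hahn_solvesD h2⟩
  · refine Filter.Tendsto.congr' ?_ (((hΦ j (by omega)).p (hnΦ j (by omega)) x i).mul
      ((hΨ x (by omega)).p (hnΨ x (by omega)) y j))
    filter_upwards [hP, hP'] with a h1 h2
    exact tratnik_hahn h1 h2 hij hxy

/-! ### Krawtchouk arrays as limits -/

section Krawtchouk

variable {N : ℕ} {r : ℂ}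

theorem krawtchoukArray_isValid (h0 : r ≠ 0) (h1 : r ≠ 1) {j : ℕ} (hj : j ≤ N) :
    (krawtchoukArray N r j).IsValid := by
  have e (x : ℕ) : (x : ℂ) - N + j - 1 = x - ((N - j : ℕ) : ℂ) - 1 := by
    rw [Nat.cast_sub hj]; ring
  have key : ∀ i : ℕ, 1 ≤ i → i ≤ N - j →
      ∑ h ∈ Finset.range i, ((h : ℂ) - ((N - j - h : ℕ) : ℂ)) /
        (((0 : ℕ) : ℂ) - ((N - j : ℕ) : ℂ)) =
      i * (((N - j : ℕ) : ℂ) - i + 1) / ((N - j : ℕ) : ℂ) := fun i hi hi' =>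
    sum_linear_ratio (θ := fun h => (h : ℂ)) (by omega)
      (fun h hh => linear_ratio (by omega) hh) hi'
  constructor
  · intro i k _ _ hik
    exact Nat.cast_injective.ne hik
  · intro i k _ _ hik
    exact Nat.cast_injective.ne hik
  · intro i hi hi'
    simp only [krawtchoukArray, e] at hi' ⊢
    exact mul_ne_zero (mul_ne_zero h0 (natCast_pos_ne hi)) (natCast_sub_sub_one_ne hi')
  · intro i hi hi'
    simp only [krawtchoukArray, e] at hi' ⊢
    exact mul_ne_zero (mul_ne_zero (sub_ne_zero.2 h1) (natCast_pos_ne hi))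
      (natCast_sub_sub_one_ne hi')
  · intro i hi hi'
    simp only [krawtchoukArray, e] at hi' ⊢
    have hd := natCast_pos_ne (hi.trans hi')
    rw [key i hi hi', Nat.cast_sub hi]
    push_cast
    field_simp
    ring
  · intro i hi hi'
    simp only [krawtchoukArray, e] at hi' ⊢
    have hd := natCast_pos_ne (hi.trans hi')
    rw [key i hi hi', Nat.cast_add, Nat.cast_sub hi']
    push_cast
    field_simp
    ring
  · refine ⟨3, fun i hi _ => ?_⟩
    simp only [krawtchoukArray]
    obtain ⟨k, rfl⟩ := Nat.exists_eq_add_of_le' hi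
    rw [show k + 2 - 2 = k by omega, show k + 2 - 1 = k + 1 by omega]
    push_cast
    constructor <;> · rw [div_eq_iff (by ring_nf; norm_num)]; ring

theorem hahnArray_isValid {m s : ℂ} (h : HahnNondeg N m r s) {j : ℕ} (hj : j ≤ N) :
    (hahnArray N m r s j).IsValid :=
  hahnArray_eq hj m r s ▸ hahnBase_isValid (h.shift hj)

theorem dualHahnArray_isValid {m s : ℂ} (h : HahnNondeg N m r s) {x : ℕ} (hx : x ≤ N) :
    (dualHahnArray N m r s x).IsValid :=
  dualHahnArray_eq hx m r s ▸ dualBase_isValid (h.shift hx)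

/-- After the substitutions `s = 1/m`, `r → r/m` all varying entries are affine in `m` away from
`0`, with the Krawtchouk value as constant term. -/
theorem tendsto_nhdsNE_zero_of_affine {f : ℂ → ℂ} {A : ℂ} (B : ℂ)
    (h : ∀ m, m ≠ 0 → f m = A + m * B) : Filter.Tendsto f (𝓝[≠] 0) (𝓝 A) := by
  have h1 : Filter.Tendsto (fun m : ℂ => A + m * B) (𝓝 0) (𝓝 A) := by
    have : Continuous fun m : ℂ => A + m * B := by fun_prop
    simpa using this.tendsto 0
  refine (h1.mono_left nhdsWithin_le_nhds).congr' ?_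
  filter_upwards [self_mem_nhdsWithin] with m hm using (h m hm).symm

theorem tendstoArray_hahn_krawtchouk (N : ℕ) (r : ℂ) (j : ℕ) :
    TendstoArray (𝓝[≠] (0 : ℂ)) (fun m => hahnArray N m (r / m) (1 / m) j)
      (krawtchoukArray N r j) where
  diam _ := rfl
  ev _ _ := tendsto_const_nhds
  dev i _ := tendsto_nhdsNE_zero_of_affine (i * (i + 1 + j)) fun m hm => by
    simp only [hahnArray, krawtchoukArray]
    field_simp
    ring
  fst i _ _ := tendsto_nhdsNE_zero_of_affine (i * (i - N + j - 1) * i) fun m hm => by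
    simp only [hahnArray, krawtchoukArray]
    field_simp
    ring
  snd i _ _ := tendsto_nhdsNE_zero_of_affine (-i * (i - N + j - 1) * (i + j)) fun m hm => by
    simp only [hahnArray, krawtchoukArray]
    field_simp
    ring

theorem tendstoArray_dualHahn_krawtchouk (N : ℕ) (r : ℂ) (x : ℕ) :
    TendstoArray (𝓝[≠] (0 : ℂ)) (fun m => dualHahnArray N m (r / m) (1 / m) x)
      (krawtchoukArray N r x) where
  diam _ := rfl
  ev i _ := tendsto_nhdsNE_zero_of_affine (i * (i + 1 + x)) fun m hm => by
    simp only [dualHahnArray, krawtchoukArray]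
    field_simp
    ring
  dev _ _ := tendsto_const_nhds
  fst i _ _ := tendsto_nhdsNE_zero_of_affine (i * (i - N + x - 1) * i) fun m hm => by
    simp only [dualHahnArray, krawtchoukArray]
    field_simp
    ring
  snd i _ _ := tendsto_nhdsNE_zero_of_affine (i * (i - N + x - 1) * (i - N - 1)) fun m hm => by
    simp only [dualHahnArray, krawtchoukArray]
    field_simp
    ring

theorem eventually_div_add_natCast_ne_zero {c : ℂ} (hc : c ≠ 0) (n : ℕ) :
    ∀ᶠ m in 𝓝[≠] (0 : ℂ), c / m + n ≠ 0 := by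
  have h : ∀ᶠ m in 𝓝 (0 : ℂ), c + m * n ≠ 0 :=
    ContinuousAt.eventually_ne (by fun_prop) (by simpa using hc)
  filter_upwards [h.filter_mono nhdsWithin_le_nhds, self_mem_nhdsWithin] with m h1 hm h2
  have hm' : m ≠ 0 := hm
  apply h1
  field_simp at h2
  linear_combination h2

/-- Near `0` the three terms `r/m`, `(1 - r)/m`, `1/m` avoid the finitely many integers `-n` in
question. This is where `r ≠ 0` and `r ≠ 1` enter. -/
theorem eventually_hahnNondeg (N : ℕ) (h0 : r ≠ 0) (h1 : r ≠ 1) :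
    ∀ᶠ m in 𝓝[≠] (0 : ℂ), HahnNondeg N m (r / m) (1 / m) := by
  have key (c : ℂ) (hc : c ≠ 0) : ∀ᶠ m in 𝓝[≠] (0 : ℂ),
      ∀ n ∈ Finset.range (2 * N + 1), c / m + n ≠ 0 :=
    (Filter.eventually_all_finset _).2 fun n _ => eventually_div_add_natCast_ne_zero hc n
  filter_upwards [self_mem_nhdsWithin, key r h0, key (1 - r) (sub_ne_zero.2 h1.symm),
    key 1 one_ne_zero] with m hm k1 k2 k3
  refine ⟨hm, fun n _ hn => k1 n (Finset.mem_range.2 (by omega)), fun n _ hn => ?_,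
    fun n _ hn => k3 n (Finset.mem_range.2 (by omega))⟩
  rw [← sub_div]
  exact k2 n (Finset.mem_range.2 (by omega))

end Krawtchouk

/-! ### The main theorem -/

theorem mainTheorem2 (N : ℕ) (hN : 0 < N) :
    -- Hahn / dual Hahn
    (∀ m r s μ ρ σ : ℂ, HahnNondeg N m r s → HahnNondeg N μ ρ σ →
      GivesFactorizedPair N (hahnArray N m r s) (dualHahnArray N μ ρ σ)
        (hahnC N ⟨m, r, s, μ, ρ, σ⟩) (hahnD N ⟨m, r, s, μ, ρ, σ⟩)
        (hahnF N ⟨m, r, s, μ, ρ, σ⟩) (hahnG N ⟨m, r, s, μ, ρ, σ⟩) ∧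
      (∀ i j x y : ℕ, i + j ≤ N → x + y ≤ N →
        tratnik (hahnArray N m r s) (dualHahnArray N μ ρ σ) i j x y
          = hahnT N ⟨m, r, s, μ, ρ, σ⟩ i j x y) ∧
      (∀ i j : ℕ, i + j ≤ N →
        (hahnArray N m r s j).a i = hahnA N r s j i ∧
        (hahnArray N m r s j).b i = hahnB N r s j i ∧
        (hahnArray N m r s j).c i = hahnCc N r s j i) ∧
      (∀ j x : ℕ, j + x ≤ N →
        (dualHahnArray N μ ρ σ x).a j
          = -(dualHahnArray N μ ρ σ x).b j - (dualHahnArray N μ ρ σ x).c j ∧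
        (dualHahnArray N μ ρ σ x).b j = μ * (j - N + x) * (j + 1 + ρ) ∧
        (dualHahnArray N μ ρ σ x).c j = μ * j * (j - N - 1 + ρ - σ)) ∧
      (∀ x : ℕ, x + 1 ≤ N →
        (dualHahnArray N μ ρ σ (x + 1)).nu / (dualHahnArray N μ ρ σ x).nu
          = nuRatio ρ σ 1 x ∧
        (dualHahnArray N μ ρ σ x).nu / (dualHahnArray N μ ρ σ (x + 1)).nu
          = nuRatio ρ σ (-1) (x + 1))) ∧
    -- Krawtchouk / dual Hahn
    (∀ r μ ρ σ : ℂ, r ≠ 0 → r ≠ 1 → HahnNondeg N μ ρ σ →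
      ∃ (C D : ℤ → ℤ → ℕ → ℕ → ℂ) (F G : ℕ → ℕ → ℂ),
        GivesFactorizedPair N (krawtchoukArray N r) (dualHahnArray N μ ρ σ) C D F G ∧
        IsHahnLimit N (𝓝[≠] (0 : ℂ)) (fun m => ⟨m, r / m, 1 / m, μ, ρ, σ⟩)
          (krawtchoukArray N r) (dualHahnArray N μ ρ σ) C D F G) ∧
    -- Hahn / Krawtchouk
    (∀ m r s ρ : ℂ, HahnNondeg N m r s → ρ ≠ 0 → ρ ≠ 1 →
      ∃ (C D : ℤ → ℤ → ℕ → ℕ → ℂ) (F G : ℕ → ℕ → ℂ),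
        GivesFactorizedPair N (hahnArray N m r s) (krawtchoukArray N ρ) C D F G ∧
        IsHahnLimit N (𝓝[≠] (0 : ℂ)) (fun μ => ⟨m, r, s, μ, ρ / μ, 1 / μ⟩)
          (hahnArray N m r s) (krawtchoukArray N ρ) C D F G) ∧
    -- Krawtchouk / Krawtchouk
    (∀ r ρ : ℂ, r ≠ 0 → r ≠ 1 → ρ ≠ 0 → ρ ≠ 1 →
      ∃ (C D : ℤ → ℤ → ℕ → ℕ → ℂ) (F G : ℕ → ℕ → ℂ),
        GivesFactorizedPair N (krawtchoukArray N r) (krawtchoukArray N ρ) C D F G ∧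
        IsHahnLimit N ((𝓝[≠] (0 : ℂ)) ×ˢ (𝓝[≠] (0 : ℂ)))
          (fun a => ⟨a.1, r / a.1, 1 / a.1, a.2, ρ / a.2, 1 / a.2⟩)
          (krawtchoukArray N r) (krawtchoukArray N ρ) C D F G) := by
  refine ⟨fun m r s μ ρ σ h h' => ⟨?_, fun i j x y hij hxy => tratnik_hahn h h' hij hxy,
    fun i j hij => ⟨hahnArray_a h hij, hahnArray_b h hij, hahnArray_c h hij⟩,
    fun j x hjx => ⟨dualHahnArray_a hjx, dualHahnArray_b hjx, dualHahnArray_c hjx⟩,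
    fun x hx => ⟨nu_ratio_succ h' hx, nu_ratio_pred h' hx⟩⟩, ?_, ?_, ?_⟩
  · have hG := hahn_goodFamilies h h'
    exact hG.givesFactorizedPair hN (fun j hj => hahnArray_isValid h hj)
      (fun x hx => dualHahnArray_isValid h' hx)
      ⟨hahn_solvesC h, hahn_solvesD h', hahn_solvesFG h h'⟩
      ((dualHahn_isDualHahnType h').degree hG fun _ _ => rfl)
  · intro r μ ρ σ h0 h1 h'
    exact exists_isHahnLimit hN (eventually_hahnNondeg N h0 h1) (.of_forall fun _ => h')
      (fun j _ => tendstoArray_hahn_krawtchouk N r j)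
      (fun x _ => TendstoArray.const (dualHahnArray N μ ρ σ x))
      (fun j hj => krawtchoukArray_isValid h0 h1 hj) (fun x hx => dualHahnArray_isValid h' hx)
      (fun _ _ => rfl) (dualHahn_isDualHahnType h') (fun _ => rfl)
  · intro m r s ρ h h0 h1
    exact exists_isHahnLimit hN (.of_forall fun _ => h) (eventually_hahnNondeg N h0 h1)
      (fun j _ => TendstoArray.const (hahnArray N m r s j))
      (fun x _ => tendstoArray_dualHahn_krawtchouk N ρ x)
      (fun j hj => hahnArray_isValid h hj) (fun x hx => krawtchoukArray_isValid h0 h1 hx)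
      (fun _ _ => rfl) (krawtchouk_isDualHahnType h0 h1) (fun _ => rfl)
  · intro r ρ h0 h1 h0' h1'
    -- Each family depends on one coordinate only, so its limit is pulled back from the factor
    -- filter along a projection.
    exact exists_isHahnLimit hN
      (Filter.tendsto_fst.eventually (eventually_hahnNondeg N h0 h1))
      (Filter.tendsto_snd.eventually (eventually_hahnNondeg N h0' h1'))
      (fun j _ => (tendstoArray_hahn_krawtchouk N r j).comp Filter.tendsto_fst)
      (fun x _ => (tendstoArray_dualHahn_krawtchouk N ρ x).comp Filter.tendsto_snd)
      (fun j hj => krawtchoukArray_isValid h0 h1 hj)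
      (fun x hx => krawtchoukArray_isValid h0' h1' hx)
      (fun _ _ => rfl) (krawtchouk_isDualHahnType h0' h1') (fun _ => rfl)
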